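/- Let $N\ge 1$, $1\le p<\infty$ and $\gamma\in\mathbb R\setminus\{0\}$. Let $\nu_\gamma$ be the measure on $\mathbb R^N\times\mathbb R^N$ given by $\nu_\gamma(E)=\iint_{(x,y)\in E,\,x\ne y}|x-y|^{\gamma-N}\,dx\,dy$, and for measurable $u:\mathbb R^N\to\mathbb R$, $b\in\mathbb R$ and $\lambda>0$ let $$E_{\lambda,b}[u]=\Big\{(x,y)\in\mathbb R^N\times\mathbb R^N:\ x\ne y,\ \frac{|u(x)-u(y)|}{|x-y|^{1+b}}>\lambda\Big\}.$$ Let $\dot W^{1,p}(\mathbb R^N)$ be the space of real-valued $u\in L^1_{\rm loc}(\mathbb R^N)$ whose distributional gradient $\nabla u$ belongs to $L^p(\mathbb R^N)$, with the seminorm $\|\nabla u\|_{L^p(\mathbb R^N)}$, and let $\kappa(p,N)=\int_{\mathbb S^{N-1}}|e\cdot\omega|^p\,d\omega$, where $e$ is any unit vector in $\mathbb R^N$ and $d\omega$ is the surface measure. (a) If $\gamma>0$, then for all $u\in\dot W^{1,p}(\mathbb R^N)$ $$\lim_{\lambda\to+\infty}\lambda^p\,\nu_\gamma(E_{\lambda,\gamma/p}[u])=\frac{\kappa(p,N)}{|\gamma|}\,\|\nabla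 u\|_{L^p(\mathbb R^N)}^p.$$ (b) If either $\gamma<0$ and $p>1$, or $\gamma<-1$ and $p=1$, then for all $u\in\dot W^{1,p}(\mathbb R^N)$ $$\lim_{\lambda\searrow 0}\lambda^p\,\nu_\gamma(E_{\lambda,\gamma/p}[u])=\frac{\kappa(p,N)}{|\gamma|}\,\|\nabla u\|_{L^p(\mathbb R^N)}^p.\qquad(*)$$ (c) If $p=1$ and $-1\le\gamma<0$, then $(*)$ holds for all $u\in C^1_c(\mathbb R^N)$, but it fails for generic $u\in\dot W^{1,1}(\mathbb R^N)$ in the sense of Baire category: the set of $u\in\dot W^{1,1}(\mathbb R^N)$ for which $(*)$ holds is meager in $\dot W^{1,1}(\mathbb R^N)$, with the topology given by the seminorm $\|\nabla u\|_{L^1(\mathbb R^N)}$. However, for all $u\in\dot W^{1,1}(\mathbb R^N)$ $$\liminf_{\lambda\searrow 0}\lambda\,\nu_\gamma(E_{\lambda,\gamma}[u])\ge\frac{\kappa(1,N)}{|\gamma|}\,\|\nabla u\|_{L^1(\mathbb R^N)}.$$ -/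

import Mathlib

open MeasureTheory Filter Topology
open scoped ENNReal NNReal ContDiff

noncomputable section

namespace WeightedReverse

/-- Euclidean space `ℝ^N`. -/
abbrev Euc (N : ℕ) : Type := EuclideanSpace ℝ (Fin N)

/-- The measure `ν_γ` on `ℝ^N × ℝ^N`, with density `|x - y|^(γ - N)` on `{x ≠ y}` with respect to
Lebesgue measure. -/
def nu (N : ℕ) (γ : ℝ) : Measure (Euc N × Euc N) :=
  ((volume : Measure (Euc N × Euc N)).restrict {z | z.1 ≠ z.2}).withDensity
    (fun z => ENNReal.ofReal (‖z.1 - z.2‖ ^ (γ - (N : ℝ))))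

/-- The difference quotient `Q_b u(x, y) = (u(x) - u(y)) / |x - y|^(1 + b)`. -/
def diffQuot {N : ℕ} (b : ℝ) (u : Euc N → ℝ) (x y : Euc N) : ℝ :=
  (u x - u y) / ‖x - y‖ ^ (1 + b)

/-- The superlevel set `E_{lam, b}[u]`. -/
def superlevel {N : ℕ} (lam b : ℝ) (u : Euc N → ℝ) : Set (Euc N × Euc N) :=
  {z | z.1 ≠ z.2 ∧ lam < |diffQuot b u z.1 z.2|}

/-- The quantity `lam^p ν_γ(E_{lam, γ/p}[u])`, with values in `[0, ∞]`. -/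
def levelFunctional {N : ℕ} (p γ : ℝ) (u : Euc N → ℝ) (lam : ℝ) : ℝ≥0∞ :=
  ENNReal.ofReal (lam ^ p) * nu N γ (superlevel lam (γ / p) u)

/-- `∫_{S^{N-1}} |e · θ|^p dθ` for the surface measure on the unit sphere; for a unit vector `e`
this is the constant `κ(p, N)`. -/
def kappa {N : ℕ} (p : ℝ) (e : Euc N) : ℝ :=
  ∫ θ : Metric.sphere (0 : Euc N) 1, |inner ℝ e (θ : Euc N)| ^ p
    ∂((volume : Measure (Euc N)).toSphere)

/-- The locally integrable vector field `g` is the distributional gradient of the locally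
integrable function `u`. -/
structure HasWeakGradient {N : ℕ} (u : Euc N → ℝ) (g : Euc N → Euc N) : Prop where
  locallyIntegrable : LocallyIntegrable u volume
  locallyIntegrable_grad : LocallyIntegrable g volume
  integral_eq : ∀ φ : Euc N → ℝ, ContDiff ℝ ∞ φ → HasCompactSupport φ →
    ∫ x, u x • gradient φ x = -∫ x, φ x • g x

open Classical in
/-- The distributional gradient of `u` (unique almost everywhere); zero if there is none that is a
locally integrable vector field. -/
def weakGrad {N : ℕ} (u : Euc N → ℝ) : Euc N → Euc N :=
  if h : ∃ g, HasWeakGradient u g then h.choose else 0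

/-- `‖∇u‖_{L^p(ℝ^N)}`. -/
def gradNorm {N : ℕ} (p : ℝ≥0∞) (u : Euc N → ℝ) : ℝ≥0∞ :=
  eLpNorm (weakGrad u) p volume

/-- `u` belongs to the homogeneous Sobolev space: it is locally integrable and its distributional
gradient is in `L^p`. -/
def MemHomSobolev {N : ℕ} (p : ℝ≥0∞) (u : Euc N → ℝ) : Prop :=
  ∃ g : Euc N → Euc N, HasWeakGradient u g ∧ MemLp g p volume

section Basic

variable {N : ℕ}

theorem continuous_gradient {φ : Euc N → ℝ} (hφ : ContDiff ℝ ∞ φ) :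
    Continuous (gradient φ) :=
  (InnerProductSpace.toDual ℝ (Euc N)).symm.continuous.comp
    (hφ.continuous_fderiv (by simp))

theorem hasCompactSupport_gradient {φ : Euc N → ℝ} (hφ : HasCompactSupport φ) :
    HasCompactSupport (gradient φ) :=
  (hφ.fderiv (𝕜 := ℝ)).comp_left (g := (InnerProductSpace.toDual ℝ (Euc N)).symm) (map_zero _)

theorem integrable_smul_gradient {u φ : Euc N → ℝ} (hu : LocallyIntegrable u volume)
    (hφ : ContDiff ℝ ∞ φ) (hc : HasCompactSupport φ) :
    Integrable (fun x => u x • gradient φ x) volume :=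
  hu.integrable_smul_right_of_hasCompactSupport (continuous_gradient hφ)
    (hasCompactSupport_gradient hc)

theorem integrable_smul_field {φ : Euc N → ℝ} {g : Euc N → Euc N}
    (hg : LocallyIntegrable g volume)
    (hφ : ContDiff ℝ ∞ φ) (hc : HasCompactSupport φ) :
    Integrable (fun x => φ x • g x) volume :=
  hg.integrable_smul_left_of_hasCompactSupport hφ.continuous hc

theorem HasWeakGradient.add {u v : Euc N → ℝ} {g h : Euc N → Euc N}
    (hu : HasWeakGradient u g) (hv : HasWeakGradient v h) :
    HasWeakGradient (u + v) (g + h) := by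
  refine ⟨hu.1.add hv.1, hu.2.add hv.2, fun φ hφ hc => ?_⟩
  simp only [Pi.add_apply, add_smul, smul_add]
  rw [integral_add (integrable_smul_gradient hu.1 hφ hc) (integrable_smul_gradient hv.1 hφ hc),
    integral_add (integrable_smul_field hu.2 hφ hc) (integrable_smul_field hv.2 hφ hc),
    hu.3 φ hφ hc, hv.3 φ hφ hc, neg_add]

theorem HasWeakGradient.const_smul {u : Euc N → ℝ} {g : Euc N → Euc N}
    (hu : HasWeakGradient u g) (c : ℝ) : HasWeakGradient (c • u) (c • g) := by
  refine ⟨hu.1.smul c, hu.2.smul c, fun φ hφ hc => ?_⟩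
  simp only [Pi.smul_apply, smul_comm _ c, smul_assoc]
  rw [integral_smul, integral_smul, hu.3 φ hφ hc, smul_neg]

theorem HasWeakGradient.zero : HasWeakGradient (0 : Euc N → ℝ) 0 :=
  ⟨locallyIntegrable_zero, locallyIntegrable_zero, fun φ _ _ => by simp⟩

theorem HasWeakGradient.ae_unique {u : Euc N → ℝ} {g h : Euc N → Euc N}
    (hg : HasWeakGradient u g) (hh : HasWeakGradient u h) : g =ᵐ[volume] h :=
  ae_eq_of_integral_contDiff_smul_eq hg.2 hh.2 fun φ hφ hc =>
    neg_injective (by rw [← hg.3 φ hφ hc, ← hh.3 φ hφ hc])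

theorem HasWeakGradient.weakGrad_ae_eq {u : Euc N → ℝ} {g : Euc N → Euc N}
    (hg : HasWeakGradient u g) : weakGrad u =ᵐ[volume] g := by
  have h : ∃ g, HasWeakGradient u g := ⟨g, hg⟩
  rw [weakGrad, dif_pos h]
  exact h.choose_spec.ae_unique hg

theorem HasWeakGradient.gradNorm_eq {u : Euc N → ℝ} {g : Euc N → Euc N}
    (hg : HasWeakGradient u g) (p : ℝ≥0∞) : gradNorm p u = eLpNorm g p volume :=
  eLpNorm_congr_ae hg.weakGrad_ae_eq

theorem gradNorm_zero (p : ℝ≥0∞) : gradNorm p (0 : Euc N → ℝ) = 0 := by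
  rw [HasWeakGradient.zero.gradNorm_eq]
  exact eLpNorm_zero

theorem MemHomSobolev.gradNorm_ne_top {p : ℝ≥0∞} {u : Euc N → ℝ} (hu : MemHomSobolev p u) :
    gradNorm p u ≠ ⊤ := by
  obtain ⟨g, hg, hgp⟩ := hu
  rw [hg.gradNorm_eq]
  exact hgp.2.ne

theorem gradNorm_add_le {p : ℝ≥0∞} (hp : 1 ≤ p) {u v : Euc N → ℝ}
    (hu : MemHomSobolev p u) (hv : MemHomSobolev p v) :
    gradNorm p (u + v) ≤ gradNorm p u + gradNorm p v := by
  obtain ⟨g, hg, hgp⟩ := hu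
  obtain ⟨h, hh, hhp⟩ := hv
  rw [hg.gradNorm_eq, hh.gradNorm_eq, (hg.add hh).gradNorm_eq]
  exact eLpNorm_add_le hgp.1 hhp.1 hp

theorem gradNorm_neg {p : ℝ≥0∞} {u : Euc N → ℝ} (hu : MemHomSobolev p u) :
    gradNorm p (-u) = gradNorm p u := by
  obtain ⟨g, hg, -⟩ := hu
  have h := hg.const_smul (-1)
  rw [neg_one_smul, neg_one_smul] at h
  rw [hg.gradNorm_eq, h.gradNorm_eq, eLpNorm_neg]

end Basic

/-- The vector space of functions in the homogeneous Sobolev space. -/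
def homSobolevSubmodule (N : ℕ) (p : ℝ≥0∞) : Submodule ℝ (Euc N → ℝ) where
  carrier := {u | MemHomSobolev p u}
  add_mem' := by
    rintro u v ⟨g, hg, hgp⟩ ⟨h, hh, hhp⟩
    exact ⟨g + h, hg.add hh, hgp.add hhp⟩
  zero_mem' := ⟨0, HasWeakGradient.zero, MemLp.zero⟩
  smul_mem' := by
    rintro c u ⟨g, hg, hgp⟩
    exact ⟨c • g, hg.const_smul c, hgp.const_smul c⟩

/-- The homogeneous Sobolev space as a type of its own; it is topologized below by the seminorm
`‖∇u‖_{L^p}` (and not by pointwise convergence). -/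
def HomSobolev (N : ℕ) (p : ℝ≥0∞) : Type := ↥(homSobolevSubmodule N p)

instance HomSobolev.instAddCommGroup (N : ℕ) (p : ℝ≥0∞) : AddCommGroup (HomSobolev N p) :=
  inferInstanceAs (AddCommGroup ↥(homSobolevSubmodule N p))

instance HomSobolev.instModule (N : ℕ) (p : ℝ≥0∞) : Module ℝ (HomSobolev N p) :=
  inferInstanceAs (Module ℝ ↥(homSobolevSubmodule N p))

/-- The function underlying an element of the homogeneous Sobolev space. -/
def HomSobolev.toFun {N : ℕ} {p : ℝ≥0∞} (u : HomSobolev N p) : Euc N → ℝ := u.1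

theorem HomSobolev.mem {N : ℕ} {p : ℝ≥0∞} (u : HomSobolev N p) : MemHomSobolev p u.toFun := u.2

/-- The seminorm `‖∇u‖_{L^p}` on the homogeneous Sobolev space. -/
def homSobolevSeminorm (N : ℕ) (p : ℝ≥0∞) [hp : Fact (1 ≤ p)] :
    AddGroupSeminorm (HomSobolev N p) where
  toFun u := (gradNorm p u.toFun).toReal
  map_zero' := by
    change (gradNorm p (0 : Euc N → ℝ)).toReal = 0
    rw [gradNorm_zero, ENNReal.toReal_zero]
  add_le' u v := by
    change (gradNorm p (u.toFun + v.toFun)).toReal ≤ _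
    rw [← ENNReal.toReal_add u.mem.gradNorm_ne_top v.mem.gradNorm_ne_top]
    exact ENNReal.toReal_mono
      (ENNReal.add_ne_top.2 ⟨u.mem.gradNorm_ne_top, v.mem.gradNorm_ne_top⟩)
      (gradNorm_add_le hp.out u.mem v.mem)
  neg' u := by
    change (gradNorm p (-u.toFun)).toReal = _
    exact congrArg ENNReal.toReal (gradNorm_neg u.mem)

instance HomSobolev.instSeminormedAddCommGroup (N : ℕ) (p : ℝ≥0∞) [Fact (1 ≤ p)] :
    SeminormedAddCommGroup (HomSobolev N p) :=
  (homSobolevSeminorm N p).toSeminormedAddCommGroup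

end WeightedReverse

end

/-!
In polar coordinates `h = r • θ`, and with `t` the height `λ * r ^ (γ / p)`, the quantity
`λ ^ p * ν_γ(E)` becomes an integral over the directions `θ` of a functional of the averages of
`∂_θ u` over segments `[x, x + r • θ]`, because `u (x + r • θ) - u x` is `r` times such an average.
The length `r = (t / λ) ^ (p / γ)` tends to `0` in the limit considered, whatever the sign of `γ`.

There the averages converge in measure to `∂_θ u`, so Fatou's lemma gives the lower bound, and the
full limit follows once the functional is controlled by `∫ |∂_θ u| ^ p` uniformly in `λ`. For
`p > 1` truncation at height `t / 2` gives this bound. For `p = 1` and `γ > 0` or `γ < -1` it comes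
from a Vitali covering argument on lines, carried over to `ℝ^N` by transference, and the limit
passes from continuous functions to all of `L¹` by density. For `u` in `C¹_c` dominated convergence
suffices.

For `-1 ≤ γ < 0` the functional is lower semicontinuous, so its sublevel sets are closed. It is
unbounded on functions with bounded energy: for `γ > -1` iterate the operation replacing a ramp by
two half-size copies of it contracted to the ends of the interval, as in the construction of a
Cantor function; for `γ = -1` take steep ramps. By Baire category, finiteness of the upper limit
is exceptional.
-/

noncomputable section

namespace WeightedReverse

/-! ### Segment averages of weak gradients -/

/-- Lebesgue measure on the unit interval `(0, 1]`, as a measure on `ℝ`: the parameter space of the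
segments over which functions are averaged. -/
abbrev unitMeasure : Measure ℝ := volume.restrict (Set.Ioc (0 : ℝ) 1)

instance isProbabilityMeasure_unitMeasure : IsProbabilityMeasure unitMeasure :=
  ⟨by simp [unitMeasure]⟩

/-- The average of `f` over the segment from `x` to `x + h`. The vector `h` comes first, so that
`lineAvg f h` is an averaging operator. -/
def lineAvg {E : Type*} [AddCommGroup E] [Module ℝ E] (f : E → ℝ) (h x : E) : ℝ :=
  ∫ s, f (x + s • h) ∂unitMeasure

section LineAvg

variable {E : Type*} [AddCommGroup E] [Module ℝ E]

theorem lineAvg_const_mul (c : ℝ) (f : E → ℝ) (h x : E) :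
    lineAvg (fun y => c * f y) h x = c * lineAvg f h x :=
  integral_const_mul c _

theorem abs_lineAvg_le {f : E → ℝ} {M : ℝ} (hM : ∀ x, |f x| ≤ M) (h x : E) :
    |lineAvg f h x| ≤ M := by
  simpa [lineAvg] using norm_integral_le_of_norm_le_const (μ := unitMeasure)
    (ae_of_all _ fun s : ℝ => (Real.norm_eq_abs _).trans_le (hM (x + s • h)))

variable [MeasurableSpace E] [MeasurableAdd₂ E] [MeasurableSMul₂ ℝ E] {f : E → ℝ}

theorem measurable_lineAvg_uncurry (hf : Measurable f) :
    Measurable fun z : E × E => lineAvg f z.1 z.2 := by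
  have hm : StronglyMeasurable fun z : (E × E) × ℝ => f (z.1.2 + z.2 • z.1.1) :=
    (hf.comp (by fun_prop)).stronglyMeasurable
  exact (hm.integral_prod_right (ν := unitMeasure)).measurable

theorem measurable_lineAvg (hf : Measurable f) (h : E) : Measurable (lineAvg f h) :=
  (measurable_lineAvg_uncurry hf).comp (measurable_const.prodMk measurable_id)

theorem enorm_lineAvg_rpow_le (hf : Measurable f) {p : ℝ} (hp : 1 ≤ p) (h x : E) :
    ‖lineAvg f h x‖ₑ ^ p ≤ ∫⁻ s, ‖f (x + s • h)‖ₑ ^ p ∂unitMeasure := by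
  have hp0 : 0 < p := by linarith
  have hm : AEStronglyMeasurable (fun s : ℝ => f (x + s • h)) unitMeasure :=
    (hf.comp (by fun_prop)).aestronglyMeasurable
  have hle : ‖lineAvg f h x‖ₑ ≤
      eLpNorm (fun s : ℝ => f (x + s • h)) (ENNReal.ofReal p) unitMeasure := by
    refine (enorm_integral_le_lintegral_enorm _).trans ?_
    rw [← eLpNorm_one_eq_lintegral_enorm]
    exact eLpNorm_le_eLpNorm_of_exponent_le (by simpa using hp) hm
  rw [eLpNorm_eq_lintegral_rpow_enorm_toReal (by simpa using hp0) (by simp),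
    ENNReal.toReal_ofReal hp0.le] at hle
  calc _ ≤ _ := ENNReal.rpow_le_rpow hle hp0.le
    _ = _ := by rw [← ENNReal.rpow_mul, one_div_mul_cancel hp0.ne', ENNReal.rpow_one]

variable {μ : Measure E} [SFinite μ] [μ.IsAddRightInvariant]

theorem lintegral_lintegral_segment {G : E → ℝ≥0∞} (hG : Measurable G) (h : E) :
    ∫⁻ x, ∫⁻ s, G (x + s • h) ∂unitMeasure ∂μ = ∫⁻ x, G x ∂μ := by
  have hm : Measurable fun z : E × ℝ => G (z.1 + z.2 • h) := hG.comp (by fun_prop)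
  rw [lintegral_lintegral_swap hm.aemeasurable]
  simp_rw [lintegral_add_right_eq_self]
  simp

theorem lintegral_lineAvg_rpow_le (hf : Measurable f) {p : ℝ} (hp : 1 ≤ p) (h : E) :
    ∫⁻ x, ‖lineAvg f h x‖ₑ ^ p ∂μ ≤ ∫⁻ x, ‖f x‖ₑ ^ p ∂μ := by
  rw [← lintegral_lintegral_segment (G := fun x => ‖f x‖ₑ ^ p) (by fun_prop) h]
  exact lintegral_mono fun x => enorm_lineAvg_rpow_le hf hp h x

theorem ae_integrable_segment (hf : Measurable f) {p : ℝ} (hp : 1 ≤ p)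
    (hfp : ∫⁻ x, ‖f x‖ₑ ^ p ∂μ ≠ ⊤) (h : E) :
    ∀ᵐ x ∂μ, Integrable (fun s : ℝ => f (x + s • h)) unitMeasure := by
  have hp0 : 0 < p := by linarith
  have hG : Measurable fun x => ‖f x‖ₑ ^ p := by fun_prop
  have hm : Measurable fun x => ∫⁻ s, ‖f (x + s • h)‖ₑ ^ p ∂unitMeasure :=
    Measurable.lintegral_prod_right' (f := fun z : E × ℝ => ‖f (z.1 + z.2 • h)‖ₑ ^ p)
      (hG.comp (by fun_prop : Measurable fun z : E × ℝ => z.1 + z.2 • h))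
  rw [← lintegral_lintegral_segment hG h] at hfp
  filter_upwards [ae_lt_top hm hfp] with x hx
  have hmem : MemLp (fun s : ℝ => f (x + s • h)) (ENNReal.ofReal p) unitMeasure := by
    refine ⟨(hf.comp (by fun_prop)).aestronglyMeasurable, ?_⟩
    rwa [eLpNorm_lt_top_iff_lintegral_rpow_enorm_lt_top (by simpa using hp0) (by simp),
      ENNReal.toReal_ofReal hp0.le]
  exact hmem.integrable (by simpa using hp)

theorem ae_lineAvg_add {f₁ f₂ : E → ℝ} (hf₁ : Measurable f₁) (hf₂ : Measurable f₂)
    {p : ℝ} (hp : 1 ≤ p) (h₁ : ∫⁻ x, ‖f₁ x‖ₑ ^ p ∂μ ≠ ⊤) (h₂ : ∫⁻ x, ‖f₂ x‖ₑ ^ p ∂μ ≠ ⊤)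
    (h : E) :
    ∀ᵐ x ∂μ, lineAvg (fun x => f₁ x + f₂ x) h x = lineAvg f₁ h x + lineAvg f₂ h x := by
  filter_upwards [ae_integrable_segment hf₁ hp h₁ h, ae_integrable_segment hf₂ hp h₂ h]
    with x hx₁ hx₂ using integral_add hx₁ hx₂

theorem measurePreserving_shear (h : E) :
    MeasurePreserving (fun z : E × ℝ => (z.1 + z.2 • h, z.2)) (μ.prod unitMeasure)
      (μ.prod unitMeasure) := by
  have hskew := (MeasurePreserving.id unitMeasure).skew_product (μc := μ) (μd := μ)
    (g := fun (s : ℝ) (x : E) => x + s • h) (by fun_prop)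
    (ae_of_all _ fun s => (measurePreserving_add_right μ (s • h)).map_eq)
  exact Measure.measurePreserving_swap.comp (hskew.comp Measure.measurePreserving_swap)

end LineAvg

section Translation

theorem locallyIntegrable_comp_add_right {E F : Type*} [NormedAddCommGroup E] [MeasurableSpace E]
    [BorelSpace E] {μ : Measure E} [μ.IsAddRightInvariant] [NormedAddCommGroup F] {f : E → F}
    (hf : LocallyIntegrable f μ) (h : E) : LocallyIntegrable (fun x => f (x + h)) μ := by
  intro x
  obtain ⟨s, hs, hi⟩ := hf (x + h)
  refine ⟨(fun x => x + h) ⁻¹' s, (continuous_add_const h).continuousAt hs, ?_⟩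
  exact ((measurePreserving_add_right μ h).integrableOn_comp_preimage
    (measurableEmbedding_addRight h)).2 hi

variable {E : Type*} [NormedAddCommGroup E] [NormedSpace ℝ E] [MeasurableSpace E] [BorelSpace E]
  [SecondCountableTopology E] {μ : Measure E}

theorem integrable_mul_comp_sub_smul {f k : E → ℝ} (hf : LocallyIntegrable f μ)
    (hk : Continuous k) (hc : HasCompactSupport k) (h : E) :
    Integrable (fun z : E × ℝ => k (z.1 - z.2 • h) * f z.1) (μ.prod unitMeasure) := by
  obtain ⟨C, hC⟩ := hk.bounded_above_of_compact_support hc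
  set K : Set E := (fun z : E × ℝ => z.1 + z.2 • h) '' (tsupport k ×ˢ Set.Icc (0 : ℝ) 1)
  have hK : IsCompact K := (hc.isCompact.prod isCompact_Icc).image (by fun_prop)
  have hfK : Integrable (K.indicator f) μ :=
    (hf.integrableOn_isCompact hK).integrable_indicator hK.measurableSet
  refine ((hfK.norm.const_mul C).comp_fst unitMeasure).mono' ?_ ?_
  · exact (hk.comp (by fun_prop : Continuous fun z : E × ℝ =>
      z.1 - z.2 • h)).aestronglyMeasurable.mul hf.aestronglyMeasurable.comp_fst
  · have hs : ∀ᵐ z : E × ℝ ∂μ.prod unitMeasure, z.2 ∈ Set.Ioc (0 : ℝ) 1 :=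
      Measure.quasiMeasurePreserving_snd.ae (ae_restrict_mem measurableSet_Ioc)
    filter_upwards [hs] with z hz
    by_cases hzk : k (z.1 - z.2 • h) = 0
    · rw [hzk, zero_mul, norm_zero]
      exact mul_nonneg ((norm_nonneg _).trans (hC 0)) (norm_nonneg _)
    · have hzK : z.1 ∈ K :=
        ⟨(z.1 - z.2 • h, z.2), ⟨subset_tsupport _ hzk, hz.1.le, hz.2⟩, by simp⟩
      rw [Set.indicator_of_mem hzK, norm_mul]
      gcongr
      exact hC _

variable [SFinite μ] [μ.IsAddRightInvariant]

theorem integral_mul_lineAvg {f φ : E → ℝ} (hf : LocallyIntegrable f μ) (hφ : Continuous φ)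
    (hc : HasCompactSupport φ) (h : E) :
    ∫ x, φ x * lineAvg f h x ∂μ = ∫ s, (∫ x, φ (x - s • h) * f x ∂μ) ∂unitMeasure := by
  have hi : Integrable (fun z : E × ℝ => φ z.1 * f (z.1 + z.2 • h)) (μ.prod unitMeasure) := by
    simpa [Function.comp_def] using
      (measurePreserving_shear (μ := μ) h).integrable_comp_of_integrable
        (integrable_mul_comp_sub_smul hf hφ hc h)
  calc ∫ x, φ x * lineAvg f h x ∂μ
      = ∫ x, ∫ s, φ x * f (x + s • h) ∂unitMeasure ∂μ := by
        simp only [lineAvg, integral_const_mul]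
    _ = ∫ s, (∫ x, φ x * f (x + s • h) ∂μ) ∂unitMeasure := integral_integral_swap hi
    _ = _ := by
        congr 1 with s
        rw [← integral_add_right_eq_self (fun x => φ (x - s • h) * f x) (s • h)]
        simp

end Translation

section Gradient

variable {E : Type*} [NormedAddCommGroup E] [InnerProductSpace ℝ E]

theorem enorm_inner_le (v w : E) : ‖(inner ℝ v w : ℝ)‖ₑ ≤ ‖v‖ₑ * ‖w‖ₑ := by
  simp only [enorm_eq_nnnorm]
  exact_mod_cast nnnorm_inner_le_nnnorm (𝕜 := ℝ) v w

theorem lintegral_inner_rpow_le {α : Type*} [MeasurableSpace α] {μ : Measure α} (g : α → E)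
    {p : ℝ} (hp : 0 ≤ p) (h : E) :
    ∫⁻ x, ‖(inner ℝ (g x) h : ℝ)‖ₑ ^ p ∂μ ≤ (∫⁻ x, ‖g x‖ₑ ^ p ∂μ) * ‖h‖ₑ ^ p := by
  rw [← lintegral_mul_const' _ _ (by simp [hp])]
  refine lintegral_mono fun x => ?_
  rw [← ENNReal.mul_rpow_of_nonneg _ _ hp]
  gcongr
  exact enorm_inner_le _ _

theorem lintegral_inner_rpow_ne_top {α : Type*} [MeasurableSpace α] {μ : Measure α} {g : α → E}
    {p : ℝ} (hp : 0 ≤ p) (hg : ∫⁻ x, ‖g x‖ₑ ^ p ∂μ ≠ ⊤) (h : E) :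
    ∫⁻ x, ‖(inner ℝ (g x) h : ℝ)‖ₑ ^ p ∂μ ≠ ⊤ :=
  ne_top_of_le_ne_top (ENNReal.mul_ne_top hg (by simp [hp])) (lintegral_inner_rpow_le g hp h)

variable [CompleteSpace E]

theorem continuous_gradient_of_contDiff_one {u : E → ℝ} (hu : ContDiff ℝ 1 u) :
    Continuous (gradient u) :=
  (InnerProductSpace.toDual ℝ E).symm.continuous.comp (hu.continuous_fderiv one_ne_zero)

theorem inner_gradient (u : E → ℝ) (x v : E) : inner ℝ (gradient u x) v = fderiv ℝ u x v := by
  simp [gradient, InnerProductSpace.toDual_symm_apply]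

theorem gradient_comp_sub_const (φ : E → ℝ) (v x : E) :
    gradient (fun x => φ (x - v)) x = gradient φ (x - v) := by
  simp only [gradient, fderiv_comp_sub]

theorem sub_eq_lineAvg_gradient {φ : E → ℝ} (hφ : ContDiff ℝ 1 φ) (h x : E) :
    φ (x + h) - φ x = lineAvg (fun y => inner ℝ (gradient φ y) h) h x := by
  have hline (s : ℝ) : HasDerivAt (fun s : ℝ => x + s • h) h s := by
    simpa using ((hasDerivAt_id s).smul_const h).const_add x
  have hderiv (s : ℝ) :
      HasDerivAt (fun s : ℝ => φ (x + s • h)) (inner ℝ (gradient φ (x + s • h)) h) s := by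
    rw [inner_gradient]
    exact (hφ.differentiable one_ne_zero _).hasFDerivAt.comp_hasDerivAt s (hline s)
  have hcont : Continuous fun s : ℝ => inner ℝ (gradient φ (x + s • h)) h :=
    ((continuous_gradient_of_contDiff_one hφ).comp (by fun_prop)).inner continuous_const
  have hftc := intervalIntegral.integral_eq_sub_of_hasDerivAt (a := 0) (b := 1)
    (fun s _ => hderiv s) (hcont.intervalIntegrable _ _)
  rw [intervalIntegral.integral_of_le zero_le_one] at hftc
  simpa [lineAvg] using hftc.symm

end Gradient

section WeakGradient

variable {N : ℕ} {u : Euc N → ℝ} {g : Euc N → Euc N}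

theorem HasWeakGradient.congr {u' : Euc N → ℝ} {g' : Euc N → Euc N} (hg : HasWeakGradient u g)
    (hu : u =ᵐ[volume] u') (hgg' : g =ᵐ[volume] g') : HasWeakGradient u' g' := by
  refine ⟨hg.1.congr hu, hg.2.congr hgg', fun φ hφ hc => ?_⟩
  have hleft : ∫ x, u' x • gradient φ x = ∫ x, u x • gradient φ x :=
    integral_congr_ae (by filter_upwards [hu] with x hx; rw [hx])
  have hright : ∫ x, φ x • g' x = ∫ x, φ x • g x :=
    integral_congr_ae (by filter_upwards [hgg'] with x hx; rw [hx])
  rw [hleft, hright, hg.3 φ hφ hc]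

theorem HasWeakGradient.integral_inner_gradient_mul (hg : HasWeakGradient u g) {φ : Euc N → ℝ}
    (hφ : ContDiff ℝ ∞ φ) (hc : HasCompactSupport φ) (h : Euc N) :
    ∫ x, inner ℝ (gradient φ x) h * u x = -∫ x, φ x * inner ℝ (g x) h := by
  have hinner := congrArg (fun v : Euc N => (inner ℝ h v : ℝ)) (hg.integral_eq φ hφ hc)
  simp only [inner_neg_right] at hinner
  rw [← integral_inner (integrable_smul_gradient hg.1 hφ hc),
    ← integral_inner (integrable_smul_field hg.2 hφ hc)] at hinner
  simpa only [real_inner_smul_right, real_inner_comm h, mul_comm (u _)] using hinner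

theorem HasWeakGradient.integral_mul_sub (hg : HasWeakGradient u g) {φ : Euc N → ℝ}
    (hφ : ContDiff ℝ ∞ φ) (hc : HasCompactSupport φ) (h : Euc N) :
    ∫ x, φ x * (u (x + h) - u x) =
      ∫ s, (∫ x, φ (x - s • h) * inner ℝ (g x) h) ∂unitMeasure := by
  have hφs (v : Euc N) : ContDiff ℝ ∞ fun x => φ (x - v) := hφ.comp (contDiff_id.sub contDiff_const)
  have hcs (v : Euc N) : HasCompactSupport fun x => φ (x - v) :=
    hc.comp_homeomorph (Homeomorph.subRight v)
  have hcont : Continuous fun x => inner ℝ (gradient φ x) h :=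
    (continuous_gradient hφ).inner continuous_const
  have hcomp : HasCompactSupport fun x => (inner ℝ (gradient φ x) h : ℝ) :=
    (hasCompactSupport_gradient hc).comp_left (g := fun v => (inner ℝ v h : ℝ)) (by simp)
  have hi (k : Euc N → ℝ) (hk : Continuous k) {v : Euc N → ℝ} (hv : LocallyIntegrable v volume)
      (hkc : HasCompactSupport k) : Integrable fun x => k x * v x := by
    simpa using hv.integrable_smul_left_of_hasCompactSupport hk hkc
  have hftc (x : Euc N) :
      φ (x - h) - φ x = -∫ s, inner ℝ (gradient φ (x - s • h)) h ∂unitMeasure := by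
    have := sub_eq_lineAvg_gradient (hφ.of_le (by simp)) (-h) x
    simpa [lineAvg, ← sub_eq_add_neg, integral_neg] using this
  have htranslate : ∫ x, φ x * u (x + h) = ∫ x, φ (x - h) * u x := by
    rw [← integral_add_right_eq_self (fun x => φ (x - h) * u x) h]
    simp
  calc ∫ x, φ x * (u (x + h) - u x) = (∫ x, φ (x - h) * u x) - ∫ x, φ x * u x := by
        rw [← htranslate, ← integral_sub (hi φ hφ.continuous
          (locallyIntegrable_comp_add_right hg.1 h) hc) (hi φ hφ.continuous hg.1 hc)]
        simp only [mul_sub]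
    _ = -∫ x, ∫ s, inner ℝ (gradient φ (x - s • h)) h * u x ∂unitMeasure := by
        rw [← integral_sub (hi _ (hφs h).continuous hg.1 (hcs h)) (hi φ hφ.continuous hg.1 hc),
          ← integral_neg]
        congr 1 with x
        rw [integral_mul_const, ← sub_mul, hftc, neg_mul]
    _ = ∫ s, -(∫ x, inner ℝ (gradient φ (x - s • h)) h * u x) ∂unitMeasure := by
        rw [integral_integral_swap (integrable_mul_comp_sub_smul hg.1 hcont hcomp h), integral_neg]
    _ = _ := by
        congr 1 with s
        have hs := hg.integral_inner_gradient_mul (hφs (s • h)) (hcs (s • h)) h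
        simp only [gradient_comp_sub_const] at hs
        rw [hs, neg_neg]

theorem HasWeakGradient.ae_sub_eq (hg : HasWeakGradient u g) (hgm : Measurable g) {p : ℝ}
    (hp : 1 ≤ p) (hgp : ∫⁻ x, ‖g x‖ₑ ^ p ≠ ⊤) (h : Euc N) :
    ∀ᵐ x, u (x + h) - u x = lineAvg (fun y => inner ℝ (g y) h) h x := by
  set f : Euc N → ℝ := fun y => inner ℝ (g y) h
  have hp0 : 0 < p := by linarith
  have hfm : Measurable f := by fun_prop
  have hfloc : LocallyIntegrable f volume := fun x => by
    obtain ⟨s, hs, hi⟩ := hg.2 x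
    exact ⟨s, hs, hi.inner_const h⟩
  have hAp : MemLp (lineAvg f h) (ENNReal.ofReal p) volume := by
    refine ⟨(measurable_lineAvg hfm h).aestronglyMeasurable, ?_⟩
    rw [eLpNorm_lt_top_iff_lintegral_rpow_enorm_lt_top (by simpa using hp0) (by simp),
      ENNReal.toReal_ofReal hp0.le]
    exact (lintegral_lineAvg_rpow_le hfm hp h).trans_lt
      (lintegral_inner_rpow_ne_top hp0.le hgp h).lt_top
  refine ae_eq_of_integral_contDiff_smul_eq
    ((locallyIntegrable_comp_add_right hg.1 h).sub hg.1)
    (hAp.locallyIntegrable (by simpa using hp)) fun φ hφ hc => ?_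
  simp only [smul_eq_mul, integral_mul_lineAvg hfloc hφ.continuous hc h]
  exact hg.integral_mul_sub hφ hc h

theorem hasWeakGradient_gradient (hu : ContDiff ℝ 1 u) : HasWeakGradient u (gradient u) := by
  have hgc := continuous_gradient_of_contDiff_one hu
  refine ⟨hu.continuous.locallyIntegrable, hgc.locallyIntegrable, fun φ hφ hφc => ?_⟩
  refine ext_inner_left ℝ fun v => ?_
  have hinner (w : Euc N → ℝ) (x : Euc N) : inner ℝ v (gradient w x) = fderiv ℝ w x v := by
    rw [real_inner_comm, inner_gradient]
  have hug := integrable_smul_gradient hu.continuous.locallyIntegrable hφ hφc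
  have hφg := integrable_smul_field hgc.locallyIntegrable hφ hφc
  have huφ : Integrable fun x => u x • φ x := by
    simpa [mul_comm] using
      hu.continuous.locallyIntegrable.integrable_smul_left_of_hasCompactSupport hφ.continuous hφc
  have hug' := hug.const_inner (𝕜 := ℝ) v
  have hφg' := hφg.const_inner (𝕜 := ℝ) v
  simp only [real_inner_smul_right, hinner] at hug' hφg'
  have hparts := integral_smul_fderiv_eq_neg_fderiv_smul_of_integrable (μ := volume) (f := u)
    (g := φ) (v := v) (by simpa [mul_comm] using hφg') (by simpa using hug') huφ
    (fun x _ => hu.differentiable (by simp) x) (fun x _ => hφ.differentiable (by simp) x)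
  rw [inner_neg_right, ← integral_inner hug, ← integral_inner hφg]
  simpa only [real_inner_smul_right, hinner, smul_eq_mul, mul_comm (φ _)] using hparts

end WeakGradient

/-! ### Polar coordinates -/

section Powers

theorem lintegral_Ioc_rpow {q : ℝ} (hq : -1 < q) {a : ℝ} (ha : 0 ≤ a) :
    ∫⁻ t in Set.Ioc 0 a, ENNReal.ofReal (t ^ q) = ENNReal.ofReal (a ^ (q + 1) / (q + 1)) := by
  have hi := (intervalIntegral.intervalIntegrable_rpow' (a := 0) (b := a) hq).1
  rw [← ofReal_integral_eq_lintegral_ofReal hi ?_, ← intervalIntegral.integral_of_le ha,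
    integral_rpow (Or.inl hq), Real.zero_rpow (by linarith), sub_zero]
  filter_upwards [ae_restrict_mem measurableSet_Ioc] with t ht using Real.rpow_nonneg ht.1.le _

theorem lintegral_Ioi_rpow {q : ℝ} (hq : q < -1) {a : ℝ} (ha : 0 < a) :
    ∫⁻ t in Set.Ioi a, ENNReal.ofReal (t ^ q) = ENNReal.ofReal (-a ^ (q + 1) / (q + 1)) := by
  rw [← ofReal_integral_eq_lintegral_ofReal (integrableOn_Ioi_rpow_of_lt hq ha) ?_,
    integral_Ioi_rpow_of_lt hq ha]
  filter_upwards [ae_restrict_mem measurableSet_Ioi] with t ht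
    using Real.rpow_nonneg (ha.trans ht).le _

end Powers

section Polar

variable {E : Type*} [NormedAddCommGroup E] [NormedSpace ℝ E] [FiniteDimensional ℝ E]
  [Nontrivial E] [MeasurableSpace E] [BorelSpace E] (μ : Measure E) [μ.IsAddHaarMeasure]

theorem lintegral_eq_lintegral_sphere_lintegral_Ioi {G : E → ℝ≥0∞} (hG : Measurable G) :
    ∫⁻ x, G x ∂μ = ∫⁻ θ : Metric.sphere (0 : E) 1, (∫⁻ r in Set.Ioi (0 : ℝ),
      ENNReal.ofReal (r ^ (Module.finrank ℝ E - 1)) * G (r • (θ : E))) ∂μ.toSphere := by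
  have hmp := μ.measurePreserving_homeomorphUnitSphereProd
  have hG' : Measurable fun z : Metric.sphere (0 : E) 1 × Set.Ioi (0 : ℝ) =>
      G ((z.2 : ℝ) • (z.1 : E)) := hG.comp (by fun_prop)
  calc ∫⁻ x, G x ∂μ = ∫⁻ x in ({0}ᶜ : Set E), G x ∂μ := by rw [restrict_compl_singleton]
    _ = ∫⁻ x : ({0}ᶜ : Set E), G x ∂(μ.comap Subtype.val) := by
        rw [lintegral_subtype_comap (measurableSet_singleton _).compl]
    _ = ∫⁻ z, G ((z.2 : ℝ) • (z.1 : E))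
          ∂(μ.toSphere.prod (.volumeIoiPow (Module.finrank ℝ E - 1))) := by
        rw [← hmp.lintegral_comp hG']
        refine lintegral_congr fun x => ?_
        congr 1
        simp [smul_smul, mul_inv_cancel₀ (norm_ne_zero_iff.2 x.2)]
    _ = ∫⁻ θ, ∫⁻ r, G ((r : ℝ) • (θ : E)) ∂(Measure.volumeIoiPow (Module.finrank ℝ E - 1))
          ∂μ.toSphere := lintegral_prod _ hG'.aemeasurable
    _ = _ := by
        refine lintegral_congr fun θ => ?_
        have hGθ : Measurable fun r : Set.Ioi (0 : ℝ) => G ((r : ℝ) • (θ : E)) :=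
          hG.comp (by fun_prop)
        rw [Measure.volumeIoiPow, lintegral_withDensity_eq_lintegral_mul _ (by fun_prop) hGθ,
          ← lintegral_subtype_comap measurableSet_Ioi]
        simp

theorem setLIntegral_ball_of_homogeneous {G : E → ℝ≥0∞} (hG : Measurable G) {p : ℝ} (hp : 0 ≤ p)
    (hhom : ∀ r : ℝ, 0 < r → ∀ x, G (r • x) = ENNReal.ofReal (r ^ p) * G x) :
    ∫⁻ x in Metric.ball 0 1, G x ∂μ =
      ENNReal.ofReal (1 / (Module.finrank ℝ E + p)) *
        ∫⁻ θ : Metric.sphere (0 : E) 1, G θ ∂μ.toSphere := by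
  set d := Module.finrank ℝ E
  have hd : 1 ≤ d := Module.finrank_pos
  have hrad : ∫⁻ r in Set.Ioo (0 : ℝ) 1, ENNReal.ofReal (r ^ ((d : ℝ) - 1 + p)) =
      ENNReal.ofReal (1 / (d + p)) := by
    have hd' : (1 : ℝ) ≤ d := by exact_mod_cast hd
    rw [setLIntegral_congr Ioo_ae_eq_Ioc, lintegral_Ioc_rpow (by linarith) zero_le_one,
      Real.one_rpow, show (d : ℝ) - 1 + p + 1 = d + p by ring]
  rw [← lintegral_indicator Metric.isOpen_ball.measurableSet,
    lintegral_eq_lintegral_sphere_lintegral_Ioi μ (hG.indicator Metric.isOpen_ball.measurableSet),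
    ← hrad,
    ← lintegral_const_mul _ (by fun_prop : Measurable fun θ : Metric.sphere (0 : E) 1 => G θ)]
  refine lintegral_congr fun θ => ?_
  rw [← lintegral_mul_const _ (by fun_prop), ← Set.Ioi_inter_Iio, Set.inter_comm,
    ← setLIntegral_indicator measurableSet_Iio]
  refine setLIntegral_congr_fun measurableSet_Ioi fun r (hr : 0 < r) => ?_
  have hmem : r • (θ : E) ∈ Metric.ball (0 : E) 1 ↔ r ∈ Set.Iio (1 : ℝ) := by
    simp [norm_smul, abs_of_pos hr]
  by_cases hr1 : r ∈ Set.Iio (1 : ℝ)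
  · simp only [Set.indicator_of_mem (hmem.2 hr1), Set.indicator_of_mem hr1, hhom r hr]
    rw [← mul_assoc, ← ENNReal.ofReal_mul (by positivity), ← Real.rpow_natCast,
      ← Real.rpow_add hr, Nat.cast_sub hd, Nat.cast_one]
  · simp only [Set.indicator_of_notMem (mt hmem.1 hr1), Set.indicator_of_notMem hr1, mul_zero]

end Polar

section Kappa

variable {E : Type*} [NormedAddCommGroup E] [InnerProductSpace ℝ E] [FiniteDimensional ℝ E]
  [MeasurableSpace E] [BorelSpace E] [Nontrivial E]

-- Linear isometries preserve the measure of the ball, and the integral of a homogeneous function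
-- over the ball is a multiple of its integral over the sphere.
theorem lintegral_sphere_inner_rpow_congr {p : ℝ} (hp : 0 ≤ p) {v w : E} (h : ‖v‖ = ‖w‖) :
    ∫⁻ θ : Metric.sphere (0 : E) 1, ‖(inner ℝ v (θ : E) : ℝ)‖ₑ ^ p ∂volume.toSphere =
    ∫⁻ θ : Metric.sphere (0 : E) 1, ‖(inner ℝ w (θ : E) : ℝ)‖ₑ ^ p ∂volume.toSphere := by
  have hball (v : E) := setLIntegral_ball_of_homogeneous (volume : Measure E)
    (G := fun x => ‖(inner ℝ v x : ℝ)‖ₑ ^ p) (by fun_prop) hp fun r hr x => by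
      rw [real_inner_smul_right, enorm_mul, ENNReal.mul_rpow_of_nonneg _ _ hp,
        Real.enorm_of_nonneg hr.le, ENNReal.ofReal_rpow_of_nonneg hr.le hp]
  let A : E ≃ₗᵢ[ℝ] E := (ℝ ∙ (v - w))ᗮ.reflection
  have hA : A v = w := Submodule.reflection_sub h
  have hrot : ∫⁻ x in Metric.ball (0 : E) 1, ‖(inner ℝ v x : ℝ)‖ₑ ^ p =
      ∫⁻ x in Metric.ball (0 : E) 1, ‖(inner ℝ w x : ℝ)‖ₑ ^ p := by
    rw [← A.measurePreserving.setLIntegral_comp_preimage Metric.isOpen_ball.measurableSet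
      (by fun_prop : Measurable fun x => ‖(inner ℝ w x : ℝ)‖ₑ ^ p)]
    simp [← hA]
  rw [hball, hball] at hrot
  have hd : 0 < (Module.finrank ℝ E : ℝ) := by exact_mod_cast Module.finrank_pos
  exact (ENNReal.mul_right_inj (by simp only [ne_eq, ENNReal.ofReal_eq_zero, not_le]; positivity)
    ENNReal.ofReal_ne_top).1 hrot

variable {N : ℕ} [NeZero N] {p : ℝ} {e : Euc N}

theorem lintegral_sphere_inner_rpow (hp : 0 ≤ p) (he : ‖e‖ = 1) (v : Euc N) :
    ∫⁻ θ : Metric.sphere (0 : Euc N) 1, ‖(inner ℝ v (θ : Euc N) : ℝ)‖ₑ ^ p ∂volume.toSphere =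
      ENNReal.ofReal (kappa p e) * ‖v‖ₑ ^ p := by
  have hv : ‖v‖ = ‖‖v‖ • e‖ := by simp [norm_smul, he]
  rw [lintegral_sphere_inner_rpow_congr hp hv]
  simp only [real_inner_smul_left, enorm_mul, ENNReal.mul_rpow_of_nonneg _ _ hp, enorm_norm]
  rw [lintegral_const_mul' _ _ (by simp [hp]), mul_comm, kappa,
    ofReal_integral_eq_lintegral_ofReal]
  · congr 1
    refine lintegral_congr fun θ => ?_
    rw [Real.enorm_eq_ofReal_abs, ENNReal.ofReal_rpow_of_nonneg (abs_nonneg _) hp]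
  · refine Integrable.of_bound (C := 1) (by fun_prop (disch := assumption))
      (ae_of_all _ fun θ => ?_)
    rw [Real.norm_of_nonneg (by positivity)]
    refine Real.rpow_le_one (abs_nonneg _) ?_ hp
    simpa [he] using abs_real_inner_le_norm e (θ : Euc N)
  · exact ae_of_all _ fun _ => by positivity

theorem lintegral_sphere_directional_energy (hp : 0 ≤ p) (γ : ℝ) (he : ‖e‖ = 1)
    {g : Euc N → Euc N} (hg : Measurable g) :
    ∫⁻ θ : Metric.sphere (0 : Euc N) 1, (ENNReal.ofReal (1 / |γ|) *
      ∫⁻ x, ‖(inner ℝ (g x) (θ : Euc N) : ℝ)‖ₑ ^ p) ∂volume.toSphere =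
    ENNReal.ofReal (kappa p e / |γ|) * ∫⁻ x, ‖g x‖ₑ ^ p := by
  rw [lintegral_const_mul' _ _ ENNReal.ofReal_ne_top,
    lintegral_lintegral_swap (Measurable.aemeasurable (by fun_prop))]
  simp_rw [lintegral_sphere_inner_rpow hp he]
  rw [lintegral_const_mul' _ _ ENNReal.ofReal_ne_top, ← mul_assoc,
    ← ENNReal.ofReal_mul (by positivity), one_div_mul_eq_div]

end Kappa

section Superlevel

variable {N : ℕ} {u v : Euc N → ℝ}

theorem superlevel_ae_eq (h : u =ᵐ[volume] v) (lam b : ℝ) :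
    superlevel lam b u =ᵐ[(volume : Measure (Euc N × Euc N))] superlevel lam b v := by
  have hfst : ∀ᵐ z : Euc N × Euc N, u z.1 = v z.1 := Measure.quasiMeasurePreserving_fst.ae h
  have hsnd : ∀ᵐ z : Euc N × Euc N, u z.2 = v z.2 := Measure.quasiMeasurePreserving_snd.ae h
  filter_upwards [hfst, hsnd] with z hz₁ hz₂
  change (z ∈ superlevel lam b u) = (z ∈ superlevel lam b v)
  simp only [superlevel, diffQuot, Set.mem_ofPred_eq, hz₁, hz₂]

theorem nu_absolutelyContinuous (N : ℕ) (γ : ℝ) :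
    nu N γ ≪ (volume : Measure (Euc N × Euc N)) :=
  (withDensity_absolutelyContinuous _ _).trans Measure.absolutelyContinuous_restrict

theorem levelFunctional_congr (h : u =ᵐ[volume] v) (p γ : ℝ) :
    levelFunctional p γ u = levelFunctional p γ v := by
  ext lam
  unfold levelFunctional
  rw [measure_congr ((nu_absolutelyContinuous N γ).ae_le (superlevel_ae_eq h lam (γ / p)))]

theorem measurableSet_superlevel (hu : Measurable u) (lam b : ℝ) :
    MeasurableSet (superlevel lam b u) := by
  have hq : Measurable fun z : Euc N × Euc N => |diffQuot b u z.1 z.2| := by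
    unfold diffQuot
    fun_prop
  exact (measurableSet_eq_fun measurable_fst measurable_snd).compl.inter
    (measurableSet_lt measurable_const hq)

theorem lt_abs_diffQuot_iff {lam b : ℝ} {x y : Euc N} (hxy : x ≠ y) :
    lam < |diffQuot b u x y| ↔ lam * ‖x - y‖ ^ (1 + b) < |u x - u y| := by
  have hpos : 0 < ‖x - y‖ ^ (1 + b) := Real.rpow_pos_of_pos (norm_pos_iff.2 (sub_ne_zero.2 hxy)) _
  rw [diffQuot, abs_div, abs_of_pos hpos, lt_div_iff₀ hpos]

theorem mk_add_mem_superlevel_iff {lam : ℝ} (hl : 0 ≤ lam) (b : ℝ) (x h : Euc N) :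
    (x, x + h) ∈ superlevel lam b u ↔ lam * ‖h‖ ^ (1 + b) < |u (x + h) - u x| := by
  rcases eq_or_ne h 0 with rfl | hh
  · have : 0 ≤ lam * ‖(0 : Euc N)‖ ^ (1 + b) := by positivity
    simpa [superlevel] using this
  · have hne : x ≠ x + h := by simpa using hh
    simp [superlevel, lt_abs_diffQuot_iff hne, abs_sub_comm (u x), hh]

theorem nu_superlevel_eq_lintegral (hu : Measurable u) (γ b : ℝ) {lam : ℝ} (hl : 0 ≤ lam) :
    nu N γ (superlevel lam b u) = ∫⁻ h : Euc N, ENNReal.ofReal (‖h‖ ^ (γ - (N : ℝ))) *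
      volume {x | lam * ‖h‖ ^ (1 + b) < |u (x + h) - u x|} := by
  set d : Euc N × Euc N → ℝ≥0∞ := fun z => ENNReal.ofReal (‖z.1 - z.2‖ ^ (γ - (N : ℝ)))
  have hE := measurableSet_superlevel hu lam b
  have hd : Measurable d := by fun_prop
  have hsub : superlevel lam b u ∩ {z : Euc N × Euc N | z.1 ≠ z.2} = superlevel lam b u :=
    Set.inter_eq_left.2 fun z hz => hz.1
  rw [nu, withDensity_apply _ hE, Measure.restrict_restrict hE, hsub, ← lintegral_indicator hE]
  change ∫⁻ z, (superlevel lam b u).indicator d z ∂(volume.prod volume) = _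
  rw [← (measurePreserving_prod_add (volume : Measure (Euc N)) volume).lintegral_comp
      (hd.indicator hE), lintegral_prod_symm' (fun z : Euc N × Euc N =>
        (superlevel lam b u).indicator d (z.1, z.1 + z.2)) ((hd.indicator hE).comp (by fun_prop))]
  refine lintegral_congr fun h => ?_
  have hS : MeasurableSet {x | lam * ‖h‖ ^ (1 + b) < |u (x + h) - u x|} :=
    measurableSet_lt measurable_const (by fun_prop)
  rw [← lintegral_indicator_const hS]
  refine lintegral_congr fun x => ?_
  have hmem : (x, x + h) ∈ superlevel lam b u ↔
      x ∈ {x | lam * ‖h‖ ^ (1 + b) < |u (x + h) - u x|} := mk_add_mem_superlevel_iff hl b x h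
  by_cases hx : (x, x + h) ∈ superlevel lam b u
  · rw [Set.indicator_of_mem hx, Set.indicator_of_mem (hmem.1 hx)]
    simp [d]
  · rw [Set.indicator_of_notMem hx, Set.indicator_of_notMem (mt hmem.2 hx)]

theorem levelFunctional_eq_lintegral (hu : Measurable u) (p γ : ℝ) {lam : ℝ} (hl : 0 ≤ lam) :
    levelFunctional p γ u lam = ENNReal.ofReal (lam ^ p) * ∫⁻ h : Euc N,
      ENNReal.ofReal (‖h‖ ^ (γ - (N : ℝ))) *
        volume {x | lam * ‖h‖ ^ (1 + γ / p) < |u (x + h) - u x|} := by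
  rw [levelFunctional, nu_superlevel_eq_lintegral hu _ _ hl]

theorem measurable_volume_translate_gt (hu : Measurable u) (γ b lam : ℝ) :
    Measurable fun h : Euc N => ENNReal.ofReal (‖h‖ ^ (γ - (N : ℝ))) *
      volume {x | lam * ‖h‖ ^ b < |u (x + h) - u x|} := by
  have hS : MeasurableSet {z : Euc N × Euc N | lam * ‖z.1‖ ^ b < |u (z.2 + z.1) - u z.2|} :=
    measurableSet_lt (by fun_prop) (by fun_prop)
  exact (by fun_prop : Measurable fun h : Euc N => ENNReal.ofReal (‖h‖ ^ (γ - (N : ℝ)))).mul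
    (measurable_measure_prodMk_left hS)

theorem levelFunctional_eq_lintegral_sphere [NeZero N] (hu : Measurable u) (p γ : ℝ)
    {lam : ℝ} (hl : 0 ≤ lam) :
    levelFunctional p γ u lam = ∫⁻ θ : Metric.sphere (0 : Euc N) 1, (∫⁻ r in Set.Ioi (0 : ℝ),
      ENNReal.ofReal (lam ^ p * r ^ (γ - 1)) *
        volume {x | lam * r ^ (1 + γ / p) < |u (x + r • (θ : Euc N)) - u x|})
      ∂volume.toSphere := by
  rw [levelFunctional_eq_lintegral hu _ _ hl, lintegral_eq_lintegral_sphere_lintegral_Ioi volume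
    (measurable_volume_translate_gt hu γ _ lam), ← lintegral_const_mul' _ _ ENNReal.ofReal_ne_top]
  refine lintegral_congr fun θ => ?_
  rw [← lintegral_const_mul' _ _ ENNReal.ofReal_ne_top]
  refine setLIntegral_congr_fun measurableSet_Ioi fun r (hr : 0 < r) => ?_
  have hnorm : ‖r • (θ : Euc N)‖ = r := by simp [norm_smul, hr.le]
  simp only [hnorm]
  rw [← mul_assoc, ← mul_assoc, ← ENNReal.ofReal_mul (by positivity),
    ← ENNReal.ofReal_mul (by positivity), mul_assoc, ← Real.rpow_natCast, ← Real.rpow_add hr,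
    finrank_euclideanSpace_fin, Nat.cast_sub NeZero.one_le, Nat.cast_one, sub_add_sub_cancel']

end Superlevel

/-! ### Directional functionals -/

section LevelRadius

variable {p γ lam : ℝ}

/-- The radius `r` at which the height `t = lam * r ^ (γ / p)` is tested at level `lam`. -/
def levelRadius (p γ lam t : ℝ) : ℝ := (t / lam) ^ (p / γ)

theorem levelRadius_pos {t : ℝ} (hl : 0 < lam) (ht : 0 < t) : 0 < levelRadius p γ lam t :=
  Real.rpow_pos_of_pos (div_pos ht hl) _

theorem mul_levelRadius_rpow {t : ℝ} (hp : p ≠ 0) (hγ : γ ≠ 0) (hl : 0 < lam) (ht : 0 < t) :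
    lam * levelRadius p γ lam t ^ (γ / p) = t := by
  rw [levelRadius, ← Real.rpow_mul (by positivity), div_mul_div_cancel₀ hγ, div_self hp,
    Real.rpow_one, mul_div_cancel₀ _ hl.ne']

theorem levelRadius_mul_rpow {r : ℝ} (hp : p ≠ 0) (hγ : γ ≠ 0) (hl : 0 < lam) (hr : 0 < r) :
    levelRadius p γ lam (lam * r ^ (γ / p)) = r := by
  rw [levelRadius, mul_div_cancel_left₀ _ hl.ne', ← Real.rpow_mul hr.le, div_mul_div_cancel₀ hp,
    div_self hγ, Real.rpow_one]

theorem measurable_levelRadius (p γ lam : ℝ) : Measurable (levelRadius p γ lam) := by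
  unfold levelRadius; fun_prop

theorem bijOn_levelRadius (hp : p ≠ 0) (hγ : γ ≠ 0) (hl : 0 < lam) :
    Set.BijOn (levelRadius p γ lam) (Set.Ioi 0) (Set.Ioi 0) :=
  Set.InvOn.bijOn (f' := fun r => lam * r ^ (γ / p))
    ⟨fun _ ht => mul_levelRadius_rpow hp hγ hl ht, fun _ hr => levelRadius_mul_rpow hp hγ hl hr⟩
    (fun _ ht => levelRadius_pos hl ht) fun _ hr => mul_pos hl (Real.rpow_pos_of_pos hr _)

theorem hasDerivAt_levelRadius {t : ℝ} (hl : 0 < lam) (ht : 0 < t) :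
    HasDerivAt (levelRadius p γ lam) (lam⁻¹ * (p / γ) * (t / lam) ^ (p / γ - 1)) t := by
  rw [← one_div]
  exact ((hasDerivAt_id t).div_const lam).rpow_const (Or.inl (div_pos ht hl).ne')

theorem abs_deriv_levelRadius_mul_weight {t : ℝ} (hp : 0 < p) (hγ : γ ≠ 0) (hl : 0 < lam)
    (ht : 0 < t) :
    |lam⁻¹ * (p / γ) * (t / lam) ^ (p / γ - 1)| * (lam ^ p * levelRadius p γ lam t ^ (γ - 1)) =
      p / |γ| * t ^ (p - 1) := by
  have hq : 0 < t / lam := div_pos ht hl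
  have hexp : p / γ - 1 + p / γ * (γ - 1) = p - 1 := by field_simp; ring
  rw [abs_mul, abs_mul, abs_div, abs_of_pos hp, abs_of_pos (inv_pos.2 hl),
    abs_of_pos (Real.rpow_pos_of_pos hq _), levelRadius, ← Real.rpow_mul hq.le]
  calc _ = p / |γ| * (lam ^ p / lam) *
        ((t / lam) ^ (p / γ - 1) * (t / lam) ^ (p / γ * (γ - 1))) := by ring
    _ = p / |γ| * lam ^ (p - 1) * (t ^ (p - 1) / lam ^ (p - 1)) := by
        rw [← Real.rpow_add hq, hexp, ← Real.rpow_sub_one hl.ne', Real.div_rpow ht.le hl.le]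
    _ = p / |γ| * t ^ (p - 1) := by
        have := (Real.rpow_pos_of_pos hl (p - 1)).ne'
        field_simp

theorem lintegral_levelRadius (hp : 0 < p) (hγ : γ ≠ 0) (hl : 0 < lam) (H : ℝ → ℝ → ℝ≥0∞) :
    ∫⁻ r in Set.Ioi (0 : ℝ), ENNReal.ofReal (lam ^ p * r ^ (γ - 1)) * H r (lam * r ^ (γ / p)) =
      ∫⁻ t in Set.Ioi (0 : ℝ), ENNReal.ofReal (p / |γ| * t ^ (p - 1)) *
        H (levelRadius p γ lam t) t := by
  have hbij := bijOn_levelRadius hp.ne' hγ hl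
  nth_rw 1 [← hbij.image_eq]
  rw [lintegral_image_eq_lintegral_abs_deriv_mul measurableSet_Ioi
    (fun t ht => (hasDerivAt_levelRadius hl ht).hasDerivWithinAt) hbij.injOn]
  refine setLIntegral_congr_fun measurableSet_Ioi fun t (ht : 0 < t) => ?_
  simp only [mul_levelRadius_rpow hp.ne' hγ hl ht]
  rw [← mul_assoc, ← ENNReal.ofReal_mul (abs_nonneg _),
    abs_deriv_levelRadius_mul_weight hp hγ hl ht]

/-- The limits `lam → ∞` for `γ > 0` and `lam ↘ 0` for `γ < 0` share these properties; stating
limit theorems for such a filter treats both at once. -/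
structure IsLevelFilter (p γ : ℝ) (l : Filter ℝ) : Prop where
  pos : ∀ᶠ lam in l, 0 < lam
  levelRadius_le : ∀ᶠ lam in l, ∀ t : ℝ, 0 < t → levelRadius p γ lam t ≤ t ^ (p / γ)
  tendsto_levelRadius : ∀ t : ℝ, 0 < t → Tendsto (fun lam => levelRadius p γ lam t) l (𝓝 0)
  tendsto_const_mul : ∀ c : ℝ, 0 < c → Tendsto (fun lam => c * lam) l l

theorem isLevelFilter_atTop (hp : 0 < p) (hγ : 0 < γ) : IsLevelFilter p γ atTop where
  pos := eventually_gt_atTop 0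
  levelRadius_le := by
    filter_upwards [eventually_ge_atTop 1] with lam hl t ht
    exact Real.rpow_le_rpow (by positivity) (div_le_self ht.le hl) (by positivity)
  tendsto_levelRadius t _ := by
    have hdiv : Tendsto (fun lam : ℝ => t / lam) atTop (𝓝 0) :=
      tendsto_const_nhds.div_atTop tendsto_id
    simpa only [levelRadius, Real.zero_rpow (div_pos hp hγ).ne'] using
      hdiv.rpow_const (p := p / γ) (Or.inr (by positivity))
  tendsto_const_mul _ hc := tendsto_id.const_mul_atTop hc

theorem isLevelFilter_nhdsGT_zero (hp : 0 < p) (hγ : γ < 0) : IsLevelFilter p γ (𝓝[>] 0) where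
  pos := self_mem_nhdsWithin
  levelRadius_le := by
    filter_upwards [Ioo_mem_nhdsGT one_pos] with lam hl t ht
    refine Real.rpow_le_rpow_of_nonpos ht ?_ (div_neg_of_pos_of_neg hp hγ).le
    exact le_div_self ht.le hl.1 hl.2.le
  tendsto_levelRadius t ht := by
    have hdiv : Tendsto (fun lam : ℝ => t / lam) (𝓝[>] 0) atTop := by
      simpa only [div_eq_mul_inv] using tendsto_inv_nhdsGT_zero.const_mul_atTop ht
    simpa only [levelRadius, neg_neg, Function.comp_def] using
      (tendsto_rpow_neg_atTop (neg_pos.2 (div_neg_of_pos_of_neg hp hγ))).comp hdiv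
  tendsto_const_mul c hc := by
    refine tendsto_nhdsWithin_iff.2 ⟨?_, ?_⟩
    · exact ((continuous_const_mul c).tendsto' 0 0 (mul_zero c)).mono_left nhdsWithin_le_nhds
    · filter_upwards [self_mem_nhdsWithin] with lam hl using mul_pos hc hl

end LevelRadius

section Measure

theorem iUnion_setOf_add_one_div_lt {α : Type*} (f : α → ℝ) (t : ℝ) :
    ⋃ n : ℕ, {x | t + 1 / ((n : ℝ) + 1) < f x} = {x | t < f x} := by
  ext x
  simp only [Set.mem_iUnion, Set.mem_ofPred_eq]
  refine ⟨fun ⟨n, hn⟩ => (lt_add_of_pos_right t Nat.one_div_pos_of_nat).trans hn, fun hx => ?_⟩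
  obtain ⟨n, hn⟩ := exists_nat_one_div_lt (sub_pos.2 hx)
  exact ⟨n, by linarith⟩

variable {α : Type*} [MeasurableSpace α] {μ : Measure α}

theorem meas_le_abs_le {F : α → ℝ} (hF : AEMeasurable F μ) {p ε : ℝ} (hp : 0 ≤ p) (hε : 0 < ε) :
    μ {x | ε ≤ |F x|} ≤ (∫⁻ x, ‖F x‖ₑ ^ p ∂μ) / ENNReal.ofReal (ε ^ p) := by
  refine (measure_mono fun x (hx : ε ≤ |F x|) => ?_).trans (meas_ge_le_lintegral_div
    (by fun_prop) (by simpa using Real.rpow_pos_of_pos hε p) ENNReal.ofReal_ne_top)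
  change _ ≤ ‖F x‖ₑ ^ p
  rw [Real.enorm_eq_ofReal_abs, ENNReal.ofReal_rpow_of_nonneg (abs_nonneg _) hp]
  gcongr

variable {ι : Type*} {l : Filter ι} {F : ι → α → ℝ} {f : α → ℝ}

theorem meas_lt_abs_le_liminf (hF : TendstoInMeasure μ F l f) (t : ℝ) :
    μ {x | t < |f x|} ≤ liminf (fun i => μ {x | t < |F i x|}) l := by
  have hmono : Monotone fun n : ℕ => {x | t + 1 / ((n : ℝ) + 1) < |f x|} :=
    fun m n hmn x (hx : t + 1 / ((m : ℝ) + 1) < |f x|) =>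
      (add_le_add_right (Nat.one_div_le_one_div hmn) t).trans_lt hx
  rw [← iUnion_setOf_add_one_div_lt, hmono.measure_iUnion]
  refine iSup_le fun n => ?_
  set ε : ℝ := 1 / ((n : ℝ) + 1)
  have hsplit (i : ι) :
      μ {x | t + ε < |f x|} ≤ μ {x | t < |F i x|} + μ {x | ε ≤ ‖F i x - f x‖} := by
    refine (measure_mono fun x (hx : t + ε < |f x|) => ?_).trans (measure_union_le _ _)
    by_contra! hcon
    simp only [Set.mem_union, Set.mem_ofPred_eq, not_or, not_lt, not_le, Real.norm_eq_abs] at hcon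
    linarith [abs_sub_abs_le_abs_sub (f x) (F i x), abs_sub_comm (f x) (F i x)]
  rw [← ENNReal.liminf_add_of_right_tendsto_zero
    (tendstoInMeasure_iff_norm.1 hF ε Nat.one_div_pos_of_nat)]
  exact le_liminf_of_le (by isBoundedDefault) (Eventually.of_forall hsplit)

theorem limsup_meas_lt_abs_le (hF : TendstoInMeasure μ F l f) (hf : AEMeasurable f μ) {s t : ℝ}
    (hst : s < t) (hs : μ {x | s ≤ |f x|} ≠ ⊤) :
    limsup (fun i => μ {x | t < |F i x|}) l ≤ μ {x | t ≤ |f x|} := by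
  have hcont : Tendsto (fun ε : ℝ => μ {x | t - ε ≤ |f x|}) (𝓝[>] 0) (𝓝 (μ {x | t ≤ |f x|})) := by
    have hset : {x | t ≤ |f x|} = ⋂ ε > (0 : ℝ), {x | t - ε ≤ |f x|} := by
      ext x
      simp only [Set.mem_iInter, Set.mem_ofPred_eq, sub_le_iff_le_add]
      exact ⟨fun h ε hε => by linarith, fun h => le_of_forall_pos_le_add h⟩
    rw [hset]
    exact tendsto_measure_biInter_gt (fun ε _ => nullMeasurableSet_le aemeasurable_const hf.abs)
      (fun ε δ _ hεδ x hx => (sub_le_sub_left hεδ t).trans hx) ⟨t - s, sub_pos.2 hst, by simpa⟩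
  refine ge_of_tendsto hcont ?_
  filter_upwards [self_mem_nhdsWithin] with ε (hε : 0 < ε)
  have hsplit (i : ι) :
      μ {x | t < |F i x|} ≤ μ {x | t - ε ≤ |f x|} + μ {x | ε ≤ ‖F i x - f x‖} := by
    refine (measure_mono fun x (hx : t < |F i x|) => ?_).trans (measure_union_le _ _)
    by_contra! hcon
    simp only [Set.mem_union, Set.mem_ofPred_eq, not_or, not_le, Real.norm_eq_abs] at hcon
    linarith [abs_sub_abs_le_abs_sub (F i x) (f x)]
  calc _ ≤ limsup ((fun _ => μ {x | t - ε ≤ |f x|}) + fun i => μ {x | ε ≤ ‖F i x - f x‖}) l :=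
        limsup_le_limsup (Eventually.of_forall hsplit)
    _ = limsup (fun _ => μ {x | t - ε ≤ |f x|}) l :=
        ENNReal.limsup_add_of_right_tendsto_zero (tendstoInMeasure_iff_norm.1 hF ε hε) _
    _ ≤ _ := limsup_le_of_le (by isBoundedDefault) (Eventually.of_forall fun _ => le_rfl)

theorem tendsto_meas_lt_abs (hF : TendstoInMeasure μ F l f) (hf : AEMeasurable f μ) {s t : ℝ}
    (hst : s < t) (hs : μ {x | s ≤ |f x|} ≠ ⊤) (ht : μ {x | t ≤ |f x|} = μ {x | t < |f x|}) :
    Tendsto (fun i => μ {x | t < |F i x|}) l (𝓝 (μ {x | t < |f x|})) :=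
  tendsto_of_le_liminf_of_limsup_le (meas_lt_abs_le_liminf hF t)
    (ht ▸ limsup_meas_lt_abs_le hF hf hst hs)

theorem lintegral_rpow_mul_meas_lt_abs (hf : AEMeasurable f μ) {p c : ℝ} (hp : 0 < p)
    (hc : 0 ≤ c) :
    ∫⁻ t in Set.Ioi (0 : ℝ), ENNReal.ofReal (c * t ^ (p - 1)) * μ {x | t < |f x|} =
      ENNReal.ofReal (c / p) * ∫⁻ x, ‖f x‖ₑ ^ p ∂μ := by
  have hnorm (x : α) : ‖f x‖ₑ ^ p = ENNReal.ofReal (|f x| ^ p) := by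
    rw [Real.enorm_eq_ofReal_abs, ENNReal.ofReal_rpow_of_nonneg (abs_nonneg _) hp.le]
  simp_rw [hnorm, ENNReal.ofReal_mul hc]
  rw [lintegral_rpow_eq_lintegral_meas_lt_mul μ (ae_of_all _ fun x => abs_nonneg (f x)) hf.abs hp,
    ← mul_assoc, ← ENNReal.ofReal_mul (by positivity), div_mul_cancel₀ _ hp.ne',
    ← lintegral_const_mul' _ _ ENNReal.ofReal_ne_top]
  exact lintegral_congr fun t => by ring

end Measure

section DirFunctional

/-- The contribution of the direction `θ` to the level functional of a function whose derivative
in the direction `θ` is `f`. -/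
def dirFunctional {E : Type*} [AddCommGroup E] [Module ℝ E] [MeasurableSpace E] (μ : Measure E)
    (p γ : ℝ) (f : E → ℝ) (θ : E) (lam : ℝ) : ℝ≥0∞ :=
  ∫⁻ r in Set.Ioi (0 : ℝ), ENNReal.ofReal (lam ^ p * r ^ (γ - 1)) *
    μ {x | lam * r ^ (γ / p) < |lineAvg f (r • θ) x|}

variable {E : Type*} [AddCommGroup E] [Module ℝ E] [MeasurableSpace E] {μ : Measure E}
  {p γ lam : ℝ} {f : E → ℝ}

theorem dirFunctional_eq (hp : 0 < p) (hγ : γ ≠ 0) (hl : 0 < lam) (f : E → ℝ) (θ : E) :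
    dirFunctional μ p γ f θ lam =
      ∫⁻ t in Set.Ioi (0 : ℝ), ENNReal.ofReal (p / |γ| * t ^ (p - 1)) *
        μ {x | t < |lineAvg f (levelRadius p γ lam t • θ) x|} :=
  lintegral_levelRadius hp hγ hl fun r t => μ {x | t < |lineAvg f (r • θ) x|}

theorem measurable_meas_lt_abs_lineAvg [MeasurableAdd₂ E] [MeasurableSMul₂ ℝ E] [SFinite μ]
    (hf : Measurable f) (p γ lam : ℝ) (θ : E) :
    Measurable fun t : ℝ => μ {x | t < |lineAvg f (levelRadius p γ lam t • θ) x|} := by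
  have hr : Measurable fun z : ℝ × E => levelRadius p γ lam z.1 • θ :=
    ((measurable_levelRadius p γ lam).comp measurable_fst).smul_const θ
  exact measurable_measure_prodMk_left (measurableSet_lt measurable_fst
    ((measurable_lineAvg_uncurry hf).comp (hr.prodMk measurable_snd)).abs)

end DirFunctional

/-! ### Exponents larger than one -/

section Limits

theorem exists_continuous_lintegral_sub_le {E : Type*} [NormedAddCommGroup E] [ProperSpace E]
    [MeasurableSpace E] [BorelSpace E] {μ : Measure E} [IsFiniteMeasureOnCompacts μ] {f : E → ℝ}
    (hf : Measurable f) {p : ℝ} (hp : 0 < p) (hfp : ∫⁻ x, ‖f x‖ₑ ^ p ∂μ ≠ ⊤) {η : ℝ≥0∞}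
    (hη : η ≠ 0) :
    ∃ k : E → ℝ, Continuous k ∧ HasCompactSupport k ∧ ∫⁻ x, ‖k x‖ₑ ^ p ∂μ ≠ ⊤ ∧
      ∫⁻ x, ‖f x - k x‖ₑ ^ p ∂μ ≤ η := by
  have hq : ENNReal.ofReal p ≠ 0 := by simpa using hp
  have hlt_top (g : E → ℝ) :
      eLpNorm g (ENNReal.ofReal p) μ < ⊤ ↔ ∫⁻ x, ‖g x‖ₑ ^ p ∂μ < ⊤ := by
    rw [eLpNorm_lt_top_iff_lintegral_rpow_enorm_lt_top hq (by simp), ENNReal.toReal_ofReal hp.le]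
  have hfL : MemLp f (ENNReal.ofReal p) μ := ⟨hf.aestronglyMeasurable, (hlt_top f).2 hfp.lt_top⟩
  obtain ⟨k, hkc, hfk, hk, hkL⟩ := hfL.exists_hasCompactSupport_eLpNorm_sub_le (by simp)
    (ε := η ^ (1 / p)) (by simp [hη, hp.le])
  refine ⟨k, hk, hkc, ((hlt_top k).1 hkL.2).ne, ?_⟩
  rw [eLpNorm_eq_lintegral_rpow_enorm_toReal hq (by simp), ENNReal.toReal_ofReal hp.le] at hfk
  exact (ENNReal.rpow_le_rpow_iff (one_div_pos.2 hp)).1 hfk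

variable {E : Type*} [NormedAddCommGroup E] [NormedSpace ℝ E]

theorem eventually_abs_lineAvg_sub_le {k : E → ℝ} (hk : Continuous k) (hc : HasCompactSupport k)
    {ε : ℝ} (hε : 0 < ε) : ∀ᶠ h : E in 𝓝 0, ∀ x, |lineAvg k h x - k x| ≤ ε := by
  have huc := hc.uniformContinuous_of_continuous hk
  obtain ⟨δ, hδ, hkδ⟩ := Metric.uniformContinuous_iff.1 huc ε hε
  filter_upwards [Metric.ball_mem_nhds (0 : E) hδ] with h hh x
  have hint : Integrable (fun s : ℝ => k (x + s • h)) unitMeasure :=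
    (by fun_prop : Continuous fun s : ℝ => k (x + s • h)).integrableOn_Ioc
  have hx : lineAvg k h x - k x = ∫ s, (k (x + s • h) - k x) ∂unitMeasure := by
    rw [integral_sub hint (integrable_const _)]
    simp [lineAvg]
  rw [hx, ← Real.norm_eq_abs]
  refine (norm_integral_le_of_norm_le_const (C := ε) ?_).trans (by simp)
  filter_upwards [ae_restrict_mem measurableSet_Ioc] with s hs
  refine (hkδ (a := x + s • h) (b := x) ?_).le
  calc dist (x + s • h) x = s * ‖h‖ := by simp [dist_eq_norm, norm_smul, abs_of_pos hs.1]
    _ ≤ ‖h‖ := mul_le_of_le_one_left (norm_nonneg h) hs.2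
    _ < δ := by simpa using hh

variable [MeasurableSpace E] [BorelSpace E] [ProperSpace E] {μ : Measure E} {f : E → ℝ} {p : ℝ}

variable [μ.IsAddHaarMeasure]

theorem meas_le_abs_lineAvg_sub_le {k : E → ℝ} (hf : Measurable f) (hk : Measurable k)
    (hp : 1 ≤ p) (hfkp : ∫⁻ x, ‖f x - k x‖ₑ ^ p ∂μ ≠ ⊤) (hkp : ∫⁻ x, ‖k x‖ₑ ^ p ∂μ ≠ ⊤)
    {ε : ℝ} (hε : 0 < ε) {h : E} (hkh : ∀ x, |lineAvg k h x - k x| < ε) :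
    μ {x | 3 * ε ≤ |lineAvg f h x - f x|} ≤
      2 * ((∫⁻ x, ‖f x - k x‖ₑ ^ p ∂μ) / ENNReal.ofReal (ε ^ p)) := by
  have hp0 : 0 ≤ p := by linarith
  set d : E → ℝ := fun x => f x - k x
  have hd : Measurable d := hf.sub hk
  have hsplit : ∀ᵐ x ∂μ, lineAvg f h x = lineAvg d h x + lineAvg k h x := by
    filter_upwards [ae_lineAvg_add hd hk hp hfkp hkp h] with x hx
    rw [← hx]
    simp [d]
  calc _ ≤ μ ({x | ε ≤ |lineAvg d h x|} ∪ {x | ε ≤ |d x|}) := by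
        refine measure_mono_ae ?_
        filter_upwards [hsplit] with x hx (hεx : 3 * ε ≤ |lineAvg f h x - f x|)
        change ε ≤ |lineAvg d h x| ∨ ε ≤ |d x|
        by_contra! hcon
        have htri : lineAvg f h x - f x = lineAvg d h x + (lineAvg k h x - k x) - d x := by
          rw [hx]; ring
        rw [htri] at hεx
        linarith [hkh x, abs_sub (lineAvg d h x + (lineAvg k h x - k x)) (d x),
          abs_add_le (lineAvg d h x) (lineAvg k h x - k x)]
    _ ≤ μ {x | ε ≤ |lineAvg d h x|} + μ {x | ε ≤ |d x|} := measure_union_le _ _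
    _ ≤ (∫⁻ x, ‖d x‖ₑ ^ p ∂μ) / ENNReal.ofReal (ε ^ p) +
        (∫⁻ x, ‖d x‖ₑ ^ p ∂μ) / ENNReal.ofReal (ε ^ p) :=
        add_le_add ((meas_le_abs_le (measurable_lineAvg hd h).aemeasurable hp0 hε).trans
          (ENNReal.div_le_div_right (lintegral_lineAvg_rpow_le hd hp h) _))
          (meas_le_abs_le hd.aemeasurable hp0 hε)
    _ = _ := (two_mul _).symm

theorem tendstoInMeasure_lineAvg (hf : Measurable f) (hp : 1 ≤ p)
    (hfp : ∫⁻ x, ‖f x‖ₑ ^ p ∂μ ≠ ⊤) : TendstoInMeasure μ (lineAvg f) (𝓝 0) f := by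
  rw [tendstoInMeasure_iff_norm]
  intro ε hε
  refine ENNReal.tendsto_nhds_zero.2 fun η hη => ?_
  rcases eq_or_ne η ⊤ with rfl | hη_top
  · exact Eventually.of_forall fun _ => le_top
  set c : ℝ≥0∞ := ENNReal.ofReal ((ε / 3) ^ p)
  have hc : c ≠ 0 := by simpa [c] using Real.rpow_pos_of_pos (by positivity : 0 < ε / 3) p
  obtain ⟨k, hk, hkc, hkp, hfk⟩ := exists_continuous_lintegral_sub_le hf (by linarith) hfp
    (mul_ne_zero (ENNReal.half_pos hη.ne').ne' hc)
  have hfk_top : ∫⁻ x, ‖f x - k x‖ₑ ^ p ∂μ ≠ ⊤ := ne_top_of_le_ne_top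
    (ENNReal.mul_ne_top (ENNReal.div_ne_top hη_top (by simp)) ENNReal.ofReal_ne_top) hfk
  filter_upwards [eventually_abs_lineAvg_sub_le hk hkc (by positivity : 0 < ε / 6)] with h hh
  have hle := meas_le_abs_lineAvg_sub_le hf hk.measurable hp hfk_top hkp
    (by positivity : 0 < ε / 3) fun x => (hh x).trans_lt (by linarith)
  rw [mul_div_cancel₀ ε (by norm_num)] at hle
  calc _ ≤ _ := hle
    _ ≤ 2 * (η / 2) := mul_le_mul_right (ENNReal.div_le_of_le_mul hfk) 2
    _ = η := ENNReal.mul_div_cancel (by simp) (by simp)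

variable {γ : ℝ} {l : Filter ℝ}

theorem IsLevelFilter.tendstoInMeasure_lineAvg (hl : IsLevelFilter p γ l) (hf : Measurable f)
    (hp : 1 ≤ p) (hfp : ∫⁻ x, ‖f x‖ₑ ^ p ∂μ ≠ ⊤) (θ : E) {t : ℝ} (ht : 0 < t) :
    TendstoInMeasure μ (fun lam => lineAvg f (levelRadius p γ lam t • θ)) l f := by
  have hr : Tendsto (fun lam => levelRadius p γ lam t • θ) l (𝓝 0) := by
    simpa using (hl.tendsto_levelRadius t ht).smul_const θ
  exact fun ε hε => (WeightedReverse.tendstoInMeasure_lineAvg hf hp hfp ε hε).comp hr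

variable [l.IsCountablyGenerated]

theorem le_liminf_dirFunctional [l.NeBot] (hl : IsLevelFilter p γ l) (hf : Measurable f)
    (hp : 1 ≤ p) (hγ : γ ≠ 0) (hfp : ∫⁻ x, ‖f x‖ₑ ^ p ∂μ ≠ ⊤) (θ : E) :
    ENNReal.ofReal (1 / |γ|) * ∫⁻ x, ‖f x‖ₑ ^ p ∂μ ≤ liminf (dirFunctional μ p γ f θ) l := by
  have hp0 : 0 < p := by linarith
  have heq : dirFunctional μ p γ f θ =ᶠ[l] _ :=
    hl.pos.mono fun lam hlam => dirFunctional_eq hp0 hγ hlam f θ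
  have hconst : 1 / |γ| = p / |γ| / p := by field_simp
  rw [liminf_congr heq, hconst,
    ← lintegral_rpow_mul_meas_lt_abs hf.aemeasurable hp0 (by positivity)]
  refine le_trans ?_ (lintegral_liminf_le fun lam =>
    (by fun_prop : Measurable fun t : ℝ => ENNReal.ofReal (p / |γ| * t ^ (p - 1))).mul
      (measurable_meas_lt_abs_lineAvg hf p γ lam θ))
  refine setLIntegral_mono' measurableSet_Ioi fun t ht => ?_
  rw [ENNReal.liminf_const_mul_of_ne_top ENNReal.ofReal_ne_top]
  gcongr
  exact meas_lt_abs_le_liminf (hl.tendstoInMeasure_lineAvg hf hp hfp θ ht) t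

theorem tendsto_dirFunctional_of_dominated (hl : IsLevelFilter p γ l) (hf : Measurable f)
    (hp : 1 ≤ p) (hγ : γ ≠ 0) (hfp : ∫⁻ x, ‖f x‖ₑ ^ p ∂μ ≠ ⊤) (θ : E) {B : ℝ → ℝ≥0∞}
    (hB : ∀ᶠ lam in l, ∀ t : ℝ, 0 < t →
      μ {x | t < |lineAvg f (levelRadius p γ lam t • θ) x|} ≤ B t)
    (hBint : ∫⁻ t in Set.Ioi (0 : ℝ), ENNReal.ofReal (p / |γ| * t ^ (p - 1)) * B t ≠ ⊤) :
    Tendsto (dirFunctional μ p γ f θ) l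
      (𝓝 (ENNReal.ofReal (1 / |γ|) * ∫⁻ x, ‖f x‖ₑ ^ p ∂μ)) := by
  have hp0 : 0 < p := by linarith
  have hconst : 1 / |γ| = p / |γ| / p := by field_simp
  refine Tendsto.congr' (hl.pos.mono fun lam hlam => (dirFunctional_eq hp0 hγ hlam f θ).symm) ?_
  rw [hconst, ← lintegral_rpow_mul_meas_lt_abs hf.aemeasurable hp0 (by positivity)]
  refine tendsto_lintegral_filter_of_dominated_convergence
    (fun t => ENNReal.ofReal (p / |γ| * t ^ (p - 1)) * B t) (Eventually.of_forall fun lam =>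
    (by fun_prop : Measurable fun t : ℝ => ENNReal.ofReal (p / |γ| * t ^ (p - 1))).mul
      (measurable_meas_lt_abs_lineAvg hf p γ lam θ)) ?_ hBint ?_
  · filter_upwards [hB] with lam hlam
    filter_upwards [ae_restrict_mem measurableSet_Ioi] with t ht
    gcongr
    exact hlam t ht
  · filter_upwards [ae_restrict_mem measurableSet_Ioi,
      meas_le_ae_eq_meas_lt μ (volume.restrict (Set.Ioi 0)) fun x => |f x|] with t (ht : 0 < t) hteq
    have hfin : μ {x | t / 2 ≤ |f x|} ≠ ⊤ := by
      refine ne_top_of_le_ne_top (ENNReal.div_ne_top hfp ?_)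
        (meas_le_abs_le hf.aemeasurable hp0.le (half_pos ht))
      simpa using Real.rpow_pos_of_pos (half_pos ht) p
    have hmeas := hl.tendstoInMeasure_lineAvg hf hp hfp θ ht
    exact ENNReal.Tendsto.const_mul
      (tendsto_meas_lt_abs hmeas hf.aemeasurable (half_lt_self ht) hfin hteq)
      (Or.inr ENNReal.ofReal_ne_top)

end Limits

section LargeExponent

theorem lintegral_rpow_mul_withDensity_lt_abs {α : Type*} [MeasurableSpace α] {μ : Measure α}
    {f : α → ℝ} (hf : Measurable f) {p c : ℝ} (hp : 1 < p)
    (hc : 0 ≤ c) :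
    ∫⁻ t in Set.Ioi (0 : ℝ), ENNReal.ofReal (c * t ^ (p - 1)) *
        ((μ.withDensity fun x => ‖f x‖ₑ) {x | t < |2 * f x|} / ENNReal.ofReal (t / 2)) =
      ENNReal.ofReal (2 ^ p * c / (p - 1)) * ∫⁻ x, ‖f x‖ₑ ^ p ∂μ := by
  have hweight : ∀ t ∈ Set.Ioi (0 : ℝ), ENNReal.ofReal (c * t ^ (p - 1)) *
        ((μ.withDensity fun x => ‖f x‖ₑ) {x | t < |2 * f x|} / ENNReal.ofReal (t / 2)) =
      ENNReal.ofReal (2 * c * t ^ (p - 1 - 1)) *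
        (μ.withDensity fun x => ‖f x‖ₑ) {x | t < |2 * f x|} := fun t (ht : 0 < t) => by
    rw [ENNReal.div_eq_inv_mul, ← mul_assoc, ← ENNReal.ofReal_inv_of_pos (half_pos ht),
      ← ENNReal.ofReal_mul (by positivity), Real.rpow_sub_one ht.ne' (p - 1)]
    congr 2
    field_simp
  have hpow (x : α) : ‖f x‖ₑ * ‖2 * f x‖ₑ ^ (p - 1) =
      ENNReal.ofReal (2 ^ (p - 1)) * ‖f x‖ₑ ^ p := by
    have htwo : ‖(2 : ℝ)‖ₑ ^ (p - 1) = ENNReal.ofReal (2 ^ (p - 1)) := by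
      rw [Real.enorm_of_nonneg zero_le_two, ENNReal.ofReal_rpow_of_pos two_pos]
    rw [enorm_mul, ENNReal.mul_rpow_of_nonneg _ _ (by linarith), htwo, mul_left_comm]
    congr 1
    nth_rw 1 [← ENNReal.rpow_one ‖f x‖ₑ]
    rw [← ENNReal.rpow_add_of_nonneg _ _ zero_le_one (by linarith), add_sub_cancel]
  rw [setLIntegral_congr_fun measurableSet_Ioi hweight,
    lintegral_rpow_mul_meas_lt_abs (hf.const_mul 2).aemeasurable (by linarith) (by positivity),
    lintegral_withDensity_eq_lintegral_mul _ (by fun_prop) (by fun_prop)]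
  simp only [Pi.mul_apply, hpow]
  have hp1 : 0 < p - 1 := by linarith
  rw [lintegral_const_mul' _ _ ENNReal.ofReal_ne_top, ← mul_assoc,
    ← ENNReal.ofReal_mul (by positivity)]
  congr 2
  rw [Real.rpow_sub_one two_ne_zero]
  field_simp

variable {E : Type*} [AddCommGroup E] [Module ℝ E] [MeasurableSpace E] [MeasurableAdd₂ E]
  [MeasurableSMul₂ ℝ E] {μ : Measure E} [SFinite μ] [μ.IsAddRightInvariant] {f : E → ℝ}

-- The part of `f` below `t / 2` contributes at most `t / 2` to the average.
theorem meas_lt_abs_lineAvg_le (hf : Measurable f) (h : E) {t : ℝ} (ht : 0 < t) :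
    μ {x | t < |lineAvg f h x|} ≤
      (μ.withDensity fun x => ‖f x‖ₑ) {x | t < |2 * f x|} / ENNReal.ofReal (t / 2) := by
  have hS : MeasurableSet {x | t < |2 * f x|} := measurableSet_lt measurable_const (by fun_prop)
  set G : E → ℝ≥0∞ := {x | t < |2 * f x|}.indicator fun x => ‖f x‖ₑ
  have hG : Measurable G := (by fun_prop : Measurable fun x => ‖f x‖ₑ).indicator hS
  have hGm : Measurable fun x => ∫⁻ s, G (x + s • h) ∂unitMeasure :=
    Measurable.lintegral_prod_right' (f := fun z : E × ℝ => G (z.1 + z.2 • h))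
      (hG.comp (by fun_prop))
  have hfG (y : E) : ‖f y‖ₑ ≤ G y + ENNReal.ofReal (t / 2) := by
    by_cases hy : t < |2 * f y|
    · rw [show G y = ‖f y‖ₑ from Set.indicator_of_mem (s := {x | t < |2 * f x|}) hy _]
      exact le_self_add
    · rw [Real.enorm_eq_ofReal_abs]
      rw [not_lt, abs_mul, abs_two] at hy
      exact (ENNReal.ofReal_le_ofReal (by linarith)).trans le_add_self
  have havg (x : E) : ‖lineAvg f h x‖ₑ ≤
      (∫⁻ s, G (x + s • h) ∂unitMeasure) + ENNReal.ofReal (t / 2) := by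
    calc _ ≤ ∫⁻ s, ‖f (x + s • h)‖ₑ ∂unitMeasure := enorm_integral_le_lintegral_enorm _
      _ ≤ ∫⁻ s, (G (x + s • h) + ENNReal.ofReal (t / 2)) ∂unitMeasure :=
          lintegral_mono fun s => hfG _
      _ = _ := by rw [lintegral_add_right _ measurable_const]; simp
  rw [withDensity_apply _ hS, ← lintegral_indicator hS, ← lintegral_lintegral_segment hG h]
  refine (measure_mono fun x (hx : t < |lineAvg f h x|) => ?_).trans
    (meas_ge_le_lintegral_div hGm.aemeasurable (by simpa using ht) ENNReal.ofReal_ne_top)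
  refine (ENNReal.add_le_add_iff_right (ENNReal.ofReal_ne_top (r := t / 2))).1 ?_
  calc _ = ENNReal.ofReal t := by
        rw [← ENNReal.ofReal_add (by positivity) (by positivity), add_halves]
    _ ≤ ‖lineAvg f h x‖ₑ := by rw [Real.enorm_eq_ofReal_abs]; gcongr
    _ ≤ _ := havg x

theorem dirFunctional_le_of_one_lt {p γ lam : ℝ} (hp : 1 < p) (hγ : γ ≠ 0) (hl : 0 < lam)
    (hf : Measurable f) (θ : E) :
    dirFunctional μ p γ f θ lam ≤
      ENNReal.ofReal (2 ^ p * (p / |γ|) / (p - 1)) * ∫⁻ x, ‖f x‖ₑ ^ p ∂μ := by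
  have hp0 : 0 < p := by linarith
  rw [dirFunctional_eq hp0 hγ hl, ← lintegral_rpow_mul_withDensity_lt_abs hf hp (by positivity)]
  refine setLIntegral_mono' measurableSet_Ioi fun t (ht : 0 < t) => ?_
  gcongr
  exact meas_lt_abs_lineAvg_le hf _ ht

theorem tendsto_dirFunctional_of_one_lt {E : Type*} [NormedAddCommGroup E] [NormedSpace ℝ E]
    [MeasurableSpace E] [BorelSpace E] [ProperSpace E] {μ : Measure E} [μ.IsAddHaarMeasure]
    {f : E → ℝ} (hf : Measurable f) {p γ : ℝ} (hp : 1 < p) (hγ : γ ≠ 0)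
    (hfp : ∫⁻ x, ‖f x‖ₑ ^ p ∂μ ≠ ⊤) {l : Filter ℝ} [l.IsCountablyGenerated]
    (hl : IsLevelFilter p γ l) (θ : E) :
    Tendsto (dirFunctional μ p γ f θ) l
      (𝓝 (ENNReal.ofReal (1 / |γ|) * ∫⁻ x, ‖f x‖ₑ ^ p ∂μ)) := by
  refine tendsto_dirFunctional_of_dominated hl hf hp.le hγ hfp θ
    (Eventually.of_forall fun lam t ht => meas_lt_abs_lineAvg_le hf _ ht) ?_
  rw [lintegral_rpow_mul_withDensity_lt_abs hf hp (by positivity)]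
  exact ENNReal.mul_ne_top ENNReal.ofReal_ne_top hfp

end LargeExponent

/-! ### The covering estimate -/

section Covering

theorem setLIntegral_Icc_add {φ : ℝ → ℝ≥0∞} (x : ℝ) {r : ℝ} (hr : 0 < r) :
    ∫⁻ y in Set.Icc x (x + r), φ y = ENNReal.ofReal r * ∫⁻ s, φ (x + s * r) ∂unitMeasure := by
  have himage : (fun s => x + s * r) '' Set.Ioc 0 1 = Set.Ioc x (x + r) := by
    have hcomp : (fun s => x + s * r) = (fun y => x + y) ∘ fun s => s * r := rfl
    rw [hcomp, Set.image_comp, Set.image_mul_right_Ioc _ _ hr, Set.image_const_add_Ioc]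
    simp
  have hderiv (s : ℝ) : HasDerivAt (fun s => x + s * r) r s := by
    simpa using ((hasDerivAt_id s).mul_const r).const_add x
  have hinj : Set.InjOn (fun s => x + s * r) (Set.Ioc 0 1) := fun a _ b _ hab => by
    simpa [hr.ne'] using hab
  rw [Measure.restrict_congr_set Ioc_ae_eq_Icc.symm, ← himage,
    lintegral_image_eq_lintegral_abs_deriv_mul measurableSet_Ioc
      (fun s _ => (hderiv s).hasDerivWithinAt) hinj, abs_of_pos hr,
    lintegral_const_mul' _ _ ENNReal.ofReal_ne_top]

/-- The lengths `r` for which, in the Vitali covering argument, an interval of length `r` can be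
absorbed by a selected interval of length `ℓ`. -/
def comparableScales (γ ℓ : ℝ) : Set ℝ := {r | 0 < r ∧ r ^ (γ + 1) ≤ 2 * ℓ ^ (γ + 1)}

theorem measurableSet_comparableScales (γ ℓ : ℝ) : MeasurableSet (comparableScales γ ℓ) :=
  measurableSet_Ioi.inter
    (measurableSet_le (f := fun r : ℝ => r ^ (γ + 1)) (by fun_prop) measurable_const)

variable {γ ℓ : ℝ}

theorem comparableScales_subset_Ioc (hγ : 0 < γ) (hℓ : 0 < ℓ) :
    comparableScales γ ℓ ⊆ Set.Ioc 0 (2 * ℓ) := by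
  rintro r ⟨hr, hle⟩
  refine ⟨hr, (Real.rpow_le_rpow_iff hr.le (by positivity) (by linarith : 0 < γ + 1)).1 ?_⟩
  refine hle.trans ?_
  rw [Real.mul_rpow zero_le_two hℓ.le]
  gcongr
  exact Real.self_le_rpow_of_one_le one_le_two (by linarith)

theorem comparableScales_subset_Ici (hγ : γ < -1) (hℓ : 0 < ℓ) :
    comparableScales γ ℓ ⊆ Set.Ici (2 ^ (1 / (γ + 1)) * ℓ) := by
  rintro r ⟨hr, hle⟩
  have hγ1 : γ + 1 < 0 := by linarith
  refine (Real.rpow_le_rpow_iff_of_neg hr (by positivity) hγ1).1 (hle.trans_eq ?_)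
  rw [Real.mul_rpow (by positivity) hℓ.le, ← Real.rpow_mul zero_le_two,
    one_div_mul_cancel hγ1.ne, Real.rpow_one]

theorem lintegral_comparableScales_le_of_pos (hγ : 0 < γ) (hℓ : 0 < ℓ) :
    ∫⁻ r in comparableScales γ ℓ, ENNReal.ofReal (r ^ (γ - 1) * (r + ℓ)) ≤
      ENNReal.ofReal (3 * 2 ^ γ / γ * ℓ ^ (γ + 1)) := by
  calc _ ≤ ∫⁻ r in Set.Ioc 0 (2 * ℓ), ENNReal.ofReal (r ^ (γ - 1) * (r + ℓ)) :=
        lintegral_mono_set (comparableScales_subset_Ioc hγ hℓ)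
    _ ≤ ∫⁻ r in Set.Ioc 0 (2 * ℓ), ENNReal.ofReal (3 * ℓ) * ENNReal.ofReal (r ^ (γ - 1)) := by
        refine setLIntegral_mono' measurableSet_Ioc fun r hr => ?_
        rw [← ENNReal.ofReal_mul (by positivity), mul_comm]
        have hpow : 0 ≤ r ^ (γ - 1) := Real.rpow_nonneg hr.1.le _
        gcongr
        linarith [hr.2]
    _ = _ := by
        rw [lintegral_const_mul' _ _ ENNReal.ofReal_ne_top,
          lintegral_Ioc_rpow (by linarith) (by positivity), ← ENNReal.ofReal_mul (by positivity),
          sub_add_cancel, Real.mul_rpow zero_le_two hℓ.le, Real.rpow_add_one hℓ.ne']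
        congr 1
        ring

theorem lintegral_comparableScales_le_of_lt (hγ : γ < -1) (hℓ : 0 < ℓ) {c : ℝ}
    (hc : c = 2 ^ (1 / (γ + 1))) :
    ∫⁻ r in comparableScales γ ℓ, ENNReal.ofReal (r ^ (γ - 1) * (r + ℓ)) ≤
      ENNReal.ofReal ((1 + 1 / c) * c ^ (γ + 1) / -(γ + 1) * ℓ ^ (γ + 1)) := by
  have hc0 : 0 < c := hc ▸ by positivity
  calc _ ≤ ∫⁻ r in Set.Ici (c * ℓ), ENNReal.ofReal (r ^ (γ - 1) * (r + ℓ)) :=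
        lintegral_mono_set (hc ▸ comparableScales_subset_Ici hγ hℓ)
    _ ≤ ∫⁻ r in Set.Ici (c * ℓ), ENNReal.ofReal (1 + 1 / c) * ENNReal.ofReal (r ^ γ) := by
        refine setLIntegral_mono' measurableSet_Ici fun r (hr : c * ℓ ≤ r) => ?_
        have hr0 : 0 < r := (mul_pos hc0 hℓ).trans_le hr
        rw [← ENNReal.ofReal_mul (by positivity), Real.rpow_sub_one hr0.ne',
          div_mul_eq_mul_div, mul_div_assoc, mul_comm (1 + 1 / c)]
        gcongr
        rw [add_div, div_self hr0.ne']
        gcongr 1 + ?_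
        rw [div_le_div_iff₀ hr0 hc0]
        linarith
    _ = _ := by
        rw [Measure.restrict_congr_set Ioi_ae_eq_Ici.symm,
          lintegral_const_mul' _ _ ENNReal.ofReal_ne_top, lintegral_Ioi_rpow hγ (by positivity),
          ← ENNReal.ofReal_mul (by positivity), Real.mul_rpow hc0.le hℓ.le]
        congr 1
        field_simp

theorem exists_lintegral_comparableScales_le (hγ : 0 < γ ∨ γ < -1) :
    ∃ K : ℝ, 0 < K ∧ ∀ ℓ : ℝ, 0 < ℓ →
      ∫⁻ r in comparableScales γ ℓ, ENNReal.ofReal (r ^ (γ - 1) * (r + ℓ)) ≤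
        ENNReal.ofReal (K * ℓ ^ (γ + 1)) := by
  rcases hγ with hγ | hγ
  · exact ⟨_, by positivity, fun ℓ hℓ => lintegral_comparableScales_le_of_pos hγ hℓ⟩
  · refine ⟨_, ?_, fun ℓ hℓ => lintegral_comparableScales_le_of_lt hγ hℓ rfl⟩
    have hγ1 : 0 < -(γ + 1) := by linarith
    positivity

/-- The intervals `(x, r)`, encoded by left endpoint and length, on which the average of `φ`
exceeds `r ^ γ`. -/
def badIntervals (γ : ℝ) (φ : ℝ → ℝ≥0∞) : Set (ℝ × ℝ) :=
  {b | 0 < b.2 ∧ ENNReal.ofReal (b.2 ^ γ) < ∫⁻ s, φ (b.1 + s * b.2) ∂unitMeasure}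

variable {φ : ℝ → ℝ≥0∞}

theorem ofReal_rpow_le_setLIntegral {b : ℝ × ℝ} (hb : b ∈ badIntervals γ φ) :
    ENNReal.ofReal (b.2 ^ (γ + 1)) ≤ ∫⁻ y in Set.Icc b.1 (b.1 + b.2), φ y := by
  rw [setLIntegral_Icc_add b.1 hb.1, Real.rpow_add_one hb.1.ne', mul_comm,
    ENNReal.ofReal_mul hb.1.le]
  gcongr
  exact hb.2.le

-- Vitali selection with respect to the gauge `r ^ (γ + 1)`, which is bounded on bad intervals.
theorem exists_disjoint_badIntervals (hφ : ∫⁻ x, φ x ≠ ⊤) :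
    ∃ u ⊆ badIntervals γ φ, u.PairwiseDisjoint (fun b => Set.Icc b.1 (b.1 + b.2)) ∧
      u.Countable ∧ ∀ a ∈ badIntervals γ φ, ∃ b ∈ u,
        a.2 ∈ comparableScales γ b.2 ∧ a.1 ∈ Set.Icc (b.1 - a.2) (b.1 + b.2) := by
  obtain ⟨u, hu, hdisj, hcov⟩ := Vitali.exists_disjoint_subfamily_covering_enlargement
    (fun b : ℝ × ℝ => Set.Icc b.1 (b.1 + b.2)) (badIntervals γ φ)
    (fun b => b.2 ^ (γ + 1)) 2 one_lt_two (fun b hb => Real.rpow_nonneg hb.1.le _)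
    (∫⁻ x, φ x).toReal (fun b hb => by
      rw [← ENNReal.ofReal_le_iff_le_toReal hφ]
      exact (ofReal_rpow_le_setLIntegral hb).trans (setLIntegral_le_lintegral _ _))
    (fun b hb => Set.nonempty_Icc.2 (by linarith [hb.1]))
  refine ⟨u, hu, hdisj, hdisj.countable_of_nonempty_interior fun b hb => ?_, fun a ha => ?_⟩
  · rw [interior_Icc]
    exact Set.nonempty_Ioo.2 (by linarith [(hu hb).1])
  · obtain ⟨b, hb, ⟨y, hya, hyb⟩, hle⟩ := hcov a ha
    exact ⟨b, hb, ⟨ha.1, hle⟩, by linarith [hya.2, hyb.1], by linarith [hya.1, hyb.2]⟩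

theorem volume_setOf_mk_mem_badIntervals_le {u : Set (ℝ × ℝ)} (hu : u.Countable)
    (hcov : ∀ a ∈ badIntervals γ φ, ∃ b ∈ u,
      a.2 ∈ comparableScales γ b.2 ∧ a.1 ∈ Set.Icc (b.1 - a.2) (b.1 + b.2)) (r : ℝ) :
    volume {x | (x, r) ∈ badIntervals γ φ} ≤
      ∑' b : u, (comparableScales γ b.1.2).indicator (fun r => ENNReal.ofReal (r + b.1.2)) r := by
  have := hu.to_subtype
  calc _ ≤ volume (⋃ b : u, {x : ℝ | r ∈ comparableScales γ b.1.2 ∧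
        x ∈ Set.Icc (b.1.1 - r) (b.1.1 + b.1.2)}) := by
        refine measure_mono fun x hx => ?_
        obtain ⟨b, hb, hxb⟩ := hcov (x, r) hx
        exact Set.mem_iUnion.2 ⟨⟨b, hb⟩, hxb⟩
    _ ≤ ∑' b : u, volume {x : ℝ | r ∈ comparableScales γ b.1.2 ∧
        x ∈ Set.Icc (b.1.1 - r) (b.1.1 + b.1.2)} := measure_iUnion_le _
    _ ≤ _ := by
        refine ENNReal.tsum_le_tsum fun b => ?_
        by_cases hr : r ∈ comparableScales γ b.1.2
        · rw [Set.indicator_of_mem hr]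
          refine (measure_mono fun x hx => hx.2).trans ?_
          rw [Real.volume_Icc]
          exact ENNReal.ofReal_le_ofReal (by linarith)
        · simp [hr]

theorem exists_lintegral_volume_badIntervals_le (hγ : 0 < γ ∨ γ < -1) :
    ∃ K : ℝ, 0 < K ∧ ∀ φ : ℝ → ℝ≥0∞,
      ∫⁻ r in Set.Ioi (0 : ℝ), ENNReal.ofReal (r ^ (γ - 1)) *
        volume {x | (x, r) ∈ badIntervals γ φ} ≤ ENNReal.ofReal K * ∫⁻ x, φ x := by
  obtain ⟨K, hK, hKb⟩ := exists_lintegral_comparableScales_le hγ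
  refine ⟨K, hK, fun φ => ?_⟩
  rcases eq_or_ne (∫⁻ x, φ x) ⊤ with hφ | hφ
  · rw [hφ, ENNReal.mul_top (by simpa using hK)]
    exact le_top
  obtain ⟨u, hub, hdisj, hu, hcov⟩ := exists_disjoint_badIntervals (γ := γ) hφ
  have := hu.to_subtype
  set F : ℝ → ℝ → ℝ≥0∞ := fun ℓ => (comparableScales γ ℓ).indicator fun r =>
    ENNReal.ofReal (r ^ (γ - 1) * (r + ℓ))
  have hF (ℓ : ℝ) : Measurable (F ℓ) :=
    (by fun_prop : Measurable fun r : ℝ => ENNReal.ofReal (r ^ (γ - 1) * (r + ℓ))).indicator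
      (measurableSet_comparableScales γ ℓ)
  calc _ ≤ ∫⁻ r in Set.Ioi (0 : ℝ), ∑' b : u, F b.1.2 r := by
        refine setLIntegral_mono' measurableSet_Ioi fun r (hr : 0 < r) => ?_
        refine (mul_le_mul_right (volume_setOf_mk_mem_badIntervals_le hu hcov r) _).trans_eq ?_
        rw [← ENNReal.tsum_mul_left]
        refine tsum_congr fun b => ?_
        rw [← Set.indicator_mul_right _ fun r : ℝ => ENNReal.ofReal (r ^ (γ - 1))]
        by_cases hrb : r ∈ comparableScales γ b.1.2 <;>
          simp [F, hrb, ENNReal.ofReal_mul (Real.rpow_nonneg hr.le _)]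
    _ = ∑' b : u, ∫⁻ r in Set.Ioi (0 : ℝ), F b.1.2 r :=
        lintegral_tsum fun b => (hF _).aemeasurable
    _ ≤ ∑' b : u, ENNReal.ofReal K * ∫⁻ y in Set.Icc b.1.1 (b.1.1 + b.1.2), φ y := by
        refine ENNReal.tsum_le_tsum fun b => (setLIntegral_le_lintegral _ _).trans ?_
        rw [lintegral_indicator (measurableSet_comparableScales γ _)]
        refine (hKb _ (hub b.2).1).trans ?_
        rw [ENNReal.ofReal_mul hK.le]
        gcongr
        exact ofReal_rpow_le_setLIntegral (hub b.2)
    _ = ENNReal.ofReal K * ∫⁻ y in ⋃ b ∈ u, Set.Icc b.1 (b.1 + b.2), φ y := by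
        rw [ENNReal.tsum_mul_left, lintegral_biUnion hu (fun b _ => measurableSet_Icc) hdisj]
    _ ≤ _ := mul_le_mul_right (setLIntegral_le_lintegral _ _) _

end Covering

section Transference

variable {E : Type*} [AddCommGroup E] [Module ℝ E] {γ : ℝ} {φ : E → ℝ≥0∞}

/-- The pairs `(r, x)` such that the average of `φ` over the segment from `x` to `x + r • θ`
exceeds `r ^ γ`. -/
def badSegments (γ : ℝ) (φ : E → ℝ≥0∞) (θ : E) : Set (ℝ × E) :=
  {z | ENNReal.ofReal (z.1 ^ γ) < ∫⁻ s, φ (z.2 + s • z.1 • θ) ∂unitMeasure}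

theorem badSegments_subset_badIntervals {r R : ℝ} (hr : r ∈ Set.Ioc 0 R) (θ x : E) :
    {a ∈ Set.Ioc 0 R | (r, x + a • θ) ∈ badSegments γ φ θ} ⊆
      {a | (a, r) ∈ badIntervals γ ((Set.Ioc 0 (2 * R)).indicator fun a => φ (x + a • θ))} := by
  rintro a ⟨ha, hbad⟩
  refine ⟨hr.1, hbad.trans_eq (setLIntegral_congr_fun measurableSet_Ioc fun s hs => ?_)⟩
  have hmem : a + s * r ∈ Set.Ioc 0 (2 * R) :=
    ⟨by nlinarith [ha.1, hs.1, hr.1], by nlinarith [ha.2, hs.2, hr.1, hr.2]⟩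
  simp only
  rw [Set.indicator_of_mem hmem, add_smul, mul_smul, add_assoc]

variable [MeasurableSpace E] [MeasurableAdd₂ E] [MeasurableSMul₂ ℝ E] {μ : Measure E} [SFinite μ]
  [μ.IsAddRightInvariant]

theorem measurableSet_badSegments (hφ : Measurable φ) (γ : ℝ) (θ : E) :
    MeasurableSet (badSegments γ φ θ) := by
  have hinner : Measurable fun z : (ℝ × E) × ℝ => φ (z.1.2 + z.2 • z.1.1 • θ) := by fun_prop
  exact measurableSet_lt (by fun_prop) (hinner.lintegral_prod_right' (ν := unitMeasure))

theorem mul_meas_badSegments (hφ : Measurable φ) (θ : E) (r : ℝ) {R : ℝ} :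
    ENNReal.ofReal R * μ {x | (r, x) ∈ badSegments γ φ θ} =
      ∫⁻ x, volume {a ∈ Set.Ioc 0 R | (r, x + a • θ) ∈ badSegments γ φ θ} ∂μ := by
  set T : Set (ℝ × E) := {z | z.1 ∈ Set.Ioc 0 R ∧ (r, z.2 + z.1 • θ) ∈ badSegments γ φ θ}
  have hT : MeasurableSet T :=
    (measurable_fst measurableSet_Ioc).inter
      ((by fun_prop : Measurable fun z : ℝ × E => (r, z.2 + z.1 • θ))
        (measurableSet_badSegments hφ γ θ))
  have hslice (a : ℝ) : μ (Prod.mk a ⁻¹' T) =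
      (Set.Ioc 0 R).indicator (fun _ => μ {x | (r, x) ∈ badSegments γ φ θ}) a := by
    by_cases ha : a ∈ Set.Ioc 0 R
    · rw [Set.indicator_of_mem ha,
        ← measure_preimage_add_right μ (a • θ) {x | (r, x) ∈ badSegments γ φ θ}]
      congr 1
      ext x
      exact and_iff_right ha
    · rw [Set.indicator_of_notMem ha]
      convert measure_empty (μ := μ)
      ext x
      exact iff_of_false (fun hx => ha hx.1) id
  calc _ = (volume.prod μ) T := by
        simp_rw [Measure.prod_apply hT, hslice, lintegral_indicator measurableSet_Ioc,
          setLIntegral_const, Real.volume_Ioc, sub_zero, mul_comm]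
    _ = _ := Measure.prod_apply_symm hT

-- Calderón's transference: translating along `θ` by `a ∈ (0, R]` and averaging over `a` reduces
-- the estimate for segments in `E` to the one-dimensional estimate on the lines parallel to `θ`.
theorem setLIntegral_Ioc_meas_badSegments_le {K : ℝ}
    (hK : ∀ φ : ℝ → ℝ≥0∞, ∫⁻ r in Set.Ioi (0 : ℝ), ENNReal.ofReal (r ^ (γ - 1)) *
      volume {x | (x, r) ∈ badIntervals γ φ} ≤ ENNReal.ofReal K * ∫⁻ x, φ x)
    (hφ : Measurable φ) (θ : E) {R : ℝ} (hR : 0 < R) :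
    ∫⁻ r in Set.Ioc 0 R, ENNReal.ofReal (r ^ (γ - 1)) * μ {x | (r, x) ∈ badSegments γ φ θ} ≤
      2 * ENNReal.ofReal K * ∫⁻ x, φ x ∂μ := by
  set w : ℝ → ℝ≥0∞ := fun r => ENNReal.ofReal (r ^ (γ - 1))
  set V : ℝ → E → ℝ≥0∞ := fun r x =>
    volume {a ∈ Set.Ioc 0 R | (r, x + a • θ) ∈ badSegments γ φ θ}
  have hV : Measurable (Function.uncurry V) :=
    measurable_measure_prodMk_left (s := {z : (ℝ × E) × ℝ | z.2 ∈ Set.Ioc 0 R ∧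
      (z.1.1, z.1.2 + z.2 • θ) ∈ badSegments γ φ θ}) ((measurable_snd measurableSet_Ioc).inter
      ((by fun_prop : Measurable fun z : (ℝ × E) × ℝ => (z.1.1, z.1.2 + z.2 • θ))
        (measurableSet_badSegments hφ γ θ)))
  have hline (x : E) : ∫⁻ r in Set.Ioc 0 R, w r * V r x ≤
      ENNReal.ofReal K * ∫⁻ a in Set.Ioc 0 (2 * R), φ (x + a • θ) := by
    rw [← lintegral_indicator measurableSet_Ioc (fun a : ℝ => φ (x + a • θ))]
    refine le_trans ?_ (hK _)
    refine (setLIntegral_mono' measurableSet_Ioc fun r hr => ?_).trans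
      (lintegral_mono_set Set.Ioc_subset_Ioi_self)
    exact mul_le_mul_right (measure_mono (badSegments_subset_badIntervals hr θ x)) _
  have htranslate (a : ℝ) : ∫⁻ x, φ (x + a • θ) ∂μ = ∫⁻ x, φ x ∂μ :=
    lintegral_add_right_eq_self φ (a • θ)
  refine (ENNReal.mul_le_mul_iff_right (a := ENNReal.ofReal R) (by simpa using hR)
    ENNReal.ofReal_ne_top).1 ?_
  calc _ = ∫⁻ r in Set.Ioc 0 R, (∫⁻ x, w r * V r x ∂μ) := by
        rw [← lintegral_const_mul' _ _ ENNReal.ofReal_ne_top]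
        refine lintegral_congr fun r => ?_
        rw [mul_left_comm, mul_meas_badSegments hφ,
          lintegral_const_mul' _ _ ENNReal.ofReal_ne_top]
    _ = ∫⁻ x, (∫⁻ r in Set.Ioc 0 R, w r * V r x) ∂μ :=
        lintegral_lintegral_swap (((by fun_prop : Measurable w).comp measurable_fst).mul
          hV).aemeasurable
    _ ≤ ∫⁻ x, ENNReal.ofReal K * (∫⁻ a in Set.Ioc 0 (2 * R), φ (x + a • θ)) ∂μ :=
        lintegral_mono hline
    _ = ENNReal.ofReal K * ∫⁻ a in Set.Ioc 0 (2 * R), (∫⁻ x, φ (x + a • θ) ∂μ) := by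
        rw [lintegral_const_mul' _ _ ENNReal.ofReal_ne_top, lintegral_lintegral_swap
          (by fun_prop : Measurable fun z : E × ℝ => φ (z.1 + z.2 • θ)).aemeasurable]
    _ = _ := by
        simp_rw [htranslate, setLIntegral_const, Real.volume_Ioc, sub_zero,
          ENNReal.ofReal_mul zero_le_two, ENNReal.ofReal_ofNat]
        ring

theorem exists_lintegral_meas_badSegments_le (hγ : 0 < γ ∨ γ < -1) :
    ∃ K : ℝ≥0, ∀ φ : E → ℝ≥0∞, Measurable φ → ∀ θ : E,
      ∫⁻ r in Set.Ioi (0 : ℝ), ENNReal.ofReal (r ^ (γ - 1)) *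
        μ {x | (r, x) ∈ badSegments γ φ θ} ≤ K * ∫⁻ x, φ x ∂μ := by
  obtain ⟨K, -, hK⟩ := exists_lintegral_volume_badIntervals_le hγ
  refine ⟨2 * K.toNNReal, fun φ hφ θ => ?_⟩
  have hIoi : Set.Ioi (0 : ℝ) = ⋃ n : ℕ, Set.Ioc 0 ((n : ℝ) + 1) := by
    ext r
    simp only [Set.mem_iUnion, Set.mem_Ioc, exists_and_left, Set.mem_Ioi, iff_self_and]
    exact fun _ => (exists_nat_ge r).imp fun n hn => by linarith
  have hmono : Monotone fun n : ℕ => Set.Ioc (0 : ℝ) ((n : ℝ) + 1) :=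
    fun m n hmn => Set.Ioc_subset_Ioc_right (by gcongr)
  rw [hIoi, setLIntegral_iUnion_of_directed _ hmono.directed_le, ENNReal.coe_mul]
  exact iSup_le fun n => setLIntegral_Ioc_meas_badSegments_le hK hφ θ (by positivity)

theorem exists_dirFunctional_one_le (μ : Measure E) [SFinite μ] [μ.IsAddRightInvariant]
    (hγ : 0 < γ ∨ γ < -1) :
    ∃ K : ℝ≥0, ∀ f : E → ℝ, Measurable f → ∀ θ : E, ∀ lam : ℝ, 0 < lam →
      dirFunctional μ 1 γ f θ lam ≤ K * ∫⁻ x, ‖f x‖ₑ ∂μ := by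
  obtain ⟨K, hK⟩ := exists_lintegral_meas_badSegments_le (μ := μ) hγ
  refine ⟨K, fun f hf θ lam hlam => ?_⟩
  have hlam_pos : ENNReal.ofReal lam ≠ 0 := by simpa using hlam
  have hbad {r : ℝ} (hr : 0 < r) : {x | lam * r ^ γ < |lineAvg f (r • θ) x|} ⊆
      {x | (r, x) ∈ badSegments γ (fun y => (ENNReal.ofReal lam)⁻¹ * ‖f y‖ₑ) θ} := by
    intro x (hx : lam * r ^ γ < |lineAvg f (r • θ) x|)
    change _ < ∫⁻ s, _ ∂unitMeasure
    rw [lintegral_const_mul' _ _ (by simpa using hlam), mul_comm, ← div_eq_mul_inv,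
      ENNReal.lt_div_iff_mul_lt (Or.inl hlam_pos) (Or.inl ENNReal.ofReal_ne_top), mul_comm,
      ← ENNReal.ofReal_mul hlam.le]
    refine lt_of_lt_of_le ?_ (enorm_integral_le_lintegral_enorm _)
    change _ < ‖lineAvg f (r • θ) x‖ₑ
    rw [Real.enorm_eq_ofReal_abs]
    exact (ENNReal.ofReal_lt_ofReal_iff_of_nonneg (by positivity)).2 hx
  calc _ ≤ ∫⁻ r in Set.Ioi (0 : ℝ), ENNReal.ofReal lam * (ENNReal.ofReal (r ^ (γ - 1)) *
        μ {x | (r, x) ∈ badSegments γ (fun y => (ENNReal.ofReal lam)⁻¹ * ‖f y‖ₑ) θ}) := by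
        simp only [dirFunctional, Real.rpow_one, div_one, ENNReal.ofReal_mul hlam.le, mul_assoc]
        refine setLIntegral_mono' measurableSet_Ioi fun r hr => ?_
        gcongr
        exact fun h => hbad hr h
    _ ≤ ENNReal.ofReal lam * (K * ∫⁻ x, (ENNReal.ofReal lam)⁻¹ * ‖f x‖ₑ ∂μ) := by
        rw [lintegral_const_mul' _ _ ENNReal.ofReal_ne_top]
        gcongr
        exact hK _ (by fun_prop) θ
    _ = _ := by
        rw [lintegral_const_mul' _ _ (by simpa using hlam), mul_left_comm,
          ENNReal.mul_inv_cancel_left hlam_pos ENNReal.ofReal_ne_top]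

end Transference

/-! ### Exponent one -/

section Domination

theorem setLIntegral_Ioi_mul_indicator_Iic (w g : ℝ → ℝ≥0∞) (M : ℝ) :
    ∫⁻ t in Set.Ioi (0 : ℝ), w t * (Set.Iic M).indicator g t =
      ∫⁻ t in Set.Ioc 0 M, w t * g t := by
  simp_rw [← Set.indicator_mul_right]
  rw [setLIntegral_indicator measurableSet_Iic, Set.inter_comm, Set.Ioi_inter_Iic]

theorem lintegral_mul_indicator_rpow_add_one_ne_top {q : ℝ} (hq : -1 < q) {M : ℝ} (hM : 0 ≤ M)
    {c V : ℝ≥0∞} (hc : c ≠ ⊤) (hV : V ≠ ⊤) :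
    ∫⁻ t in Set.Ioi (0 : ℝ), c *
      (Set.Iic M).indicator (fun t => ENNReal.ofReal (t ^ q + 1) * V) t ≠ ⊤ := by
  rw [setLIntegral_Ioi_mul_indicator_Iic fun _ => c, lintegral_const_mul' _ _ hc,
    lintegral_mul_const' _ _ hV]
  refine ENNReal.mul_ne_top hc (ENNReal.mul_ne_top ?_ hV)
  refine ne_top_of_le_ne_top ?_ (lintegral_mono fun t => ENNReal.ofReal_add_le)
  rw [lintegral_add_right _ measurable_const, lintegral_Ioc_rpow hq hM]
  simp

variable {E : Type*} [NormedAddCommGroup E] [NormedSpace ℝ E] {k : E → ℝ}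

theorem exists_mem_ball_of_lineAvg_ne_zero {R : ℝ} (hR : Function.support k ⊆ Metric.ball 0 R)
    {h x : E} (hx : lineAvg k h x ≠ 0) :
    ∃ j ∈ Finset.range (⌊‖h‖⌋₊ + 1), x ∈ Metric.ball (-((j : ℝ) • ‖h‖⁻¹ • h)) (R + 1) := by
  set e : E := ‖h‖⁻¹ • h
  have he : ‖e‖ ≤ 1 := by
    rw [norm_smul, norm_inv, norm_norm]
    exact inv_mul_le_one
  have hh : h = ‖h‖ • e := by
    rcases eq_or_ne h 0 with h0 | h0
    · simp [h0]
    · exact (smul_inv_smul₀ (norm_ne_zero_iff.2 h0) h).symm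
  obtain ⟨s, hs, hks⟩ : ∃ s ∈ Set.Ioc (0 : ℝ) 1, k (x + s • h) ≠ 0 := by
    contrapose! hx
    exact setIntegral_eq_zero_of_forall_eq_zero hx
  set j : ℕ := ⌊s * ‖h‖⌋₊
  have hj : (j : ℝ) ≤ s * ‖h‖ := Nat.floor_le (mul_nonneg hs.1.le (norm_nonneg h))
  refine ⟨j, Finset.mem_range_succ_iff.2
    (Nat.floor_le_floor (mul_le_of_le_one_left (norm_nonneg h) hs.2)), ?_⟩
  have hsplit : x - -((j : ℝ) • e) = (x + s • h) - (s * ‖h‖ - j) • e := by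
    rw [sub_smul, mul_smul, ← hh]
    abel
  have hrem : ‖(s * ‖h‖ - j) • e‖ ≤ 1 := by
    rw [norm_smul, Real.norm_eq_abs, abs_of_nonneg (sub_nonneg.2 hj)]
    exact mul_le_one₀ (by linarith [Nat.lt_floor_add_one (s * ‖h‖)]) (norm_nonneg e) he
  rw [mem_ball_iff_norm, hsplit]
  linarith [norm_sub_le (x + s • h) ((s * ‖h‖ - j) • e), mem_ball_zero_iff.1 (hR hks)]

variable [MeasurableSpace E] [BorelSpace E] {μ : Measure E} [μ.IsAddHaarMeasure]

theorem meas_lineAvg_ne_zero_le {R : ℝ} (hR : Function.support k ⊆ Metric.ball 0 R) (h : E) :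
    μ {x | lineAvg k h x ≠ 0} ≤ ENNReal.ofReal (‖h‖ + 1) * μ (Metric.ball (0 : E) (R + 1)) := by
  calc _ ≤ μ (⋃ j ∈ Finset.range (⌊‖h‖⌋₊ + 1),
        Metric.ball (-((j : ℝ) • ‖h‖⁻¹ • h)) (R + 1)) := measure_mono fun x hx => by
        simpa only [Set.mem_iUnion, exists_prop] using exists_mem_ball_of_lineAvg_ne_zero hR hx
    _ ≤ ∑ j ∈ Finset.range (⌊‖h‖⌋₊ + 1),
        μ (Metric.ball (-((j : ℝ) • ‖h‖⁻¹ • h)) (R + 1)) := measure_biUnion_finset_le _ _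
    _ = ((⌊‖h‖⌋₊ + 1 : ℕ) : ℝ≥0∞) * μ (Metric.ball (0 : E) (R + 1)) := by
        simp [Measure.addHaar_ball_center]
    _ ≤ _ := by
        gcongr
        rw [← ENNReal.ofReal_natCast]
        refine ENNReal.ofReal_le_ofReal ?_
        push_cast
        linarith [Nat.floor_le (norm_nonneg h)]

variable [ProperSpace E]

theorem tendsto_dirFunctional_one_of_continuous (hk : Continuous k) (hkc : HasCompactSupport k)
    {γ : ℝ} (hγ : 0 < γ ∨ γ < -1) {θ : E} (hθ : ‖θ‖ = 1) {l : Filter ℝ}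
    [l.IsCountablyGenerated] (hl : IsLevelFilter 1 γ l) :
    Tendsto (dirFunctional μ 1 γ k θ) l (𝓝 (ENNReal.ofReal (1 / |γ|) * ∫⁻ x, ‖k x‖ₑ ∂μ)) := by
  have hγ0 : γ ≠ 0 := by rcases hγ with h | h <;> linarith
  have hexp : -1 < 1 / γ := by
    rcases hγ with h | h
    · linarith [one_div_pos.2 h]
    · rw [lt_div_iff_of_neg (by linarith)]
      linarith
  obtain ⟨M, hM⟩ := hk.bounded_above_of_compact_support hkc
  obtain ⟨R, hR⟩ := hkc.isCompact.isBounded.subset_ball (0 : E)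
  have hk1 : ∫⁻ x, ‖k x‖ₑ ^ (1 : ℝ) ∂μ ≠ ⊤ := by
    simpa using (hk.integrable_of_hasCompactSupport hkc).2.ne
  set V : ℝ≥0∞ := μ (Metric.ball (0 : E) (R + 1))
  have hlim := tendsto_dirFunctional_of_dominated hl hk.measurable le_rfl hγ0 hk1 θ
    (B := (Set.Iic M).indicator fun t => ENNReal.ofReal (t ^ (1 / γ) + 1) * V) ?_ ?_
  · simpa using hlim
  · filter_upwards [hl.levelRadius_le, hl.pos] with lam hle hlam t ht
    refine Set.le_indicator_apply (fun _ => ?_) fun htM => ?_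
    · have hnorm : ‖levelRadius 1 γ lam t • θ‖ = levelRadius 1 γ lam t := by
        rw [norm_smul, hθ, mul_one, Real.norm_of_nonneg (levelRadius_pos hlam ht).le]
      refine (measure_mono fun x (hx : t < |lineAvg k _ x|) => abs_pos.1 (ht.trans hx)).trans
        ((meas_lineAvg_ne_zero_le ((subset_tsupport k).trans hR) _).trans ?_)
      rw [hnorm]
      gcongr
      exact hle t ht
    · refine (measure_mono_null (fun x (hx : t < |lineAvg k _ x|) => ?_) measure_empty).le
      exact htM (hx.le.trans (abs_lineAvg_le hM _ x))
  · simpa using lintegral_mul_indicator_rpow_add_one_ne_top hexp ((norm_nonneg _).trans (hM 0))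
      ENNReal.ofReal_ne_top measure_ball_lt_top.ne

end Domination

section Density

variable {E : Type*} [AddCommGroup E] [Module ℝ E] [MeasurableSpace E] {μ : Measure E}
  {p γ lam : ℝ} {f g : E → ℝ}

theorem mul_dirFunctional_mul {c : ℝ} (hc : 0 < c) (hlam : 0 < lam) (f : E → ℝ) (θ : E) :
    ENNReal.ofReal (c ^ (-p)) * dirFunctional μ p γ f θ (c * lam) =
      ∫⁻ r in Set.Ioi (0 : ℝ), ENNReal.ofReal (lam ^ p * r ^ (γ - 1)) *
        μ {x | c * lam * r ^ (γ / p) < |lineAvg f (r • θ) x|} := by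
  rw [dirFunctional, ← lintegral_const_mul' _ _ ENNReal.ofReal_ne_top]
  refine lintegral_congr fun r => ?_
  rw [← mul_assoc, ← ENNReal.ofReal_mul (by positivity), Real.mul_rpow hc.le hlam.le, mul_assoc,
    ← mul_assoc, ← Real.rpow_add hc, neg_add_cancel, Real.rpow_zero, one_mul]

variable [MeasurableAdd₂ E] [MeasurableSMul₂ ℝ E] [SFinite μ] [μ.IsAddRightInvariant]

theorem dirFunctional_add_le (hf : Measurable f) (hg : Measurable g) (hp : 1 ≤ p)
    (hfp : ∫⁻ x, ‖f x‖ₑ ^ p ∂μ ≠ ⊤) (hgp : ∫⁻ x, ‖g x‖ₑ ^ p ∂μ ≠ ⊤) (θ : E) {a b : ℝ}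
    (ha : 0 < a) (hb : 0 < b) (hab : a + b = 1) (hlam : 0 < lam) :
    dirFunctional μ p γ (fun x => f x + g x) θ lam ≤
      ENNReal.ofReal (a ^ (-p)) * dirFunctional μ p γ f θ (a * lam) +
      ENNReal.ofReal (b ^ (-p)) * dirFunctional μ p γ g θ (b * lam) := by
  have hmeas : Measurable fun r : ℝ => ENNReal.ofReal (lam ^ p * r ^ (γ - 1)) *
      μ {x | a * lam * r ^ (γ / p) < |lineAvg f (r • θ) x|} := by
    refine (by fun_prop : Measurable fun r : ℝ =>
      ENNReal.ofReal (lam ^ p * r ^ (γ - 1))).mul ?_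
    refine measurable_measure_prodMk_left (s := {z : ℝ × E |
      a * lam * z.1 ^ (γ / p) < |lineAvg f (z.1 • θ) z.2|}) (measurableSet_lt (by fun_prop) ?_)
    exact ((measurable_lineAvg_uncurry hf).comp (by fun_prop :
      Measurable fun z : ℝ × E => (z.1 • θ, z.2))).abs
  rw [mul_dirFunctional_mul ha hlam, mul_dirFunctional_mul hb hlam, ← lintegral_add_left hmeas]
  refine lintegral_mono fun r => ?_
  rw [← mul_add]
  gcongr
  refine (measure_mono_ae ?_).trans (measure_union_le _ _)
  filter_upwards [ae_lineAvg_add hf hg hp hfp hgp (r • θ)] with x hx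
    (hlt : lam * r ^ (γ / p) < |lineAvg (fun x => f x + g x) (r • θ) x|)
  change a * lam * r ^ (γ / p) < |lineAvg f (r • θ) x| ∨
    b * lam * r ^ (γ / p) < |lineAvg g (r • θ) x|
  by_contra! hcon
  have hsum : lam * r ^ (γ / p) = a * lam * r ^ (γ / p) + b * lam * r ^ (γ / p) := by
    rw [← add_mul, ← add_mul, hab, one_mul]
  rw [hx, hsum] at hlt
  linarith [abs_add_le (lineAvg f (r • θ) x) (lineAvg g (r • θ) x)]

end Density

section DensityOne

variable {E : Type*} [NormedAddCommGroup E] [NormedSpace ℝ E] [MeasurableSpace E] [BorelSpace E]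
  [ProperSpace E] {μ : Measure E} [μ.IsAddHaarMeasure] {γ : ℝ} {f : E → ℝ} {l : Filter ℝ}
  [l.NeBot] [l.IsCountablyGenerated]

theorem limsup_dirFunctional_one_le (hl : IsLevelFilter 1 γ l) (hγ : 0 < γ ∨ γ < -1)
    (hf : Measurable f) (hf1 : ∫⁻ x, ‖f x‖ₑ ∂μ ≠ ⊤) {θ : E} (hθ : ‖θ‖ = 1) {K : ℝ≥0}
    (hK : ∀ f : E → ℝ, Measurable f → ∀ θ : E, ∀ lam : ℝ, 0 < lam →
      dirFunctional μ 1 γ f θ lam ≤ K * ∫⁻ x, ‖f x‖ₑ ∂μ) {δ : ℝ} (hδ : δ ∈ Set.Ioo 0 1) :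
    limsup (dirFunctional μ 1 γ f θ) l ≤ ENNReal.ofReal ((1 - δ)⁻¹) *
      (ENNReal.ofReal (1 / |γ|) * ((∫⁻ x, ‖f x‖ₑ ∂μ) + ENNReal.ofReal (δ ^ 2))) +
      K * ENNReal.ofReal δ := by
  have hδ1 : 0 < 1 - δ := sub_pos.2 hδ.2
  obtain ⟨k, hk, hkc, hk1, hfk⟩ := exists_continuous_lintegral_sub_le (μ := μ) hf one_pos
    (by simpa using hf1) (η := ENNReal.ofReal (δ ^ 2)) (by simpa using hδ.1.ne')
  simp only [ENNReal.rpow_one] at hfk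
  have hfk1 : ∫⁻ x, ‖f x - k x‖ₑ ^ (1 : ℝ) ∂μ ≠ ⊤ := by
    simpa using ne_top_of_le_ne_top ENNReal.ofReal_ne_top hfk
  have hk_le : ∫⁻ x, ‖k x‖ₑ ∂μ ≤ (∫⁻ x, ‖f x‖ₑ ∂μ) + ENNReal.ofReal (δ ^ 2) := by
    refine le_trans ?_ (add_le_add_right hfk _)
    rw [← lintegral_add_left (by fun_prop)]
    exact lintegral_mono fun x => by simpa using enorm_sub_le (a := f x) (b := f x - k x)
  have hsplit (lam : ℝ) (hlam : 0 < lam) : dirFunctional μ 1 γ f θ lam ≤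
      ENNReal.ofReal ((1 - δ)⁻¹) * dirFunctional μ 1 γ k θ ((1 - δ) * lam) +
        K * ENNReal.ofReal δ := by
    have hadd := dirFunctional_add_le (γ := γ) hk.measurable (hf.sub hk.measurable) le_rfl hk1
      hfk1 θ hδ1 hδ.1 (sub_add_cancel 1 δ) hlam
    simp only [Pi.sub_apply, add_sub_cancel, Real.rpow_neg_one] at hadd
    refine hadd.trans (add_le_add_right ?_ _)
    calc _ ≤ ENNReal.ofReal δ⁻¹ * (K * ENNReal.ofReal (δ ^ 2)) := by
          gcongr
          exact (hK _ (hf.sub hk.measurable) θ _ (mul_pos hδ.1 hlam)).trans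
            (mul_le_mul_right hfk _)
      _ = K * ENNReal.ofReal δ := by
          rw [mul_left_comm, ← ENNReal.ofReal_mul (inv_nonneg.2 hδ.1.le), sq,
            inv_mul_cancel_left₀ hδ.1.ne']
  have hlim := (ENNReal.Tendsto.const_mul ((tendsto_dirFunctional_one_of_continuous (μ := μ) hk
    hkc hγ hθ hl).comp (hl.tendsto_const_mul _ hδ1))
    (Or.inr (ENNReal.ofReal_ne_top (r := (1 - δ)⁻¹)))).add_const (K * ENNReal.ofReal δ)
  calc _ ≤ _ := limsup_le_limsup (hl.pos.mono hsplit) (by isBoundedDefault) (by isBoundedDefault)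
    _ = _ := hlim.limsup_eq
    _ ≤ _ := by gcongr

theorem tendsto_dirFunctional_one (hl : IsLevelFilter 1 γ l) (hγ : 0 < γ ∨ γ < -1)
    (hf : Measurable f) (hf1 : ∫⁻ x, ‖f x‖ₑ ∂μ ≠ ⊤) {θ : E} (hθ : ‖θ‖ = 1) :
    Tendsto (dirFunctional μ 1 γ f θ) l (𝓝 (ENNReal.ofReal (1 / |γ|) * ∫⁻ x, ‖f x‖ₑ ∂μ)) := by
  have hγ0 : γ ≠ 0 := by rcases hγ with h | h <;> linarith
  obtain ⟨K, hK⟩ := exists_dirFunctional_one_le μ hγ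
  have hlow := le_liminf_dirFunctional (μ := μ) hl hf le_rfl hγ0 (by simpa using hf1) θ
  simp only [ENNReal.rpow_one] at hlow
  refine tendsto_of_le_liminf_of_limsup_le hlow ?_
  set c : ℝ≥0∞ := ENNReal.ofReal (1 / |γ|)
  set I : ℝ≥0∞ := ∫⁻ x, ‖f x‖ₑ ∂μ
  have hlim : Tendsto (fun δ : ℝ => ENNReal.ofReal ((1 - δ)⁻¹) *
      (c * (I + ENNReal.ofReal (δ ^ 2))) + K * ENNReal.ofReal δ) (𝓝[>] 0) (𝓝 (c * I)) := by
    have hinv : ContinuousAt (fun δ : ℝ => (1 - δ)⁻¹) 0 :=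
      ContinuousAt.inv₀ (by fun_prop) (by norm_num)
    have hsq : ContinuousAt (fun δ : ℝ => δ ^ 2) 0 := by fun_prop
    have hinv' := ENNReal.tendsto_ofReal hinv.tendsto
    have hsq' := ENNReal.tendsto_ofReal hsq.tendsto
    have hid := ENNReal.tendsto_ofReal (tendsto_id (x := 𝓝 (0 : ℝ)))
    have hfirst := ENNReal.Tendsto.mul hinv' (Or.inl (by norm_num))
      (ENNReal.Tendsto.const_mul (a := c) (hsq'.const_add I) (Or.inr ENNReal.ofReal_ne_top))
      (Or.inr ENNReal.ofReal_ne_top)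
    have hsum := hfirst.add (ENNReal.Tendsto.const_mul (a := (K : ℝ≥0∞)) hid
      (Or.inr ENNReal.coe_ne_top))
    convert hsum.mono_left nhdsWithin_le_nhds using 2 <;> simp
  refine ge_of_tendsto hlim ?_
  filter_upwards [Ioo_mem_nhdsGT one_pos] with δ hδ
  exact limsup_dirFunctional_one_le hl hγ hf hf1 hθ hK hδ

end DensityOne

/-! ### Limits of the level functional -/

section DirectionalLimit

variable {E : Type*} [NormedAddCommGroup E] [NormedSpace ℝ E] [MeasurableSpace E] [BorelSpace E]
  [ProperSpace E] {p γ : ℝ}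

theorem exists_dirFunctional_le (μ : Measure E) [μ.IsAddHaarMeasure] (hγ : γ ≠ 0)
    (h : 1 < p ∨ p = 1 ∧ (0 < γ ∨ γ < -1)) :
    ∃ K : ℝ≥0, ∀ f : E → ℝ, Measurable f → ∀ θ : E, ∀ lam : ℝ, 0 < lam →
      dirFunctional μ p γ f θ lam ≤ K * ∫⁻ x, ‖f x‖ₑ ^ p ∂μ := by
  rcases h with hp | ⟨rfl, hγ'⟩
  · exact ⟨_, fun f hf θ lam hlam => dirFunctional_le_of_one_lt hp hγ hlam hf θ⟩
  · simpa only [ENNReal.rpow_one] using exists_dirFunctional_one_le μ hγ'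

theorem tendsto_dirFunctional {μ : Measure E} [μ.IsAddHaarMeasure] {l : Filter ℝ} [l.NeBot]
    [l.IsCountablyGenerated] (hl : IsLevelFilter p γ l) (hγ : γ ≠ 0)
    (h : 1 < p ∨ p = 1 ∧ (0 < γ ∨ γ < -1)) {f : E → ℝ} (hf : Measurable f)
    (hfp : ∫⁻ x, ‖f x‖ₑ ^ p ∂μ ≠ ⊤) {θ : E} (hθ : ‖θ‖ = 1) :
    Tendsto (dirFunctional μ p γ f θ) l
      (𝓝 (ENNReal.ofReal (1 / |γ|) * ∫⁻ x, ‖f x‖ₑ ^ p ∂μ)) := by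
  rcases h with hp | ⟨rfl, hγ'⟩
  · exact tendsto_dirFunctional_of_one_lt hf hp hγ hfp hl θ
  · simp only [ENNReal.rpow_one] at hfp ⊢
    exact tendsto_dirFunctional_one hl hγ' hf hfp hθ

end DirectionalLimit

section LevelFunctional

variable {N : ℕ} {p γ lam : ℝ} {u : Euc N → ℝ} {g : Euc N → Euc N}

theorem lintegral_lt_abs_sub_eq_dirFunctional (hg : HasWeakGradient u g) (hgm : Measurable g)
    (hp : 1 ≤ p) (hgp : ∫⁻ x, ‖g x‖ₑ ^ p ≠ ⊤) (γ lam : ℝ) (θ : Euc N) :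
    ∫⁻ r in Set.Ioi (0 : ℝ), ENNReal.ofReal (lam ^ p * r ^ (γ - 1)) *
        volume {x | lam * r ^ (1 + γ / p) < |u (x + r • θ) - u x|} =
      dirFunctional volume p γ (fun y => inner ℝ (g y) θ) θ lam := by
  refine setLIntegral_congr_fun measurableSet_Ioi fun r (hr : 0 < r) => ?_
  congr 1
  refine measure_congr ?_
  filter_upwards [hg.ae_sub_eq hgm hp hgp (r • θ)] with x hx
  change (_ < _) = (_ < _)
  simp only [hx, real_inner_smul_right]
  rw [lineAvg_const_mul, abs_mul, abs_of_pos hr, Real.rpow_add hr, Real.rpow_one, mul_left_comm,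
    mul_lt_mul_iff_right₀ hr]

theorem levelFunctional_eq_lintegral_dirFunctional [NeZero N] (hg : HasWeakGradient u g)
    (hu : Measurable u) (hgm : Measurable g) (hp : 1 ≤ p) (hgp : ∫⁻ x, ‖g x‖ₑ ^ p ≠ ⊤) (γ : ℝ)
    (hlam : 0 ≤ lam) :
    levelFunctional p γ u lam = ∫⁻ θ : Metric.sphere (0 : Euc N) 1,
      dirFunctional volume p γ (fun y => inner ℝ (g y) (θ : Euc N)) θ lam ∂volume.toSphere := by
  rw [levelFunctional_eq_lintegral_sphere hu p γ hlam]
  exact lintegral_congr fun θ => lintegral_lt_abs_sub_eq_dirFunctional hg hgm hp hgp γ lam θ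

theorem measurable_dirFunctional_inner (hg : HasWeakGradient u g) (hu : Measurable u)
    (hgm : Measurable g) (hp : 1 ≤ p) (hgp : ∫⁻ x, ‖g x‖ₑ ^ p ≠ ⊤) (γ lam : ℝ) :
    Measurable fun θ : Euc N => dirFunctional volume p γ (fun y => inner ℝ (g y) θ) θ lam := by
  simp_rw [← lintegral_lt_abs_sub_eq_dirFunctional hg hgm hp hgp γ lam]
  refine Measurable.lintegral_prod_right' (f := fun z : Euc N × ℝ =>
    ENNReal.ofReal (lam ^ p * z.2 ^ (γ - 1)) *
      volume {x | lam * z.2 ^ (1 + γ / p) < |u (x + z.2 • z.1) - u x|}) ?_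
  refine (by fun_prop : Measurable fun z : Euc N × ℝ =>
    ENNReal.ofReal (lam ^ p * z.2 ^ (γ - 1))).mul ?_
  exact measurable_measure_prodMk_left (s := {z : (Euc N × ℝ) × Euc N |
    lam * z.1.2 ^ (1 + γ / p) < |u (z.2 + z.1.2 • z.1.1) - u z.2|})
    (measurableSet_lt (by fun_prop) (by fun_prop))

theorem MemHomSobolev.exists_measurable (hp : 1 ≤ p) (hu : MemHomSobolev (ENNReal.ofReal p) u) :
    ∃ (v : Euc N → ℝ) (g : Euc N → Euc N), Measurable v ∧ Measurable g ∧ u =ᵐ[volume] v ∧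
      HasWeakGradient v g ∧ ∫⁻ x, ‖g x‖ₑ ^ p ≠ ⊤ ∧
      gradNorm (ENNReal.ofReal p) u ^ p = ∫⁻ x, ‖g x‖ₑ ^ p := by
  have hp0 : 0 < p := by linarith
  obtain ⟨g, hg, -⟩ := id hu
  have hum := hg.1.aestronglyMeasurable
  have hgm := hg.2.aestronglyMeasurable
  have henergy : gradNorm (ENNReal.ofReal p) u ^ p = ∫⁻ x, ‖hgm.mk g x‖ₑ ^ p := by
    rw [(hg.congr (ae_eq_refl u) hgm.ae_eq_mk).gradNorm_eq,
      eLpNorm_eq_lintegral_rpow_enorm_toReal (by simpa using hp0) (by simp),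
      ENNReal.toReal_ofReal hp0.le, ← ENNReal.rpow_mul, one_div_mul_cancel hp0.ne',
      ENNReal.rpow_one]
  refine ⟨hum.mk u, hgm.mk g, hum.stronglyMeasurable_mk.measurable,
    hgm.stronglyMeasurable_mk.measurable, hum.ae_eq_mk, hg.congr hum.ae_eq_mk hgm.ae_eq_mk,
    ?_, henergy⟩
  rw [← henergy]
  exact ENNReal.rpow_ne_top_of_nonneg hp0.le hu.gradNorm_ne_top

theorem lintegral_inner_rpow_le_of_norm_eq_one (g : Euc N → Euc N) (hp : 0 ≤ p) {θ : Euc N}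
    (hθ : ‖θ‖ = 1) : ∫⁻ x, ‖(inner ℝ (g x) θ : ℝ)‖ₑ ^ p ≤ ∫⁻ x, ‖g x‖ₑ ^ p := by
  simpa [← ofReal_norm, hθ] using lintegral_inner_rpow_le (μ := volume) g hp θ

variable [NeZero N] {e : Euc N} {l : Filter ℝ} [l.IsCountablyGenerated]

theorem tendsto_levelFunctional_of_dirFunctional (hl : IsLevelFilter p γ l)
    (hg : HasWeakGradient u g) (hu : Measurable u) (hgm : Measurable g) (hp : 1 ≤ p)
    (hgp : ∫⁻ x, ‖g x‖ₑ ^ p ≠ ⊤) (he : ‖e‖ = 1) {C : ℝ≥0∞} (hC : C ≠ ⊤)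
    (hbound : ∀ᶠ lam in l, ∀ θ : Euc N, ‖θ‖ = 1 →
      dirFunctional volume p γ (fun y => inner ℝ (g y) θ) θ lam ≤ C)
    (hlim : ∀ θ : Euc N, ‖θ‖ = 1 →
      Tendsto (dirFunctional volume p γ (fun y => inner ℝ (g y) θ) θ) l
        (𝓝 (ENNReal.ofReal (1 / |γ|) * ∫⁻ x, ‖(inner ℝ (g x) θ : ℝ)‖ₑ ^ p))) :
    Tendsto (levelFunctional p γ u) l
      (𝓝 (ENNReal.ofReal (kappa p e / |γ|) * ∫⁻ x, ‖g x‖ₑ ^ p)) := by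
  have heq : levelFunctional p γ u =ᶠ[l] _ := hl.pos.mono fun lam hlam =>
    levelFunctional_eq_lintegral_dirFunctional hg hu hgm hp hgp γ hlam.le
  rw [tendsto_congr' heq, ← lintegral_sphere_directional_energy (by linarith) γ he hgm]
  refine tendsto_lintegral_filter_of_dominated_convergence (fun _ => C)
    (Eventually.of_forall fun lam => (measurable_dirFunctional_inner hg hu hgm hp hgp γ
      lam).comp measurable_subtype_coe) ?_ ?_ ?_
  · filter_upwards [hbound] with lam hlam
    exact ae_of_all _ fun θ => hlam θ (norm_eq_of_mem_sphere θ)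
  · rw [lintegral_const]
    exact ENNReal.mul_ne_top hC (measure_ne_top _ _)
  · exact ae_of_all _ fun θ => hlim θ (norm_eq_of_mem_sphere θ)

theorem tendsto_levelFunctional [l.NeBot] (hl : IsLevelFilter p γ l) (hγ : γ ≠ 0)
    (h : 1 < p ∨ p = 1 ∧ (0 < γ ∨ γ < -1)) (he : ‖e‖ = 1)
    (hu : MemHomSobolev (ENNReal.ofReal p) u) :
    Tendsto (levelFunctional p γ u) l
      (𝓝 (ENNReal.ofReal (kappa p e / |γ|) * gradNorm (ENNReal.ofReal p) u ^ p)) := by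
  have hp : 1 ≤ p := by rcases h with h | h <;> linarith
  have hp0 : 0 ≤ p := by linarith
  obtain ⟨v, g, hv, hgm, huv, hg, hgp, hnorm⟩ := hu.exists_measurable hp
  obtain ⟨K, hK⟩ := exists_dirFunctional_le (E := Euc N) volume hγ h
  have hfm (θ : Euc N) : Measurable fun y => (inner ℝ (g y) θ : ℝ) := by fun_prop
  rw [levelFunctional_congr huv, hnorm]
  refine tendsto_levelFunctional_of_dirFunctional hl hg hv hgm hp hgp he
    (ENNReal.mul_ne_top (ENNReal.coe_ne_top (r := K)) hgp) ?_ fun θ hθ => ?_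
  · filter_upwards [hl.pos] with lam hlam θ hθ
    exact (hK _ (hfm θ) θ lam hlam).trans
      (mul_le_mul_right (lintegral_inner_rpow_le_of_norm_eq_one g hp0 hθ) _)
  · exact tendsto_dirFunctional hl hγ h (hfm θ)
      (ne_top_of_le_ne_top hgp (lintegral_inner_rpow_le_of_norm_eq_one g hp0 hθ)) hθ

theorem le_liminf_levelFunctional [l.NeBot] (hl : IsLevelFilter p γ l) (hp : 1 ≤ p) (hγ : γ ≠ 0)
    (he : ‖e‖ = 1) (hu : MemHomSobolev (ENNReal.ofReal p) u) :
    ENNReal.ofReal (kappa p e / |γ|) * gradNorm (ENNReal.ofReal p) u ^ p ≤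
      liminf (levelFunctional p γ u) l := by
  have hp0 : 0 ≤ p := by linarith
  obtain ⟨v, g, hv, hgm, huv, hg, hgp, hnorm⟩ := hu.exists_measurable hp
  have heq : levelFunctional p γ v =ᶠ[l] _ := hl.pos.mono fun lam hlam =>
    levelFunctional_eq_lintegral_dirFunctional hg hv hgm hp hgp γ hlam.le
  rw [levelFunctional_congr huv, hnorm, liminf_congr heq,
    ← lintegral_sphere_directional_energy hp0 γ he hgm]
  refine le_trans (lintegral_mono fun θ => ?_) (lintegral_liminf_le fun lam =>
    (measurable_dirFunctional_inner hg hv hgm hp hgp γ lam).comp measurable_subtype_coe)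
  exact le_liminf_dirFunctional hl (by fun_prop) hp hγ (ne_top_of_le_ne_top hgp
    (lintegral_inner_rpow_le_of_norm_eq_one g hp0 (norm_eq_of_mem_sphere θ))) θ

end LevelFunctional

section Smooth

variable {N : ℕ} {u : Euc N → ℝ}

theorem meas_lineAvg_gradient_ne_zero_le (hu : ContDiff ℝ 1 u) (θ : Euc N) {r : ℝ}
    (hr : r ≠ 0) :
    volume {x | lineAvg (fun y => inner ℝ (gradient u y) θ) (r • θ) x ≠ 0} ≤
      2 * volume (tsupport u) := by
  have hsub : {x | lineAvg (fun y => inner ℝ (gradient u y) θ) (r • θ) x ≠ 0} ⊆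
      (fun x => x + r • θ) ⁻¹' tsupport u ∪ tsupport u := by
    intro x hx
    by_contra! hcon
    rw [Set.mem_union, not_or] at hcon
    have hsub := sub_eq_lineAvg_gradient hu (r • θ) x
    simp only [real_inner_smul_right] at hsub
    rw [lineAvg_const_mul, image_eq_zero_of_notMem_tsupport hcon.1,
      image_eq_zero_of_notMem_tsupport hcon.2, sub_self] at hsub
    exact hx ((mul_eq_zero.1 hsub.symm).resolve_left hr)
  refine (measure_mono hsub).trans ((measure_union_le _ _).trans_eq ?_)
  rw [measure_preimage_add_right, two_mul]

theorem tendsto_levelFunctional_of_contDiff [NeZero N] {γ : ℝ} (hγ : γ ≠ 0) {e : Euc N}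
    (he : ‖e‖ = 1) {l : Filter ℝ} [l.IsCountablyGenerated] (hl : IsLevelFilter 1 γ l)
    (hu : ContDiff ℝ 1 u) (hc : HasCompactSupport u) :
    Tendsto (levelFunctional 1 γ u) l
      (𝓝 (ENNReal.ofReal (kappa 1 e / |γ|) * gradNorm 1 u)) := by
  have hgc := continuous_gradient_of_contDiff_one hu
  have hgs : HasCompactSupport (gradient u) := hasCompactSupport_gradient hc
  have hgp : ∫⁻ x, ‖gradient u x‖ₑ ^ (1 : ℝ) ≠ ⊤ := by
    simpa using (hgc.integrable_of_hasCompactSupport hgs).2.ne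
  have hnorm : gradNorm 1 u = ∫⁻ x, ‖gradient u x‖ₑ ^ (1 : ℝ) := by
    simp [(hasWeakGradient_gradient hu).gradNorm_eq, eLpNorm_one_eq_lintegral_enorm]
  obtain ⟨M, hM⟩ := hgc.bounded_above_of_compact_support hgs
  set B : ℝ → ℝ≥0∞ := (Set.Iic M).indicator fun _ => 2 * volume (tsupport u)
  have hBint : ∫⁻ t in Set.Ioi (0 : ℝ),
      ENNReal.ofReal (1 / |γ| * t ^ ((1 : ℝ) - 1)) * B t ≠ ⊤ := by
    simp only [B, sub_self, Real.rpow_zero, mul_one]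
    rw [setLIntegral_Ioi_mul_indicator_Iic fun _ => ENNReal.ofReal (1 / |γ|), setLIntegral_const]
    exact ENNReal.mul_ne_top (ENNReal.mul_ne_top ENNReal.ofReal_ne_top
      (ENNReal.mul_ne_top ENNReal.ofNat_ne_top hc.isCompact.measure_lt_top.ne))
      measure_Ioc_lt_top.ne
  have hB {θ : Euc N} (hθ : ‖θ‖ = 1) {lam : ℝ} (hlam : 0 < lam) (t : ℝ) (ht : 0 < t) :
      volume {x | t < |lineAvg (fun y => inner ℝ (gradient u y) θ)
        (levelRadius 1 γ lam t • θ) x|} ≤ B t := by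
    refine Set.le_indicator_apply (fun _ => ?_) fun htM => ?_
    · exact (measure_mono fun x (hx : t < _) => abs_pos.1 (ht.trans hx)).trans
        (meas_lineAvg_gradient_ne_zero_le hu θ (levelRadius_pos hlam ht).ne')
    · refine (measure_mono_null (fun x (hx : t < _) => htM (hx.le.trans ?_)) measure_empty).le
      exact abs_lineAvg_le (fun y => (abs_real_inner_le_norm _ _).trans
        (by simpa [hθ] using hM y)) _ x
  rw [hnorm]
  refine tendsto_levelFunctional_of_dirFunctional hl (hasWeakGradient_gradient hu)
    hu.continuous.measurable hgc.measurable le_rfl hgp he hBint ?_ fun θ hθ => ?_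
  · filter_upwards [hl.pos] with lam hlam θ hθ
    rw [dirFunctional_eq one_pos hγ hlam]
    exact setLIntegral_mono' measurableSet_Ioi fun t ht => mul_le_mul_right (hB hθ hlam t ht) _
  · exact tendsto_dirFunctional_of_dominated hl (by fun_prop) le_rfl hγ (ne_top_of_le_ne_top hgp
      (lintegral_inner_rpow_le_of_norm_eq_one _ zero_le_one hθ)) θ
      (hl.pos.mono fun lam hlam => hB hθ hlam) hBint

end Smooth

/-! ### Semicontinuity and Baire category -/

section Semicontinuity

variable {N : ℕ} {q : ℝ≥0∞} {u v : Euc N → ℝ}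

theorem translate_sub_ae_eq (huv : u =ᵐ[volume] v) (h : Euc N) :
    (fun x => u (x + h) - u x) =ᵐ[volume] fun x => v (x + h) - v x :=
  ((measurePreserving_add_right volume h).quasiMeasurePreserving.ae_eq_comp huv).sub huv

theorem levelFunctional_le_liminf {U : ℕ → Euc N → ℝ} (hU : ∀ n, AEMeasurable (U n))
    (hu : AEMeasurable u)
    (hUu : ∀ h : Euc N, TendstoInMeasure volume (fun n x => U n (x + h) - U n x) atTop
      fun x => u (x + h) - u x) (p γ : ℝ) {lam : ℝ} (hlam : 0 ≤ lam) :
    levelFunctional p γ u lam ≤ liminf (fun n => levelFunctional p γ (U n) lam) atTop := by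
  choose V hV hUV using hU
  obtain ⟨v, hv, huv⟩ := hu
  simp only [levelFunctional_congr (hUV _), levelFunctional_congr huv,
    levelFunctional_eq_lintegral (hV _) p γ hlam, levelFunctional_eq_lintegral hv p γ hlam]
  rw [ENNReal.liminf_const_mul_of_ne_top ENNReal.ofReal_ne_top]
  gcongr
  refine (lintegral_mono fun h => ?_).trans
    (lintegral_liminf_le fun n => measurable_volume_translate_gt (hV n) γ (1 + γ / p) lam)
  rw [ENNReal.liminf_const_mul_of_ne_top ENNReal.ofReal_ne_top]
  gcongr
  exact meas_lt_abs_le_liminf ((hUu h).congr (fun n => translate_sub_ae_eq (hUV n) h)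
    (translate_sub_ae_eq huv h)) _

theorem MemHomSobolev.aemeasurable (hu : MemHomSobolev q u) : AEMeasurable u := by
  obtain ⟨g, hg, -⟩ := hu
  exact hg.locallyIntegrable.aestronglyMeasurable.aemeasurable

theorem MemHomSobolev.lintegral_translate_sub_rpow_le {p : ℝ} (hp : 1 ≤ p)
    (hu : MemHomSobolev (ENNReal.ofReal p) u) (h : Euc N) :
    ∫⁻ x, ‖u (x + h) - u x‖ₑ ^ p ≤ (gradNorm (ENNReal.ofReal p) u * ‖h‖ₑ) ^ p := by
  have hp0 : 0 ≤ p := zero_le_one.trans hp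
  obtain ⟨v, g, -, hgm, huv, hg, hgp, hnorm⟩ := hu.exists_measurable hp
  calc ∫⁻ x, ‖u (x + h) - u x‖ₑ ^ p
      = ∫⁻ x, ‖lineAvg (fun y => inner ℝ (g y) h) h x‖ₑ ^ p := by
        refine lintegral_congr_ae ?_
        filter_upwards [translate_sub_ae_eq huv h, hg.ae_sub_eq hgm hp hgp h] with x hx hx'
        rw [hx, hx']
    _ ≤ ∫⁻ x, ‖(inner ℝ (g x) h : ℝ)‖ₑ ^ p := lintegral_lineAvg_rpow_le (by fun_prop) hp h
    _ ≤ (∫⁻ x, ‖g x‖ₑ ^ p) * ‖h‖ₑ ^ p := lintegral_inner_rpow_le g hp0 h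
    _ = (gradNorm (ENNReal.ofReal p) u * ‖h‖ₑ) ^ p := by
        rw [ENNReal.mul_rpow_of_nonneg _ _ hp0, hnorm]

theorem MemHomSobolev.eLpNorm_translate_sub_le (hq : 1 ≤ q) (hq' : q ≠ ⊤) (hu : MemHomSobolev q u)
    (h : Euc N) : eLpNorm (fun x => u (x + h) - u x) q ≤ gradNorm q u * ‖h‖ₑ := by
  have hp : 1 ≤ q.toReal := by simpa using ENNReal.toReal_mono hq' hq
  have hle := (ENNReal.ofReal_toReal hq' ▸ hu).lintegral_translate_sub_rpow_le hp h
  rw [ENNReal.ofReal_toReal hq'] at hle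
  rw [eLpNorm_eq_lintegral_rpow_enorm_toReal (zero_lt_one.trans_le hq).ne' hq', one_div]
  exact (ENNReal.rpow_inv_le_iff (zero_lt_one.trans_le hp)).2 hle

theorem tendstoInMeasure_translate_sub {ι : Type*} {l : Filter ι} {U : ι → Euc N → ℝ} (hq : 1 ≤ q)
    (hq' : q ≠ ⊤) (hU : ∀ i, MemHomSobolev q (U i)) (hu : MemHomSobolev q u)
    (hUu : Tendsto (fun i => gradNorm q (U i - u)) l (𝓝 0)) (h : Euc N) :
    TendstoInMeasure volume (fun i x => U i (x + h) - U i x) l fun x => u (x + h) - u x := by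
  have hmeas {v : Euc N → ℝ} (hv : MemHomSobolev q v) :
      AEStronglyMeasurable (fun x => v (x + h) - v x) volume :=
    ((hv.aemeasurable.comp_quasiMeasurePreserving
      (measurePreserving_add_right volume h).quasiMeasurePreserving).sub
        hv.aemeasurable).aestronglyMeasurable
  refine tendstoInMeasure_of_tendsto_eLpNorm (zero_lt_one.trans_le hq).ne'
    (fun i => hmeas (hU i)) (hmeas hu) ?_
  have hbound := ENNReal.Tendsto.mul_const (b := ‖h‖ₑ) hUu (Or.inr enorm_ne_top)
  rw [zero_mul] at hbound
  refine tendsto_of_tendsto_of_tendsto_of_le_of_le tendsto_const_nhds hbound (fun _ => zero_le)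
    fun i => ?_
  have hdiff : MemHomSobolev q (U i - u) := (homSobolevSubmodule N q).sub_mem (hU i) hu
  refine (eLpNorm_congr_ae (ae_of_all _ ?_)).trans_le (hdiff.eLpNorm_translate_sub_le hq hq' h)
  exact fun x => sub_sub_sub_comm (U i (x + h)) (U i x) (u (x + h)) (u x)

theorem HomSobolev.enorm_eq_gradNorm [Fact (1 ≤ q)] (u : HomSobolev N q) :
    ‖u‖ₑ = gradNorm q u.toFun := by
  rw [← ofReal_norm]
  exact ENNReal.ofReal_toReal u.mem.gradNorm_ne_top

theorem isClosed_levelFunctional_le [hq : Fact (1 ≤ q)] (hq' : q ≠ ⊤) (p γ : ℝ) {lam : ℝ}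
    (hlam : 0 ≤ lam) (c : ℝ≥0∞) :
    IsClosed {u : HomSobolev N q | levelFunctional p γ u.toFun lam ≤ c} := by
  refine IsSeqClosed.isClosed fun U u hU hlim => ?_
  have hnorm : Tendsto (fun n => gradNorm q ((U n).toFun - u.toFun)) atTop (𝓝 0) := by
    have h := (tendsto_iff_norm_sub_tendsto_zero.1 hlim).enorm
    simp only [enorm_norm, HomSobolev.enorm_eq_gradNorm, enorm_zero] at h
    exact h
  calc levelFunctional p γ u.toFun lam
      ≤ liminf (fun n => levelFunctional p γ (U n).toFun lam) atTop :=
        levelFunctional_le_liminf (fun n => (U n).mem.aemeasurable) u.mem.aemeasurable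
          (tendstoInMeasure_translate_sub hq.out hq' (fun n => (U n).mem) u.mem hnorm) p γ hlam
    _ ≤ c := liminf_le_of_le (by isBoundedDefault) fun b hb =>
        let ⟨n, hn⟩ := hb.exists
        hn.trans (hU n)

end Semicontinuity

section Scaling

variable {N : ℕ} {p : ℝ} {lam : ℝ}

theorem levelFunctional_const_smul (p γ : ℝ) (u : Euc N → ℝ) {c : ℝ} (hc : 0 < c)
    (hlam : 0 ≤ lam) :
    levelFunctional p γ (c • u) (c * lam) = ENNReal.ofReal (c ^ p) * levelFunctional p γ u lam := by
  have hquot (z : Euc N × Euc N) :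
      diffQuot (γ / p) (c • u) z.1 z.2 = c * diffQuot (γ / p) u z.1 z.2 := by
    simp only [diffQuot, Pi.smul_apply, smul_eq_mul]
    ring
  have hsuper : superlevel (c * lam) (γ / p) (c • u) = superlevel lam (γ / p) u := by
    ext z
    simp only [superlevel, Set.mem_ofPred_eq, hquot, abs_mul, abs_of_pos hc,
      mul_lt_mul_iff_right₀ hc]
  rw [levelFunctional, levelFunctional, hsuper, Real.mul_rpow hc.le hlam,
    ENNReal.ofReal_mul (Real.rpow_nonneg hc.le p), mul_assoc]

theorem levelFunctional_sub_two_mul_le (p γ : ℝ) (u v : Euc N → ℝ) (hlam : 0 ≤ lam) :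
    levelFunctional p γ (u - v) (2 * lam) ≤
      ENNReal.ofReal (2 ^ p) * (levelFunctional p γ u lam + levelFunctional p γ v lam) := by
  have hsub : superlevel (2 * lam) (γ / p) (u - v) ⊆
      superlevel lam (γ / p) u ∪ superlevel lam (γ / p) v := by
    rintro z ⟨hz, hlt⟩
    have hquot : diffQuot (γ / p) (u - v) z.1 z.2 =
        diffQuot (γ / p) u z.1 z.2 - diffQuot (γ / p) v z.1 z.2 := by
      simp only [diffQuot, Pi.sub_apply]
      ring
    rw [hquot] at hlt
    have htri := abs_sub (diffQuot (γ / p) u z.1 z.2) (diffQuot (γ / p) v z.1 z.2)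
    by_cases hu : lam < |diffQuot (γ / p) u z.1 z.2|
    · exact Or.inl ⟨hz, hu⟩
    · exact Or.inr ⟨hz, by linarith⟩
  rw [levelFunctional, levelFunctional, levelFunctional, Real.mul_rpow zero_le_two hlam,
    ENNReal.ofReal_mul (Real.rpow_nonneg zero_le_two p), mul_assoc, ← mul_add]
  gcongr
  exact (measure_mono hsub).trans (measure_union_le _ _)

end Scaling

section Baire

variable {N : ℕ} {q : ℝ≥0∞} {p γ : ℝ} {K : ℝ≥0}

theorem MemHomSobolev.gradNorm_const_smul {u : Euc N → ℝ} (hu : MemHomSobolev q u) (c : ℝ) :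
    gradNorm q (c • u) = ‖c‖ₑ * gradNorm q u := by
  obtain ⟨g, hg, -⟩ := hu
  rw [(hg.const_smul c).gradNorm_eq, eLpNorm_const_smul, hg.gradNorm_eq]

theorem exists_mem_ball_lt_levelFunctional [Fact (1 ≤ q)]
    (hlarge : ∀ n : ℕ, ∀ δ : ℝ, 0 < δ → ∃ w : Euc N → ℝ, MemHomSobolev q w ∧ gradNorm q w ≤ K ∧
      ∃ lam ∈ Set.Ioo 0 δ, n ≤ levelFunctional p γ w lam)
    (u : HomSobolev N q) {ε δ : ℝ} (hε : 0 < ε) (hδ : 0 < δ) {M : ℝ≥0∞} (hM : M ≠ ⊤)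
    (huM : ∀ lam ∈ Set.Ioo 0 δ, levelFunctional p γ u.toFun lam ≤ M) :
    ∃ v ∈ Metric.ball u ε, ∃ lam ∈ Set.Ioo 0 δ, M < levelFunctional p γ v.toFun lam := by
  set c : ℝ := ε / (K + 1)
  have hc : 0 < c := by positivity
  obtain ⟨n, hn⟩ : ∃ n : ℕ, ENNReal.ofReal (2 ^ p) * (M + M) < n * ENNReal.ofReal (c ^ p) :=
    ENNReal.exists_nat_mul_gt (by simpa using Real.rpow_pos_of_pos hc p)
      (ENNReal.mul_ne_top ENNReal.ofReal_ne_top (ENNReal.add_ne_top.2 ⟨hM, hM⟩))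
  obtain ⟨w, hw, hwK, lam, ⟨hlam, hlamδ⟩, hnw⟩ := hlarge n (2 * δ / c) (by positivity)
  set w' : HomSobolev N q := (⟨w, hw⟩ : homSobolevSubmodule N q)
  set v : HomSobolev N q := u + c • w'
  have hvu : v.toFun - u.toFun = c • w := add_sub_cancel_left u.toFun (c • w)
  set μ : ℝ := c * lam / 2
  have hμ : μ ∈ Set.Ioo 0 δ := by
    refine ⟨by positivity, ?_⟩
    rw [lt_div_iff₀ hc] at hlamδ
    simp only [μ]
    linarith
  refine ⟨v, ?_, μ, hμ, ?_⟩
  · have hnorm : ‖v - u‖ = c * (gradNorm q w).toReal := by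
      change (gradNorm q (v.toFun - u.toFun)).toReal = _
      rw [hvu, hw.gradNorm_const_smul, ENNReal.toReal_mul, toReal_enorm, Real.norm_of_nonneg hc.le]
    have hwK' : (gradNorm q w).toReal < K + 1 :=
      lt_add_of_le_of_pos (ENNReal.toReal_mono ENNReal.coe_ne_top hwK) one_pos
    rw [mem_ball_iff_norm, hnorm]
    calc c * (gradNorm q w).toReal < c * (K + 1) := by gcongr
      _ = ε := div_mul_cancel₀ ε (by positivity)
  · by_contra! hvM
    refine hn.not_ge ?_
    calc n * ENNReal.ofReal (c ^ p)
        ≤ ENNReal.ofReal (c ^ p) * levelFunctional p γ w lam := by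
          rw [mul_comm]
          gcongr
      _ = levelFunctional p γ (v.toFun - u.toFun) (2 * μ) := by
          rw [hvu, mul_div_cancel₀ _ two_ne_zero, levelFunctional_const_smul p γ w hc hlam.le]
      _ ≤ ENNReal.ofReal (2 ^ p) * (M + M) := by
          refine (levelFunctional_sub_two_mul_le p γ v.toFun u.toFun hμ.1.le).trans ?_
          gcongr
          exact huM μ hμ

theorem isMeagre_limsup_levelFunctional_ne_top [Fact (1 ≤ q)] (hq : q ≠ ⊤)
    (hlarge : ∀ n : ℕ, ∀ δ : ℝ, 0 < δ → ∃ w : Euc N → ℝ, MemHomSobolev q w ∧ gradNorm q w ≤ K ∧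
      ∃ lam ∈ Set.Ioo 0 δ, n ≤ levelFunctional p γ w lam) :
    IsMeagre {u : HomSobolev N q | limsup (levelFunctional p γ u.toFun) (𝓝[>] 0) ≠ ⊤} := by
  set A : ℕ → ℕ → Set (HomSobolev N q) := fun m k =>
    {u | ∀ lam ∈ Set.Ioo (0 : ℝ) (1 / (k + 1)), levelFunctional p γ u.toFun lam ≤ m}
  have hA (m k : ℕ) : IsNowhereDense (A m k) := by
    have hclosed : IsClosed (A m k) := by
      simp only [A, Set.ofPred_forall]
      exact isClosed_biInter fun lam hlam => isClosed_levelFunctional_le hq p γ hlam.1.le m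
    rw [IsNowhereDense, hclosed.closure_eq]
    refine Set.eq_empty_of_forall_notMem fun u hu => ?_
    obtain ⟨ε, hε, hball⟩ := Metric.mem_nhds_iff.1 (mem_interior_iff_mem_nhds.1 hu)
    obtain ⟨v, hv, lam, hlam, hlt⟩ := exists_mem_ball_lt_levelFunctional hlarge u hε
      Nat.one_div_pos_of_nat (ENNReal.natCast_ne_top m) (interior_subset hu)
    exact hlt.not_ge (hball hv lam hlam)
  refine (isMeagre_iUnion fun m => isMeagre_iUnion fun k => (hA m k).isMeagre).mono
    fun u (hu : limsup _ _ ≠ ⊤) => ?_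
  obtain ⟨m, hm⟩ := ENNReal.exists_nat_gt hu
  obtain ⟨δ, hδ, hδm⟩ := mem_nhdsGT_iff_exists_Ioo_subset.1 (eventually_lt_of_limsup_lt hm)
  obtain ⟨k, hk⟩ := exists_nat_one_div_lt (show (0 : ℝ) < δ from hδ)
  exact Set.mem_iUnion₂.2 ⟨m, k, fun lam hlam => (hδm ⟨hlam.1, hlam.2.trans hk⟩).le⟩

end Baire

/-! ### Ramps with many jumps -/

section Scaling

theorem lintegral_comp_smul {E : Type*} [NormedAddCommGroup E] [NormedSpace ℝ E]
    [MeasurableSpace E] [BorelSpace E] [FiniteDimensional ℝ E] (μ : Measure E)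
    [μ.IsAddHaarMeasure] (f : E → ℝ≥0∞) {c : ℝ} (hc : c ≠ 0) :
    ∫⁻ x, f (c • x) ∂μ = ENNReal.ofReal |(c ^ Module.finrank ℝ E)⁻¹| * ∫⁻ x, f x ∂μ := by
  rw [← smul_eq_mul, ← lintegral_smul_measure, ← Measure.map_addHaar_smul μ hc]
  exact ((Homeomorph.smulOfNeZero c hc).measurableEmbedding.lintegral_map f).symm

theorem lintegral_Ioi_comp_div (f : ℝ → ℝ≥0∞) {ρ : ℝ} (hρ : 0 < ρ) :
    ∫⁻ r in Set.Ioi (0 : ℝ), f (r / ρ) = ENNReal.ofReal ρ * ∫⁻ r in Set.Ioi (0 : ℝ), f r := by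
  have h := lintegral_comp_smul volume ((Set.Ioi (0 : ℝ)).indicator f) (inv_pos.2 hρ).ne'
  simp only [Module.finrank_self, pow_one, inv_inv, abs_of_pos hρ,
    lintegral_indicator measurableSet_Ioi] at h
  rw [← h, ← lintegral_indicator measurableSet_Ioi]
  refine lintegral_congr fun r => ?_
  simp [Set.indicator_apply, div_eq_inv_mul, hρ]

theorem volume_setOf_sub_div_mem (S : Set ℝ) (c : ℝ) {ρ : ℝ} (hρ : 0 < ρ) :
    volume {x | (x - c) / ρ ∈ S} = ENNReal.ofReal ρ * volume S := by
  have h : {x | (x - c) / ρ ∈ S} = (fun x => x - c) ⁻¹' ((fun x => x * ρ⁻¹) ⁻¹' S) := by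
    ext x; simp [div_eq_mul_inv]
  rw [h, (measurePreserving_sub_right volume c).measure_preimage_emb
    (MeasurableEquiv.subRight c).measurableEmbedding,
    Real.volume_preimage_mul_right (inv_ne_zero hρ.ne'), inv_inv, abs_of_pos hρ]

end Scaling

section Ramps

variable {γ a θ r : ℝ} {W : ℝ → ℝ}

/-- A `C¹` monotone transition from `0` to `1` taking place in `[0, 1]`. -/
structure IsRamp (W : ℝ → ℝ) : Prop where
  contDiff : ContDiff ℝ 1 W
  mono : Monotone W
  eq_zero : ∀ x ≤ 0, W x = 0
  eq_one : ∀ x, 1 ≤ x → W x = 1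

theorem isRamp_smoothTransition : IsRamp Real.smoothTransition :=
  ⟨Real.smoothTransition.contDiff, Real.smoothTransition.monotone,
    fun _ => Real.smoothTransition.zero_of_nonpos, fun _ => Real.smoothTransition.one_of_one_le⟩

theorem IsRamp.comp_div (hW : IsRamp W) {ε : ℝ} (hε : 0 < ε) (hε1 : ε ≤ 1) :
    IsRamp fun x => W (x / ε) where
  contDiff := hW.contDiff.comp (contDiff_id.div_const ε)
  mono x y h := hW.mono (by gcongr)
  eq_zero x hx := hW.eq_zero _ (div_nonpos_of_nonpos_of_nonneg hx hε.le)
  eq_one x hx := hW.eq_one _ ((one_le_div hε).2 (hε1.trans hx))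

theorem IsRamp.nonneg (hW : IsRamp W) (x : ℝ) : 0 ≤ W x := by
  rcases le_total x 0 with h | h
  · exact (hW.eq_zero x h).ge
  · exact (hW.eq_zero 0 le_rfl).ge.trans (hW.mono h)

theorem IsRamp.le_one (hW : IsRamp W) (x : ℝ) : W x ≤ 1 := by
  rcases le_total 1 x with h | h
  · exact (hW.eq_one x h).le
  · exact (hW.mono h).trans (hW.eq_one 1 le_rfl).le

/-- The points of `(-a, 1 + a - r)` at which the increment of `W` over a step `r` exceeds
`θ r^(1 + γ)`. -/
def jumpSet (γ a θ : ℝ) (W : ℝ → ℝ) (r : ℝ) : Set ℝ :=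
  {x | -a < x ∧ x + r < 1 + a ∧ θ * r ^ (1 + γ) < W (x + r) - W x}

/-- The one-dimensional analogue of `levelFunctional 1 γ W θ`, restricted to pairs of points of
`(-a, 1 + a)` and without the factor `θ`. -/
def jumpEnergy (γ a θ : ℝ) (W : ℝ → ℝ) : ℝ≥0∞ :=
  ∫⁻ r in Set.Ioi (0 : ℝ), ENNReal.ofReal (r ^ (γ - 1)) * volume (jumpSet γ a θ W r)

theorem measurableSet_jumpSet (hW : Measurable W) :
    MeasurableSet {z : ℝ × ℝ | z.2 ∈ jumpSet γ a θ W z.1} :=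
  (measurableSet_lt measurable_const measurable_snd).inter <|
    (measurableSet_lt (measurable_snd.add measurable_fst) measurable_const).inter <|
      measurableSet_lt (f := fun z : ℝ × ℝ => θ * z.1 ^ (1 + γ))
        (g := fun z => W (z.2 + z.1) - W z.2) (by fun_prop) (by fun_prop)

theorem IsRamp.Ioo_subset_jumpSet (hW : IsRamp W) {b : ℝ} (hWb : ∀ x, b ≤ x → W x = 1)
    (hrb : r - b ≤ a) (hra : r ≤ 1 + a) (hr : θ * r ^ (1 + γ) < 1) :
    Set.Ioo (b - r) 0 ⊆ jumpSet γ a θ W r := by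
  rintro x ⟨hx, hx0⟩
  refine ⟨by linarith, by linarith, ?_⟩
  rwa [hWb _ (by linarith), hW.eq_zero _ hx0.le, sub_zero]

end Ramps

section Doubling

variable {γ ρ a θ r : ℝ} {W : ℝ → ℝ}

/-- Two half-size copies of `W`, contracted by `ρ` to the ends of `[0, 1]`. Iterating this
operation produces `C¹` approximations of a Cantor function. -/
def doubleRamp (ρ : ℝ) (W : ℝ → ℝ) (x : ℝ) : ℝ :=
  (W (x / ρ) + W ((x - (1 - ρ)) / ρ)) / 2

theorem IsRamp.doubleRamp (hW : IsRamp W) (hρ : 0 < ρ) (hρ1 : ρ ≤ 1) :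
    IsRamp (doubleRamp ρ W) where
  contDiff := ((hW.contDiff.comp (contDiff_id.div_const ρ)).add
    (hW.contDiff.comp ((contDiff_id.sub contDiff_const).div_const ρ))).div_const 2
  mono x y h := by
    have h₁ : W (x / ρ) ≤ W (y / ρ) := hW.mono (by gcongr)
    have h₂ : W ((x - (1 - ρ)) / ρ) ≤ W ((y - (1 - ρ)) / ρ) := hW.mono (by gcongr)
    simp only [WeightedReverse.doubleRamp]
    linarith
  eq_zero x hx := by
    rw [WeightedReverse.doubleRamp, hW.eq_zero _ (div_nonpos_of_nonpos_of_nonneg hx hρ.le),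
      hW.eq_zero _ (div_nonpos_of_nonpos_of_nonneg (by linarith) hρ.le), add_zero, zero_div]
  eq_one x hx := by
    rw [WeightedReverse.doubleRamp, hW.eq_one _ ((one_le_div hρ).2 (hρ1.trans hx)),
      hW.eq_one _ ((one_le_div hρ).2 (by linarith)), one_add_one_eq_two, div_self two_ne_zero]

theorem sub_div_mem_jumpSet_iff (hρ : 0 < ρ) (hργ : ρ ^ (1 + γ) = 1 / 2) (hr : 0 < r) (x c : ℝ) :
    (x - c) / ρ ∈ jumpSet γ a θ W (r / ρ) ↔ c - ρ * a < x ∧ x + r < c + ρ * (1 + a) ∧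
      2 * (θ * r ^ (1 + γ)) < W ((x + r - c) / ρ) - W ((x - c) / ρ) := by
  have hadd : (x - c) / ρ + r / ρ = (x + r - c) / ρ := by rw [← add_div]; congr 1; ring
  have hpow : θ * (r / ρ) ^ (1 + γ) = 2 * (θ * r ^ (1 + γ)) := by
    rw [Real.div_rpow hr.le hρ.le, hργ]; ring
  rw [jumpSet, Set.mem_ofPred_eq, hadd, hpow, lt_div_iff₀ hρ, div_lt_iff₀ hρ]
  constructor <;> rintro ⟨h₁, h₂, h₃⟩ <;> exact ⟨by linarith, by linarith, h₃⟩

theorem mem_jumpSet_doubleRamp_of_left (hW : Monotone W) (hρ : 0 < ρ)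
    (hργ : ρ ^ (1 + γ) = 1 / 2) (ha : 0 < a) (hρa : ρ * (1 + a) = 1 / 2) (hr : 0 < r) {x : ℝ}
    (hx : (x - 0) / ρ ∈ jumpSet γ a θ W (r / ρ)) :
    x + r < 1 / 2 ∧ x ∈ jumpSet γ a θ (doubleRamp ρ W) r := by
  obtain ⟨h₁, h₂, h₃⟩ := (sub_div_mem_jumpSet_iff hρ hργ hr x 0).1 hx
  have hright : W ((x - (1 - ρ)) / ρ) ≤ W ((x + r - (1 - ρ)) / ρ) := hW (by gcongr; linarith)
  refine ⟨by linarith, by nlinarith, by linarith, ?_⟩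
  simp only [doubleRamp, sub_zero] at h₃ ⊢
  linarith

theorem mem_jumpSet_doubleRamp_of_right (hW : Monotone W) (hρ : 0 < ρ)
    (hργ : ρ ^ (1 + γ) = 1 / 2) (ha : 0 < a) (hρa : ρ * (1 + a) = 1 / 2) (hr : 0 < r) {x : ℝ}
    (hx : (x - (1 - ρ)) / ρ ∈ jumpSet γ a θ W (r / ρ)) :
    1 / 2 < x ∧ x ∈ jumpSet γ a θ (doubleRamp ρ W) r := by
  obtain ⟨h₁, h₂, h₃⟩ := (sub_div_mem_jumpSet_iff hρ hργ hr x (1 - ρ)).1 hx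
  have hleft : W (x / ρ) ≤ W ((x + r) / ρ) := hW (by gcongr; linarith)
  refine ⟨by linarith, by linarith, by nlinarith, ?_⟩
  simp only [doubleRamp]
  linarith

/-- The doubled ramp inherits the jumps of both copies and gains those across `[0, 1]`, which have
steps `r > 1`. -/
theorem volume_jumpSet_doubleRamp_ge (hW : IsRamp W) (hρ : 0 < ρ) (hργ : ρ ^ (1 + γ) = 1 / 2)
    (ha : 0 < a) (hρa : ρ * (1 + a) = 1 / 2) (hγ : -1 ≤ γ) (hθ₀ : 0 < θ)
    (hθ : θ * (1 + a) ^ (1 + γ) < 1) (hr : 0 < r) :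
    ENNReal.ofReal (2 * ρ) * volume (jumpSet γ a θ W (r / ρ)) +
      (Set.Ioo 1 (1 + a)).indicator (fun r => ENNReal.ofReal (r - 1)) r ≤
      volume (jumpSet γ a θ (doubleRamp ρ W) r) := by
  set S := jumpSet γ a θ W (r / ρ)
  set L : Set ℝ := {x | (x - 0) / ρ ∈ S}
  set R : Set ℝ := {x | (x - (1 - ρ)) / ρ ∈ S}
  have hL x (hx : x ∈ L) := mem_jumpSet_doubleRamp_of_left hW.mono hρ hργ ha hρa hr hx
  have hR x (hx : x ∈ R) := mem_jumpSet_doubleRamp_of_right hW.mono hρ hργ ha hρa hr hx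
  have hRm : MeasurableSet R :=
    ((measurableSet_jumpSet hW.contDiff.continuous.measurable).preimage
      measurable_prodMk_left).preimage (by fun_prop)
  have hLR : Disjoint L R := Set.disjoint_left.2 fun x hxL hxR => by
    linarith [(hL x hxL).1, (hR x hxR).1]
  have hLRvol : ENNReal.ofReal (2 * ρ) * volume S = volume (L ∪ R) := by
    rw [measure_union hLR hRm, volume_setOf_sub_div_mem S _ hρ, volume_setOf_sub_div_mem S _ hρ,
      ← two_mul, ← mul_assoc, ENNReal.ofReal_mul zero_le_two, ENNReal.ofReal_ofNat]
  have hLRsub : L ∪ R ⊆ jumpSet γ a θ (doubleRamp ρ W) r :=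
    Set.union_subset (fun x hx => (hL x hx).2) fun x hx => (hR x hx).2
  rw [hLRvol]
  by_cases h : r ∈ Set.Ioo 1 (1 + a)
  · have hdisj : Disjoint (L ∪ R) (Set.Ioo (1 - r) 0) := by
      refine Set.disjoint_left.2 fun x hx hx' => ?_
      rcases hx with hx | hx
      · linarith [(hL x hx).1, hx'.1]
      · linarith [(hR x hx).1, hx'.2]
    have hT := hW.doubleRamp hρ (by nlinarith : ρ ≤ 1)
    have hsub : Set.Ioo (1 - r) 0 ⊆ jumpSet γ a θ (doubleRamp ρ W) r := by
      refine hT.Ioo_subset_jumpSet hT.eq_one (by linarith [h.2]) h.2.le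
        (lt_of_le_of_lt ?_ hθ)
      gcongr
      exacts [by linarith, h.2.le]
    rw [Set.indicator_of_mem h, show r - 1 = 0 - (1 - r) by ring, ← Real.volume_Ioo,
      ← measure_union hdisj measurableSet_Ioo]
    exact measure_mono (Set.union_subset hLRsub hsub)
  · rw [Set.indicator_of_notMem h, add_zero]
    exact measure_mono hLRsub

theorem lintegral_jumpSet_comp_div (hρ : 0 < ρ) (hργ : ρ ^ (1 + γ) = 1 / 2) :
    ∫⁻ r in Set.Ioi (0 : ℝ), ENNReal.ofReal (r ^ (γ - 1)) *
      (ENNReal.ofReal (2 * ρ) * volume (jumpSet γ a θ W (r / ρ))) = jumpEnergy γ a θ W := by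
  have hpow : ρ ^ (γ - 1) = 1 / 2 / (ρ * ρ) := by
    rw [← hργ, show γ - 1 = 1 + γ - 1 - 1 by ring, Real.rpow_sub_one hρ.ne',
      Real.rpow_sub_one hρ.ne', div_div]
  have hone : ENNReal.ofReal (2 * ρ) * ENNReal.ofReal (ρ ^ (γ - 1)) * ENNReal.ofReal ρ = 1 := by
    rw [← ENNReal.ofReal_mul (by positivity), ← ENNReal.ofReal_mul (by positivity),
      ← ENNReal.ofReal_one, hpow]
    congr 1
    field_simp
  calc _ = ∫⁻ r in Set.Ioi (0 : ℝ), ENNReal.ofReal (2 * ρ) * ENNReal.ofReal (ρ ^ (γ - 1)) *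
        (ENNReal.ofReal ((r / ρ) ^ (γ - 1)) * volume (jumpSet γ a θ W (r / ρ))) := by
        refine setLIntegral_congr_fun measurableSet_Ioi fun r (hr : 0 < r) => ?_
        have hsplit : r ^ (γ - 1) = ρ ^ (γ - 1) * (r / ρ) ^ (γ - 1) := by
          rw [← Real.mul_rpow hρ.le (by positivity), mul_div_cancel₀ r hρ.ne']
        rw [hsplit, ENNReal.ofReal_mul (by positivity)]
        ring
    _ = ENNReal.ofReal (2 * ρ) * ENNReal.ofReal (ρ ^ (γ - 1)) *
        (ENNReal.ofReal ρ * jumpEnergy γ a θ W) := by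
        rw [lintegral_const_mul' _ _ (ENNReal.mul_ne_top ENNReal.ofReal_ne_top
          ENNReal.ofReal_ne_top), lintegral_Ioi_comp_div
          (fun r => ENNReal.ofReal (r ^ (γ - 1)) * volume (jumpSet γ a θ W r)) hρ, jumpEnergy]
    _ = jumpEnergy γ a θ W := by rw [← mul_assoc, hone, one_mul]

theorem jumpEnergy_doubleRamp_ge (hW : IsRamp W) (hρ : 0 < ρ) (hργ : ρ ^ (1 + γ) = 1 / 2)
    (ha : 0 < a) (hρa : ρ * (1 + a) = 1 / 2) (hγ : -1 ≤ γ) (hθ₀ : 0 < θ)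
    (hθ : θ * (1 + a) ^ (1 + γ) < 1) :
    jumpEnergy γ a θ W + ∫⁻ r in Set.Ioo 1 (1 + a), ENNReal.ofReal (r ^ (γ - 1) * (r - 1)) ≤
      jumpEnergy γ a θ (doubleRamp ρ W) := by
  have hgain : ∫⁻ r in Set.Ioo 1 (1 + a), ENNReal.ofReal (r ^ (γ - 1) * (r - 1)) =
      ∫⁻ r in Set.Ioi (0 : ℝ), ENNReal.ofReal (r ^ (γ - 1)) *
        (Set.Ioo 1 (1 + a)).indicator (fun r => ENNReal.ofReal (r - 1)) r := by
    rw [← lintegral_indicator measurableSet_Ioo, ← lintegral_indicator measurableSet_Ioi]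
    refine lintegral_congr fun r => ?_
    by_cases h : r ∈ Set.Ioo 1 (1 + a)
    · have h₀ : 0 < r := one_pos.trans h.1
      rw [Set.indicator_of_mem h, Set.indicator_of_mem (Set.mem_Ioi.2 h₀),
        Set.indicator_of_mem h, ENNReal.ofReal_mul (by positivity)]
    · rw [Set.indicator_of_notMem h]
      simp [Set.indicator, h]
  rw [← lintegral_jumpSet_comp_div hρ hργ, hgain, ← lintegral_add_right, jumpEnergy]
  · refine setLIntegral_mono' measurableSet_Ioi fun r hr => ?_
    rw [← mul_add]
    gcongr
    exact volume_jumpSet_doubleRamp_ge hW hρ hργ ha hρa hγ hθ₀ hθ hr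
  · exact Measurable.mul (by fun_prop) (Measurable.indicator (by fun_prop) measurableSet_Ioo)

theorem exists_contraction (hγ₁ : -1 < γ) (hγ₀ : γ < 0) :
    ∃ ρ a : ℝ, 0 < ρ ∧ 0 < a ∧ ρ ^ (1 + γ) = 1 / 2 ∧ ρ * (1 + a) = 1 / 2 := by
  have hγ : 0 < 1 + γ := by linarith
  set ρ : ℝ := (1 / 2 : ℝ) ^ (1 / (1 + γ))
  have hρ : 0 < ρ := by positivity
  have hρ2 : ρ < 1 / 2 := by
    calc ρ < (1 / 2 : ℝ) ^ (1 : ℝ) := Real.rpow_lt_rpow_of_exponent_gt (by norm_num)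
          (by norm_num) ((lt_div_iff₀ hγ).2 (by linarith))
      _ = 1 / 2 := Real.rpow_one _
  refine ⟨ρ, 1 / (2 * ρ) - 1, hρ, ?_, ?_, by field_simp; ring⟩
  · rw [sub_pos, lt_div_iff₀ (by positivity)]
    linarith
  · rw [← Real.rpow_mul (by norm_num), one_div_mul_cancel hγ.ne', Real.rpow_one]

theorem lintegral_Ioo_rpow_mul_sub_one_pos (ha : 0 < a) (s : ℝ) :
    0 < ∫⁻ r in Set.Ioo 1 (1 + a), ENNReal.ofReal (r ^ s * (r - 1)) := by
  refine setLIntegral_pos_iff (by fun_prop) |>.2 ?_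
  have hsub : Set.Ioo 1 (1 + a) ⊆ Function.support fun r : ℝ => ENNReal.ofReal (r ^ s * (r - 1)) :=
    fun r hr => (ENNReal.ofReal_pos.2 (mul_pos (Real.rpow_pos_of_pos (one_pos.trans hr.1) s)
      (sub_pos.2 hr.1))).ne'
  rw [Set.inter_eq_right.2 hsub]
  simpa using ha

theorem exists_natCast_mul_le_jumpEnergy (hρ : 0 < ρ) (hργ : ρ ^ (1 + γ) = 1 / 2)
    (ha : 0 < a) (hρa : ρ * (1 + a) = 1 / 2) (hγ : -1 ≤ γ) (hθ₀ : 0 < θ)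
    (hθ : θ * (1 + a) ^ (1 + γ) < 1) (k : ℕ) :
    ∃ W, IsRamp W ∧ k * ∫⁻ r in Set.Ioo 1 (1 + a), ENNReal.ofReal (r ^ (γ - 1) * (r - 1)) ≤
      jumpEnergy γ a θ W := by
  induction k with
  | zero => exact ⟨_, isRamp_smoothTransition, by simp⟩
  | succ k ih =>
    obtain ⟨W, hW, h⟩ := ih
    refine ⟨doubleRamp ρ W, hW.doubleRamp hρ (by nlinarith), ?_⟩
    refine le_trans ?_ (jumpEnergy_doubleRamp_ge hW hρ hργ ha hρa hγ hθ₀ hθ)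
    rw [Nat.cast_succ, add_mul, one_mul]
    gcongr

theorem exists_large_jumpEnergy_of_gt (hγ₁ : -1 < γ) (hγ₀ : γ < 0) :
    ∃ a θ : ℝ, 0 < a ∧ 0 < θ ∧ ∀ n : ℕ, ∃ W, IsRamp W ∧ n ≤ jumpEnergy γ a θ W := by
  obtain ⟨ρ, a, hρ, ha, hργ, hρa⟩ := exists_contraction hγ₁ hγ₀
  have hθ : 1 / (2 * (1 + a) ^ (1 + γ)) * (1 + a) ^ (1 + γ) < 1 := by field_simp; norm_num
  refine ⟨a, 1 / (2 * (1 + a) ^ (1 + γ)), ha, by positivity, fun n => ?_⟩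
  obtain ⟨k, hk⟩ := ENNReal.exists_nat_mul_gt
    (lintegral_Ioo_rpow_mul_sub_one_pos ha (γ - 1)).ne' (ENNReal.natCast_ne_top n)
  obtain ⟨W, hW, h⟩ :=
    exists_natCast_mul_le_jumpEnergy hρ hργ ha hρa hγ₁.le (by positivity) hθ k
  exact ⟨W, hW, hk.le.trans h⟩

end Doubling

section SteepRamp

variable {ε : ℝ}

theorem ofReal_log_div_le_jumpEnergy (hε : 0 < ε) (hε1 : 2 * ε ≤ 1) :
    ENNReal.ofReal (Real.log (1 / (2 * ε)) / 2) ≤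
      jumpEnergy (-1) 1 (1 / 2) fun x => Real.smoothTransition (x / ε) := by
  set W : ℝ → ℝ := fun x => Real.smoothTransition (x / ε)
  have hW : IsRamp W := isRamp_smoothTransition.comp_div hε (by linarith)
  have hWε x (hx : ε ≤ x) : W x = 1 :=
    Real.smoothTransition.one_of_one_le ((one_le_div hε).2 hx)
  have hpos r (hr : r ∈ Set.Ioc (2 * ε) 1) : 0 < r := by linarith [hr.1]
  calc ENNReal.ofReal (Real.log (1 / (2 * ε)) / 2)
      = ENNReal.ofReal (∫ r in (2 * ε)..1, r⁻¹ / 2) := by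
        rw [intervalIntegral.integral_div, integral_inv_of_pos (by positivity) one_pos]
    _ = ∫⁻ r in Set.Ioc (2 * ε) 1, ENNReal.ofReal (r⁻¹ / 2) := by
        rw [intervalIntegral.integral_of_le hε1, ofReal_integral_eq_lintegral_ofReal]
        · refine (ContinuousOn.integrableOn_Icc ?_).mono_set Set.Ioc_subset_Icc_self
          refine (continuousOn_inv₀.mono fun r hr => ?_).div_const 2
          exact (by linarith [hr.1] : 0 < r).ne'
        · filter_upwards [ae_restrict_mem measurableSet_Ioc] with r hr
          have := hpos r hr
          positivity
    _ ≤ ∫⁻ r in Set.Ioc (2 * ε) 1, ENNReal.ofReal (r ^ ((-1 : ℝ) - 1)) *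
          volume (jumpSet (-1) 1 (1 / 2) W r) := by
        refine setLIntegral_mono' measurableSet_Ioc fun r hr => ?_
        have h₀ := hpos r hr
        have hsub : Set.Ioo (ε - r) 0 ⊆ jumpSet (-1) 1 (1 / 2) W r :=
          hW.Ioo_subset_jumpSet hWε (by linarith [hr.2])
            (by linarith [hr.2]) (by norm_num)
        refine le_trans ?_ (mul_le_mul' le_rfl (measure_mono hsub))
        rw [Real.volume_Ioo, ← ENNReal.ofReal_mul (by positivity)]
        apply ENNReal.ofReal_le_ofReal
        calc r⁻¹ / 2 = r ^ ((-1 : ℝ) - 1) * (r / 2) := by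
              rw [Real.rpow_sub_one h₀.ne', Real.rpow_neg_one]
              field_simp
          _ ≤ r ^ ((-1 : ℝ) - 1) * (0 - (ε - r)) := by gcongr; linarith [hr.1]
    _ ≤ jumpEnergy (-1) 1 (1 / 2) W := lintegral_mono_set hpos

theorem exists_large_jumpEnergy_neg_one (n : ℕ) :
    ∃ W, IsRamp W ∧ n ≤ jumpEnergy (-1) 1 (1 / 2) W := by
  have hexp : Real.exp (-(2 * n)) ≤ 1 := Real.exp_le_one_iff.2 (by simp)
  refine ⟨fun x => Real.smoothTransition (x / (Real.exp (-(2 * n)) / 2)),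
    isRamp_smoothTransition.comp_div (by positivity) (by linarith), ?_⟩
  have h := ofReal_log_div_le_jumpEnergy (ε := Real.exp (-(2 * n)) / 2) (by positivity)
    (by linarith)
  rwa [mul_div_cancel₀ _ two_ne_zero, one_div, ← Real.exp_neg, neg_neg, Real.log_exp,
    mul_div_cancel_left₀ _ two_ne_zero, ENNReal.ofReal_natCast] at h

end SteepRamp

theorem exists_large_jumpEnergy {γ : ℝ} (hγ₁ : -1 ≤ γ) (hγ₀ : γ < 0) :
    ∃ a θ : ℝ, 0 < a ∧ 0 < θ ∧ ∀ n : ℕ, ∃ W, IsRamp W ∧ n ≤ jumpEnergy γ a θ W := by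
  rcases hγ₁.lt_or_eq with h | rfl
  · exact exists_large_jumpEnergy_of_gt h hγ₀
  · exact ⟨1, 1 / 2, one_pos, by norm_num, exists_large_jumpEnergy_neg_one⟩

section Dilation

variable {N : ℕ} {γ c lam : ℝ} {u : Euc N → ℝ}

theorem norm_smul_rpow (hc : 0 < c) (h : Euc N) (s : ℝ) : ‖c • h‖ ^ s = c ^ s * ‖h‖ ^ s := by
  rw [norm_smul, Real.norm_eq_abs, abs_of_pos hc, Real.mul_rpow hc.le (norm_nonneg _)]

theorem ofReal_mul_volume_translate_comp_smul (γ b : ℝ) (hc : 0 < c) (lam : ℝ) (u : Euc N → ℝ)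
    (h : Euc N) :
    ENNReal.ofReal (‖h‖ ^ (γ - N)) *
        volume {x | c ^ b * lam * ‖h‖ ^ b < |u (c • (x + h)) - u (c • x)|} =
      ENNReal.ofReal (c ^ (-γ)) * (ENNReal.ofReal (‖c • h‖ ^ (γ - N)) *
        volume {x | lam * ‖c • h‖ ^ b < |u (x + c • h) - u x|}) := by
  have hset : {x | c ^ b * lam * ‖h‖ ^ b < |u (c • (x + h)) - u (c • x)|} =
      (c • ·) ⁻¹' {x | lam * ‖c • h‖ ^ b < |u (x + c • h) - u x|} := by
    ext x
    simp only [Set.mem_preimage, Set.mem_ofPred_eq, norm_smul_rpow hc, smul_add, mul_assoc,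
      mul_left_comm lam]
  have hpow : ‖h‖ ^ (γ - N) * |(c ^ N)⁻¹| = c ^ (-γ) * ‖c • h‖ ^ (γ - N) := by
    rw [norm_smul_rpow hc, ← mul_assoc, ← Real.rpow_add hc, abs_of_pos (by positivity),
      ← Real.rpow_natCast, ← Real.rpow_neg hc.le, mul_comm]
    congr 2
    ring
  rw [hset, Measure.addHaar_preimage_smul volume hc.ne', finrank_euclideanSpace_fin, ← mul_assoc,
    ← ENNReal.ofReal_mul (by positivity), hpow, ENNReal.ofReal_mul (by positivity), mul_assoc]

theorem levelFunctional_comp_smul {p : ℝ} (hp : p ≠ 0) (γ : ℝ) (hu : Measurable u) (hc : 0 < c)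
    (hlam : 0 ≤ lam) :
    levelFunctional p γ (fun x => u (c • x)) (c ^ (1 + γ / p) * lam) =
      ENNReal.ofReal (c ^ (p - N)) * levelFunctional p γ u lam := by
  have hcu : Measurable fun x => u (c • x) := hu.comp (measurable_const_smul c)
  have hlevel : (c ^ (1 + γ / p) * lam) ^ p * c ^ (-γ) * |(c ^ N)⁻¹| = c ^ (p - N) * lam ^ p := by
    rw [Real.mul_rpow (by positivity) hlam, ← Real.rpow_mul hc.le, add_mul, one_mul,
      div_mul_cancel₀ _ hp, abs_of_pos (by positivity), ← Real.rpow_natCast, ← Real.rpow_neg hc.le,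
      mul_right_comm (c ^ (p + γ)), ← Real.rpow_add hc, mul_right_comm, ← Real.rpow_add hc]
    congr 2
    ring
  rw [levelFunctional_eq_lintegral hcu p γ (by positivity),
    levelFunctional_eq_lintegral hu p γ hlam]
  simp only [ofReal_mul_volume_translate_comp_smul γ _ hc]
  rw [lintegral_const_mul' _ _ ENNReal.ofReal_ne_top,
    lintegral_comp_smul volume (fun h => ENNReal.ofReal (‖h‖ ^ (γ - N)) *
      volume {x | lam * ‖h‖ ^ (1 + γ / p) < |u (x + h) - u x|}) hc.ne',
    finrank_euclideanSpace_fin, ← mul_assoc, ← mul_assoc, ← ENNReal.ofReal_mul (by positivity),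
    ← ENNReal.ofReal_mul (by positivity), hlevel, ENNReal.ofReal_mul (by positivity), mul_assoc]

theorem gradNorm_one_eq_lintegral (hu : ContDiff ℝ 1 u) :
    gradNorm 1 u = ∫⁻ x, ‖fderiv ℝ u x‖ₑ := by
  rw [(hasWeakGradient_gradient hu).gradNorm_eq, eLpNorm_one_eq_lintegral_enorm]
  simp only [gradient, LinearIsometryEquiv.enorm_map]

theorem memHomSobolev_of_contDiff (hu : ContDiff ℝ 1 u) (hc : HasCompactSupport u) (p : ℝ≥0∞) :
    MemHomSobolev p u :=
  ⟨gradient u, hasWeakGradient_gradient hu,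
    (continuous_gradient_of_contDiff_one hu).memLp_of_hasCompactSupport
      (hasCompactSupport_gradient hc)⟩

theorem gradNorm_one_comp_smul (hu : ContDiff ℝ 1 u) (hc : 0 < c) :
    gradNorm 1 (fun x => u (c • x)) = ENNReal.ofReal (c ^ (1 - N : ℝ)) * gradNorm 1 u := by
  have hcu : ContDiff ℝ 1 fun x => u (c • x) := hu.comp (contDiff_const_smul c)
  rw [gradNorm_one_eq_lintegral hu, gradNorm_one_eq_lintegral hcu]
  simp only [fderiv_comp_smul, enorm_smul]
  rw [lintegral_const_mul' _ _ enorm_ne_top,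
    lintegral_comp_smul volume (fun x => ‖fderiv ℝ u x‖ₑ) hc.ne', ← mul_assoc,
    Real.enorm_eq_ofReal hc.le, ← ENNReal.ofReal_mul hc.le, finrank_euclideanSpace_fin,
    abs_of_pos (by positivity), Real.rpow_sub hc, Real.rpow_one, Real.rpow_natCast, div_eq_mul_inv]

/-- The dilation of `u` by the factor `c⁻¹`, normalized so as to preserve `‖∇u‖_{L¹}`. -/
def dilate (c : ℝ) (u : Euc N → ℝ) : Euc N → ℝ := c ^ (N - 1 : ℝ) • fun x => u (c • x)

theorem contDiff_dilate (hu : ContDiff ℝ 1 u) (c : ℝ) : ContDiff ℝ 1 (dilate c u) :=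
  contDiff_const.smul (hu.comp (contDiff_const_smul c))

theorem hasCompactSupport_dilate (hu : HasCompactSupport u) (hc : c ≠ 0) :
    HasCompactSupport (dilate c u) :=
  (hu.comp_homeomorph (Homeomorph.smulOfNeZero c hc)).smul_left (f := fun _ => c ^ (N - 1 : ℝ))

theorem gradNorm_one_dilate (hu : ContDiff ℝ 1 u) (hus : HasCompactSupport u) (hc : 0 < c) :
    gradNorm 1 (dilate c u) = gradNorm 1 u := by
  have hmem : MemHomSobolev 1 fun x => u (c • x) :=
    memHomSobolev_of_contDiff (hu.comp (contDiff_const_smul c))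
      (hus.comp_homeomorph (Homeomorph.smulOfNeZero c hc.ne')) 1
  rw [dilate, hmem.gradNorm_const_smul, gradNorm_one_comp_smul hu hc, ← mul_assoc,
    Real.enorm_eq_ofReal (by positivity), ← ENNReal.ofReal_mul (by positivity),
    ← Real.rpow_add hc, sub_add_sub_cancel, sub_self, Real.rpow_zero,
    ENNReal.ofReal_one, one_mul]

theorem levelFunctional_one_dilate (γ : ℝ) (hu : Measurable u) (hc : 0 < c) (hlam : 0 ≤ lam) :
    levelFunctional 1 γ (dilate c u) (c ^ (N + γ) * lam) = levelFunctional 1 γ u lam := by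
  have hlevel : c ^ (N + γ) * lam = c ^ (N - 1 : ℝ) * (c ^ (1 + γ / 1) * lam) := by
    rw [← mul_assoc, ← Real.rpow_add hc]
    congr 2
    ring
  rw [dilate, hlevel, levelFunctional_const_smul _ _ _ (by positivity) (by positivity),
    levelFunctional_comp_smul one_ne_zero γ hu hc hlam, Real.rpow_one, ← mul_assoc,
    ← ENNReal.ofReal_mul (by positivity),
    ← Real.rpow_add hc, sub_add_sub_cancel, sub_self, Real.rpow_zero, ENNReal.ofReal_one, one_mul]

theorem ofReal_rpow_mul_levelFunctional_le (p γ : ℝ) (u : Euc N → ℝ) {θ : ℝ} (hlam : 0 < lam)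
    (h : lam ≤ θ) :
    ENNReal.ofReal ((lam / θ) ^ p) * levelFunctional p γ u θ ≤ levelFunctional p γ u lam := by
  have hθ : 0 < θ := hlam.trans_le h
  have hsub : superlevel θ (γ / p) u ⊆ superlevel lam (γ / p) u :=
    fun _ hz => ⟨hz.1, h.trans_lt hz.2⟩
  rw [levelFunctional, ← mul_assoc, ← ENNReal.ofReal_mul (by positivity),
    ← Real.mul_rpow (by positivity) hθ.le, div_mul_cancel₀ _ hθ.ne', levelFunctional]
  gcongr

end Dilation

/-! ### From ramps on the line to functions on `ℝ^N` -/

section ConsCoord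

variable {n : ℕ}

/-- Splitting of `ℝ^(n + 1)` into the first coordinate and the others. -/
def consCoord (n : ℕ) : (ℝ × (Fin n → ℝ)) ≃ᵐ Euc (n + 1) :=
  (MeasurableEquiv.piFinSuccAbove (fun _ => ℝ) 0).symm.trans (MeasurableEquiv.toLp 2 _)

theorem measurePreserving_consCoord (n : ℕ) : MeasurePreserving (consCoord n) :=
  (PiLp.volume_preserving_toLp _).comp
    (volume_preserving_piFinSuccAbove (fun _ : Fin (n + 1) => ℝ) 0).symm

@[simp] theorem consCoord_zero (z : ℝ × (Fin n → ℝ)) : consCoord n z 0 = z.1 := rfl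

@[simp] theorem consCoord_succ (z : ℝ × (Fin n → ℝ)) (i : Fin n) :
    consCoord n z i.succ = z.2 i := rfl

theorem consCoord_add (z z' : ℝ × (Fin n → ℝ)) :
    consCoord n (z + z') = consCoord n z + consCoord n z' := by
  ext i
  refine Fin.cases ?_ (fun j => ?_) i <;> simp

theorem norm_le_natCast_mul {N : ℕ} (x : Euc N) {B : ℝ} (h : ∀ i, |x i| ≤ B) : ‖x‖ ≤ N * B := by
  have hx : x = ∑ i, EuclideanSpace.single i (x i) := by
    ext j
    simp
  calc ‖x‖ ≤ ∑ i, ‖EuclideanSpace.single i (x i)‖ := by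
        conv_lhs => rw [hx]
        exact norm_sum_le _ _
    _ ≤ ∑ _i : Fin N, B := by gcongr with i; simpa using h i
    _ = N * B := by simp

theorem norm_consCoord_le {z : ℝ × (Fin n → ℝ)} {B : ℝ} (h₁ : |z.1| ≤ B) (h₂ : ∀ i, |z.2 i| ≤ B) :
    ‖consCoord n z‖ ≤ (n + 1 : ℕ) * B :=
  norm_le_natCast_mul _ fun i => Fin.cases h₁ h₂ i

theorem lintegral_eq_lintegral_consCoord {f : Euc (n + 1) → ℝ≥0∞} (hf : Measurable f) :
    ∫⁻ x, f x = ∫⁻ t, ∫⁻ y, f (consCoord n (t, y)) := by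
  rw [← (measurePreserving_consCoord n).lintegral_comp hf, Measure.volume_eq_prod,
    lintegral_prod (fun z => f (consCoord n z)) (by fun_prop)]

theorem setLIntegral_tube (n : ℕ) {f : ℝ → ℝ≥0∞} (hf : Measurable f) (R : ℝ) :
    ∫⁻ x in {x : Euc (n + 1) | ∀ i : Fin n, |x i.succ| ≤ R}, f (x 0) =
      ENNReal.ofReal (2 * R) ^ n * ∫⁻ t, f t := by
  have hpre : consCoord n ⁻¹' {x | ∀ i : Fin n, |x i.succ| ≤ R} =
      Set.univ ×ˢ Set.Icc (fun _ => -R) fun _ => R := by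
    ext z
    simp [Pi.le_def, abs_le, forall_and]
  rw [← (measurePreserving_consCoord n).setLIntegral_comp_preimage_emb
    (consCoord n).measurableEmbedding, hpre, Measure.volume_eq_prod, ← Measure.prod_restrict,
    Measure.restrict_univ]
  simp only [consCoord_zero]
  rw [lintegral_prod (fun z => f z.1) (by fun_prop)]
  simp only [lintegral_const, Measure.restrict_apply_univ, Real.volume_Icc_pi, sub_neg_eq_add,
    Finset.prod_const, Finset.card_univ, Fintype.card_fin]
  rw [lintegral_mul_const _ hf, mul_comm, two_mul]

end ConsCoord

section LevelFunctional

variable {n : ℕ} {γ a θ : ℝ} {W : ℝ → ℝ} {w : Euc (n + 1) → ℝ}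

theorem volume_jumpSet_le_volume_translate (hγ : -1 ≤ γ) (ha : 0 < a) (hθ : 0 < θ)
    (hw : ∀ x : Euc (n + 1), ‖x‖ ≤ (n + 1 : ℕ) * (2 + 2 * a) → w x = W (x 0)) {t : ℝ} (ht : 0 < t)
    {k : Fin n → ℝ} (hk : k ∈ Set.Icc 0 fun _ => t) :
    volume (jumpSet γ a θ W t) ≤ volume {x | θ / (n + 1 : ℕ) ^ (1 + γ) *
      ‖consCoord n (t, k)‖ ^ (1 + γ) < |w (x + consCoord n (t, k)) - w x|} := by
  have hprod : volume (jumpSet γ a θ W t) =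
      volume (jumpSet γ a θ W t ×ˢ Set.Icc (0 : Fin n → ℝ) 1) := by
    rw [Measure.volume_eq_prod, Measure.prod_prod, Real.volume_Icc_pi]
    simp
  have hnorm : ‖consCoord n (t, k)‖ ≤ (n + 1 : ℕ) * t :=
    norm_consCoord_le (abs_of_pos ht).le fun i => (abs_of_nonneg (hk.1 i)).trans_le (hk.2 i)
  rw [hprod, ← (measurePreserving_consCoord n).measure_preimage_emb
    (consCoord n).measurableEmbedding]
  refine measure_mono fun ⟨s, y⟩ ⟨⟨(hs : -a < s), (hst : s + t < 1 + a), hjump⟩, hy⟩ => ?_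
  have hy i : 0 ≤ y i ∧ y i ≤ 1 := ⟨hy.1 i, hy.2 i⟩
  have hk i : 0 ≤ k i ∧ k i ≤ t := ⟨hk.1 i, hk.2 i⟩
  have hx : w (consCoord n (s, y)) = W s := hw _ <| norm_consCoord_le
    (abs_le.2 ⟨by linarith, by linarith⟩)
    fun i => abs_le.2 ⟨by linarith [hy i], by linarith [hy i]⟩
  have hxt : w (consCoord n (s, y) + consCoord n (t, k)) = W (s + t) := by
    rw [← consCoord_add, Prod.mk_add_mk]
    exact hw _ <| norm_consCoord_le (abs_le.2 ⟨by linarith, by linarith⟩) fun i =>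
      abs_le.2 ⟨by linarith [Pi.add_apply y k i, hy i, hk i],
        by linarith [Pi.add_apply y k i, hy i, hk i]⟩
  have hpow : 0 ≤ 1 + γ := by linarith
  rw [Set.mem_preimage, Set.mem_ofPred_eq, hx, hxt]
  calc θ / (n + 1 : ℕ) ^ (1 + γ) * ‖consCoord n (t, k)‖ ^ (1 + γ)
      ≤ θ / (n + 1 : ℕ) ^ (1 + γ) * ((n + 1 : ℕ) * t) ^ (1 + γ) := by gcongr
    _ = θ * t ^ (1 + γ) := by
        rw [Real.mul_rpow (by positivity) ht.le]
        field_simp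
    _ < W (s + t) - W s := hjump
    _ ≤ |W (s + t) - W s| := le_abs_self _

theorem jumpEnergy_eq_lintegral_cube (γ a θ : ℝ) (W : ℝ → ℝ) (n : ℕ) {M : ℝ} (hM : 0 ≤ M) :
    ENNReal.ofReal (M ^ (γ - (n + 1 : ℕ))) * jumpEnergy γ a θ W =
      ∫⁻ t in Set.Ioi (0 : ℝ), ∫⁻ _ in Set.Icc (0 : Fin n → ℝ) fun _ => t,
        ENNReal.ofReal ((M * t) ^ (γ - (n + 1 : ℕ))) * volume (jumpSet γ a θ W t) := by
  rw [jumpEnergy, ← lintegral_const_mul' _ _ ENNReal.ofReal_ne_top]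
  refine setLIntegral_congr_fun measurableSet_Ioi fun t (ht : 0 < t) => ?_
  have hpow : M ^ (γ - (n + 1 : ℕ)) * t ^ (γ - 1) = (M * t) ^ (γ - (n + 1 : ℕ)) * t ^ n := by
    rw [Real.mul_rpow hM ht.le, ← Real.rpow_natCast t n, mul_assoc, ← Real.rpow_add ht]
    congr 2
    push_cast
    ring
  rw [setLIntegral_const, Real.volume_Icc_pi, ← mul_assoc, ← ENNReal.ofReal_mul (by positivity),
    hpow, ENNReal.ofReal_mul (by positivity), ENNReal.ofReal_pow ht.le]
  simp only [Pi.zero_apply, sub_zero, Finset.prod_const, Finset.card_univ, Fintype.card_fin]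
  rw [mul_right_comm]

theorem jumpEnergy_le_levelFunctional (hγ₁ : -1 ≤ γ) (hγ₀ : γ < 0) (ha : 0 < a) (hθ : 0 < θ)
    (hwm : Measurable w)
    (hw : ∀ x : Euc (n + 1), ‖x‖ ≤ (n + 1 : ℕ) * (2 + 2 * a) → w x = W (x 0)) :
    ENNReal.ofReal (θ / (n + 1 : ℕ) ^ (1 + γ)) *
        (ENNReal.ofReal ((n + 1 : ℕ) ^ (γ - (n + 1 : ℕ))) * jumpEnergy γ a θ W) ≤
      levelFunctional 1 γ w (θ / (n + 1 : ℕ) ^ (1 + γ)) := by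
  set F : Euc (n + 1) → ℝ≥0∞ := fun h => ENNReal.ofReal (‖h‖ ^ (γ - (n + 1 : ℕ))) *
    volume {x | θ / (n + 1 : ℕ) ^ (1 + γ) * ‖h‖ ^ (1 + γ) < |w (x + h) - w x|}
  have hF : Measurable F := measurable_volume_translate_gt hwm γ (1 + γ) _
  have hbound t (ht : 0 < t) k (hk : k ∈ Set.Icc (0 : Fin n → ℝ) fun _ => t) :
      ENNReal.ofReal (((n + 1 : ℕ) * t) ^ (γ - (n + 1 : ℕ))) * volume (jumpSet γ a θ W t) ≤
        F (consCoord n (t, k)) := by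
    have hle : ‖consCoord n (t, k)‖ ≤ (n + 1 : ℕ) * t :=
      norm_consCoord_le (abs_of_pos ht).le fun i => (abs_of_nonneg (hk.1 i)).trans_le (hk.2 i)
    have hpos : 0 < ‖consCoord n (t, k)‖ :=
      ht.trans_le ((le_abs_self t).trans (PiLp.norm_apply_le (consCoord n (t, k)) 0))
    have hexp : γ - (n + 1 : ℕ) ≤ 0 := by linarith [Nat.cast_nonneg (α := ℝ) (n + 1)]
    exact mul_le_mul'
      (ENNReal.ofReal_le_ofReal (Real.rpow_le_rpow_of_nonpos hpos hle hexp))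
      (volume_jumpSet_le_volume_translate hγ₁ ha hθ hw ht hk)
  rw [levelFunctional_eq_lintegral hwm 1 γ (by positivity), Real.rpow_one, div_one]
  gcongr
  calc _ = ∫⁻ t in Set.Ioi (0 : ℝ), ∫⁻ _ in Set.Icc (0 : Fin n → ℝ) fun _ => t,
          ENNReal.ofReal (((n + 1 : ℕ) * t) ^ (γ - (n + 1 : ℕ))) *
            volume (jumpSet γ a θ W t) := jumpEnergy_eq_lintegral_cube γ a θ W n (by positivity)
    _ ≤ ∫⁻ t in Set.Ioi (0 : ℝ), ∫⁻ k in Set.Icc (0 : Fin n → ℝ) fun _ => t,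
          F (consCoord n (t, k)) := setLIntegral_mono' measurableSet_Ioi fun t ht =>
        setLIntegral_mono' measurableSet_Icc fun k hk => hbound t ht k hk
    _ ≤ ∫⁻ t, ∫⁻ k, F (consCoord n (t, k)) := (setLIntegral_le_lintegral _ _).trans
        (lintegral_mono fun t => setLIntegral_le_lintegral _ _)
    _ = ∫⁻ h, F h := (lintegral_eq_lintegral_consCoord hF).symm

end LevelFunctional

section GradNorm

variable {n : ℕ} {W : ℝ → ℝ} {ψ : Euc (n + 1) → ℝ} {R : ℝ}

theorem IsRamp.support_deriv_subset (hW : IsRamp W) :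
    Function.support (fun t => ‖deriv W t‖ₑ) ⊆ Set.Ioc 0 1 := by
  refine fun t ht => ⟨?_, ?_⟩ <;> by_contra! h <;> refine ht (enorm_eq_zero.2 ?_)
  · exact IsLocalMin.deriv_eq_zero (.of_forall fun s => (hW.eq_zero t h).trans_le (hW.nonneg s))
  · exact IsLocalMax.deriv_eq_zero (.of_forall fun s => (hW.le_one s).trans_eq
      (hW.eq_one t h.le).symm)

theorem IsRamp.lintegral_enorm_deriv (hW : IsRamp W) : ∫⁻ t, ‖deriv W t‖ₑ = 1 := by
  have hcont : Continuous (deriv W) := hW.contDiff.continuous_deriv le_rfl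
  calc ∫⁻ t, ‖deriv W t‖ₑ = ∫⁻ t in Set.Ioc 0 1, ENNReal.ofReal (deriv W t) := by
        rw [← setLIntegral_eq_of_support_subset hW.support_deriv_subset]
        simp only [Real.enorm_eq_ofReal hW.mono.deriv_nonneg]
    _ = ENNReal.ofReal (∫ t in (0 : ℝ)..1, deriv W t) := by
        rw [intervalIntegral.integral_of_le zero_le_one, ofReal_integral_eq_lintegral_ofReal]
        · exact hcont.integrableOn_Ioc
        · exact .of_forall fun t => hW.mono.deriv_nonneg
    _ = 1 := by
        rw [intervalIntegral.integral_deriv_eq_sub' W rfl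
          (fun x _ => hW.contDiff.differentiable one_ne_zero x) hcont.continuousOn,
          hW.eq_one 1 le_rfl, hW.eq_zero 0 le_rfl, sub_zero, ENNReal.ofReal_one]

theorem enorm_fderiv_ramp_mul_le (hW : IsRamp W) (hψ : ContDiff ℝ 1 ψ) (hψ₁ : ∀ x, |ψ x| ≤ 1)
    (hψR : ∀ x, R ≤ ‖x‖ → ψ x = 0) (x : Euc (n + 1)) :
    ‖fderiv ℝ (fun x => W (x 0) * ψ x) x‖ₑ ≤
      {x : Euc (n + 1) | ∀ i : Fin n, |x i.succ| ≤ R}.indicator (fun x => ‖deriv W (x 0)‖ₑ) x +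
        ‖fderiv ℝ ψ x‖ₑ := by
  set π : Euc (n + 1) →L[ℝ] ℝ := EuclideanSpace.proj 0
  have hfderiv : fderiv ℝ (fun x => W (x 0) * ψ x) x =
      W (x 0) • fderiv ℝ ψ x + ψ x • deriv W (x 0) • π :=
    (((hW.contDiff.differentiable one_ne_zero (π x)).hasDerivAt.comp_hasFDerivAt x
      π.hasFDerivAt).mul (hψ.differentiable one_ne_zero x).hasFDerivAt).fderiv
  have hW₁ : ‖W (x 0)‖ₑ ≤ 1 := by
    rw [Real.enorm_eq_ofReal (hW.nonneg _)]
    exact ENNReal.ofReal_le_one.2 (hW.le_one _)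
  have hπ : ‖π‖ₑ ≤ 1 := by
    rw [← ofReal_norm, ENNReal.ofReal_le_one]
    exact π.opNorm_le_bound zero_le_one fun x =>
      (PiLp.norm_apply_le x 0).trans_eq (one_mul _).symm
  have htube : ‖ψ x‖ₑ * ‖deriv W (x 0)‖ₑ ≤
      {x : Euc (n + 1) | ∀ i : Fin n, |x i.succ| ≤ R}.indicator (fun x => ‖deriv W (x 0)‖ₑ) x := by
    rw [Set.indicator_apply]
    split_ifs with hx
    · refine mul_le_of_le_one_left' ?_
      rw [Real.enorm_eq_ofReal_abs]
      exact ENNReal.ofReal_le_one.2 (hψ₁ x)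
    · have hxR : R ≤ ‖x‖ := by
        by_contra! h
        exact hx fun i => (PiLp.norm_apply_le x i.succ).trans h.le
      rw [hψR x hxR, enorm_zero, zero_mul]
  calc ‖fderiv ℝ (fun x => W (x 0) * ψ x) x‖ₑ
      ≤ ‖ψ x‖ₑ * (‖deriv W (x 0)‖ₑ * ‖π‖ₑ) + ‖W (x 0)‖ₑ * ‖fderiv ℝ ψ x‖ₑ := by
        rw [hfderiv, add_comm (‖ψ x‖ₑ * _), ← enorm_smul, ← enorm_smul, ← enorm_smul]
        exact enorm_add_le (W (x 0) • fderiv ℝ ψ x) (ψ x • deriv W (x 0) • π)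
    _ ≤ ‖ψ x‖ₑ * ‖deriv W (x 0)‖ₑ + ‖fderiv ℝ ψ x‖ₑ := by
        gcongr
        exacts [mul_le_of_le_one_right' hπ, mul_le_of_le_one_left' hW₁]
    _ ≤ _ := by gcongr

theorem gradNorm_ramp_mul_le (hW : IsRamp W) (hψ : ContDiff ℝ 1 ψ) (hψ₁ : ∀ x, |ψ x| ≤ 1)
    (hψR : ∀ x, R ≤ ‖x‖ → ψ x = 0) :
    gradNorm 1 (fun x => W (x 0) * ψ x) ≤ ENNReal.ofReal (2 * R) ^ n + gradNorm 1 ψ := by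
  have hWψ : ContDiff ℝ 1 fun x : Euc (n + 1) => W (x 0) * ψ x :=
    (hW.contDiff.comp (EuclideanSpace.proj (𝕜 := ℝ) (0 : Fin (n + 1))).contDiff).mul hψ
  have htube : MeasurableSet {x : Euc (n + 1) | ∀ i : Fin n, |x i.succ| ≤ R} := by
    simp only [Set.ofPred_forall]
    exact .iInter fun i => measurableSet_le (by fun_prop) measurable_const
  rw [gradNorm_one_eq_lintegral hWψ, gradNorm_one_eq_lintegral hψ]
  calc _ ≤ _ := lintegral_mono (enorm_fderiv_ramp_mul_le hW hψ hψ₁ hψR)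
    _ = ENNReal.ofReal (2 * R) ^ n * (∫⁻ t, ‖deriv W t‖ₑ) + ∫⁻ x, ‖fderiv ℝ ψ x‖ₑ := by
        rw [lintegral_add_right _ (hψ.continuous_fderiv one_ne_zero).enorm.measurable,
          lintegral_indicator htube, setLIntegral_tube n (measurable_deriv W).enorm R]
    _ = _ := by rw [hW.lintegral_enorm_deriv, mul_one]

end GradNorm

section LargeLevelFunctional

variable {N : ℕ} {γ : ℝ}

theorem exists_large_levelFunctional_of_contDiff [NeZero N] (hγ₁ : -1 ≤ γ) (hγ₀ : γ < 0) :
    ∃ (K : ℝ≥0) (θ : ℝ), 0 < θ ∧ ∀ k : ℕ, ∃ w : Euc N → ℝ, ContDiff ℝ 1 w ∧ HasCompactSupport w ∧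
      gradNorm 1 w ≤ K ∧ k ≤ levelFunctional 1 γ w θ := by
  obtain ⟨n, rfl⟩ := Nat.exists_eq_succ_of_ne_zero (NeZero.ne N)
  obtain ⟨a, θ, ha, hθ, hlarge⟩ := exists_large_jumpEnergy hγ₁ hγ₀
  set r : ℝ := (n + 1 : ℕ) * (2 + 2 * a)
  have hr : 0 < r := by positivity
  let ψ : ContDiffBump (0 : Euc (n + 1)) := ⟨r, r + 1, hr, lt_add_one r⟩
  have hψ : ContDiff ℝ 1 ψ := ψ.contDiff
  have hψR x (hx : r + 1 ≤ ‖x‖) : ψ x = 0 := ψ.zero_of_le_dist (by rwa [dist_zero_right])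
  have hψr x (hx : ‖x‖ ≤ r) : ψ x = 1 :=
    ψ.one_of_mem_closedBall (by rwa [mem_closedBall_zero_iff])
  have hK : ENNReal.ofReal (2 * (r + 1)) ^ n + gradNorm 1 ψ ≠ ⊤ := ENNReal.add_ne_top.2
    ⟨ENNReal.pow_ne_top ENNReal.ofReal_ne_top,
      (memHomSobolev_of_contDiff hψ ψ.hasCompactSupport 1).gradNorm_ne_top⟩
  set θ' : ℝ := θ / (n + 1 : ℕ) ^ (1 + γ)
  have hθ' : 0 < θ' := by positivity
  refine ⟨(ENNReal.ofReal (2 * (r + 1)) ^ n + gradNorm 1 ψ).toNNReal, θ', hθ', fun k => ?_⟩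
  set A : ℝ≥0∞ := ENNReal.ofReal θ' * ENNReal.ofReal ((n + 1 : ℕ) ^ (γ - (n + 1 : ℕ)))
  have hA : A ≠ 0 := mul_ne_zero (ENNReal.ofReal_pos.2 hθ').ne'
    (ENNReal.ofReal_pos.2 (by positivity)).ne'
  obtain ⟨m, hm⟩ := ENNReal.exists_nat_mul_gt hA (ENNReal.natCast_ne_top k)
  obtain ⟨W, hW, hWm⟩ := hlarge m
  have hw : ContDiff ℝ 1 fun x : Euc (n + 1) => W (x 0) * ψ x :=
    (hW.contDiff.comp (EuclideanSpace.proj (𝕜 := ℝ) (0 : Fin (n + 1))).contDiff).mul hψ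
  refine ⟨_, hw, ψ.hasCompactSupport.mul_left,
    (gradNorm_ramp_mul_le hW hψ (fun x => ?_) hψR).trans_eq (ENNReal.coe_toNNReal hK).symm, ?_⟩
  · exact (abs_of_nonneg ψ.nonneg).trans_le ψ.le_one
  calc (k : ℝ≥0∞) ≤ A * jumpEnergy γ a θ W := by
        rw [mul_comm]
        exact hm.le.trans (by gcongr)
    _ ≤ levelFunctional 1 γ (fun x => W (x 0) * ψ x) θ' := by
        rw [mul_assoc]
        exact jumpEnergy_le_levelFunctional hγ₁ hγ₀ ha hθ hw.continuous.measurable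
          fun x hx => by rw [hψr x hx, mul_one]

theorem exists_large_levelFunctional [NeZero N] (hγ₁ : -1 ≤ γ) (hγ₀ : γ < 0) :
    ∃ K : ℝ≥0, ∀ k : ℕ, ∀ δ : ℝ, 0 < δ → ∃ w : Euc N → ℝ, MemHomSobolev 1 w ∧ gradNorm 1 w ≤ K ∧
      ∃ lam ∈ Set.Ioo 0 δ, k ≤ levelFunctional 1 γ w lam := by
  obtain ⟨K, θ, hθ, hlarge⟩ := exists_large_levelFunctional_of_contDiff (N := N) hγ₁ hγ₀
  refine ⟨K, fun k δ hδ => ?_⟩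
  rcases hγ₁.lt_or_eq with hγ | rfl
  · -- A dilation keeps the energy and the level functional while moving the level towards `0`.
    obtain ⟨w, hw, hws, hwK, hwk⟩ := hlarge k
    have hN : (1 : ℝ) ≤ N := by exact_mod_cast NeZero.one_le
    have hlevel : Tendsto (fun c : ℝ => c ^ (N + γ) * θ) (𝓝[>] 0) (𝓝 0) := by
      have h := (Real.continuousAt_rpow_const 0 (N + γ) (.inr (by linarith))).tendsto
      rw [Real.zero_rpow (by linarith)] at h
      simpa using (h.mono_left nhdsWithin_le_nhds).mul_const θ
    obtain ⟨c, hcδ, hc : 0 < c⟩ :=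
      ((hlevel.eventually (gt_mem_nhds hδ)).and self_mem_nhdsWithin).exists
    refine ⟨dilate c w, memHomSobolev_of_contDiff (contDiff_dilate hw c)
      (hasCompactSupport_dilate hws hc.ne') 1, (gradNorm_one_dilate hw hws hc).trans_le hwK,
      c ^ (N + γ) * θ, ⟨by positivity, hcδ⟩, ?_⟩
    rwa [levelFunctional_one_dilate γ hw.continuous.measurable hc hθ.le]
  · -- At a fixed level there is no bound either, and lowering the level costs a fixed factor.
    set lam : ℝ := min (δ / 2) θ
    have hlam : 0 < lam := by positivity
    have hfactor : ENNReal.ofReal ((lam / θ) ^ (1 : ℝ)) ≠ 0 :=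
      (ENNReal.ofReal_pos.2 (by positivity)).ne'
    obtain ⟨m, hm⟩ := ENNReal.exists_nat_mul_gt hfactor (ENNReal.natCast_ne_top k)
    obtain ⟨w, hw, hws, hwK, hwm⟩ := hlarge m
    refine ⟨w, memHomSobolev_of_contDiff hw hws 1, hwK, lam,
      ⟨hlam, (min_le_left _ _).trans_lt (half_lt_self hδ)⟩, ?_⟩
    calc (k : ℝ≥0∞) ≤ ENNReal.ofReal ((lam / θ) ^ (1 : ℝ)) * levelFunctional 1 (-1) w θ := by
          rw [mul_comm]
          exact hm.le.trans (by gcongr)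
      _ ≤ levelFunctional 1 (-1) w lam :=
          ofReal_rpow_mul_levelFunctional_le 1 (-1) w hlam (min_le_right _ _)

end LargeLevelFunctional

end WeightedReverse

end

open WeightedReverse in
theorem theorem1p1 (N : ℕ) (hN : 1 ≤ N) (p γ : ℝ) (hp : 1 ≤ p) (hγ : γ ≠ 0)
    (e : Euc N) (he : ‖e‖ = 1) :
    -- (a)
    (0 < γ → ∀ u : Euc N → ℝ, MemHomSobolev (ENNReal.ofReal p) u →
      Tendsto (levelFunctional p γ u) atTop
        (𝓝 (ENNReal.ofReal (kappa p e / |γ|) * gradNorm (ENNReal.ofReal p) u ^ p))) ∧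
    -- (b)
    ((γ < 0 ∧ 1 < p) ∨ (γ < -1 ∧ p = 1) → ∀ u : Euc N → ℝ, MemHomSobolev (ENNReal.ofReal p) u →
      Tendsto (levelFunctional p γ u) (𝓝[>] 0)
        (𝓝 (ENNReal.ofReal (kappa p e / |γ|) * gradNorm (ENNReal.ofReal p) u ^ p))) ∧
    -- (c)
    (p = 1 → -1 ≤ γ → γ < 0 →
      (∀ u : Euc N → ℝ, ContDiff ℝ 1 u → HasCompactSupport u →
        Tendsto (levelFunctional 1 γ u) (𝓝[>] 0)
          (𝓝 (ENNReal.ofReal (kappa 1 e / |γ|) * gradNorm 1 u))) ∧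
      IsMeagre {u : HomSobolev N 1 |
        Tendsto (levelFunctional 1 γ u.toFun) (𝓝[>] 0)
          (𝓝 (ENNReal.ofReal (kappa 1 e / |γ|) * gradNorm 1 u.toFun))} ∧
      (∀ u : Euc N → ℝ, MemHomSobolev 1 u →
        ENNReal.ofReal (kappa 1 e / |γ|) * gradNorm 1 u ≤
          liminf (levelFunctional 1 γ u) (𝓝[>] 0))) := by
  have hN₀ : NeZero N := ⟨by omega⟩
  have hp₀ : 0 < p := by linarith
  refine ⟨fun h u hu => ?_, fun h u hu => ?_, fun _ h₁ h₀ => ⟨fun u hu hc => ?_, ?_,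
    fun u hu => ?_⟩⟩
  · exact tendsto_levelFunctional (isLevelFilter_atTop hp₀ h) hγ
      (hp.lt_or_eq.imp_right fun h₁ => ⟨h₁.symm, .inl h⟩) he hu
  · rcases h with ⟨h, h₁⟩ | ⟨h, h₁⟩
    · exact tendsto_levelFunctional (isLevelFilter_nhdsGT_zero hp₀ h) hγ (.inl h₁) he hu
    · exact tendsto_levelFunctional (isLevelFilter_nhdsGT_zero hp₀ (by linarith)) hγ
        (.inr ⟨h₁, .inr h⟩) he hu
  · simpa using tendsto_levelFunctional_of_contDiff hγ he (isLevelFilter_nhdsGT_zero one_pos h₀)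
      hu hc
  · obtain ⟨K, hK⟩ := exists_large_levelFunctional (N := N) h₁ h₀
    refine (isMeagre_limsup_levelFunctional_ne_top ENNReal.one_ne_top hK).mono fun u hu => ?_
    exact hu.limsup_eq.trans_ne
      (ENNReal.mul_ne_top ENNReal.ofReal_ne_top u.mem.gradNorm_ne_top)
  · simpa using le_liminf_levelFunctional (isLevelFilter_nhdsGT_zero one_pos h₀) le_rfl hγ he
      (u := u) (by simpa using hu)
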